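/- **Normal o-graphs.** An oriented virtual link diagram is considered up to planar isotopy and Reidemeister type moves involving virtual crossings; so it is given by a finite set of signed real crossings, each with an over-strand and an under-strand, and by oriented edges joining the outgoing half-edges to the incoming ones (as well as closed curves without crossings). Such a class is a *normal o-graph*. An *integral* normal o-graph has an integer weight on each edge; when an edge is cut into segments by marked points, the weight of the edge is the sum of the weights of its segments. **Circuits.** A normal o-graph represents a branched polyhedron $P$, whose 0-cells and 1-cells are the crossings and the edges. Along each edge run three lines, numbered $1,2,3$; the boundaries of the 2-cells are the circuits obtained by joining them at the crossings. The oriented boundary of a 2-cell follows lines $1,2$ in the direction of the edge and line $3$ in the opposite direction. Write $o_i,u_i$ for the line $i$ of the over- and the under-strand at a crossing, on the half-edge which the boundary uses: it arrives on an incoming half-edge if $i=1,2$ and on an outgoing one if $i=3$; it leaves on an outgoing half-edge if $i=1,2$ and on an incoming one if $i=3$. At a positive crossing arriving and leaving lines are joined by $o_1\to u_2,\ o_2\to o_2,\ o_3\to u_3,\ u_1\to u_1,\ u_2\to o_3,\ u_3\to o_1$, and at a negative crossing by $o_1\to u_3,\ o_2\to o_2,\ o_3\to u_2,\ u_1\to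 u_1,\ u_2\to o_1,\ u_3\to o_3$. A *dot* lies at each of the corners $u_2\to o_3$, $u_3\to o_1$ of positive crossings and $o_1\to u_3$, $o_3\to u_2$ of negative ones. **Closed and framed normal o-graphs.** A normal o-graph is *closed* if the boundary of the thickening $M(P)$ is a 2-sphere on which the vector field transverse to $P$ is tangent along a single circle. Combinatorially: going straight through all crossings one obtains a single curve; the number of circuits is the number of crossings plus one; and the boundary surface is connected, i.e. all sides (top, bottom) of 2-cells are related by the relation generated, along each edge, by top of line 3 $\sim$ top of line 2, bottom of line 3 $\sim$ bottom of line 1, top of line 1 $\sim$ bottom of line 2. A *framed integral normal o-graph* is a closed integral normal o-graph whose weight cochain $x$ satisfies $\delta x=c_P$, where $(\delta x)(\Delta)$ is the sum of the weights along $\partial\Delta$ with sign $+$ on lines $1,2$ and $-$ on line $3$, and $c_P(\Delta)=-(1-n_\Delta/2)$ with $n_\Delta$ the number of dots on $\partial\Delta$. A *framed normal o-graph* is the image of a framed integral normal o-graph under reduction of the weights mod 2. All moves below are defined on framed integral normal o-graphs; the corresponding *framed* move is the relation on framed normal o-graphs obtained by reducing the weights mod 2 before and after the move. **Local pictures.**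 A local picture with numbered strands is described by the signs of its crossings $0,1,\dots$ and, for each strand (separated by $\mid$), the succession of its passages, $o_i$ or $u_i$ meaning over or under at the crossing $i$ ($\emptyset$ if there is none). Weights are listed successively for the segments of each strand ($0$ alone: all weights are zero). A move replaces a local picture inside an arbitrary normal o-graph by another one, joining the ends of the strands to the outside in the same way; weights on the same edge are added. **The 16 integral MP moves** (all weights before the move are $0$; the weights after the move are given): - A1: $(+,+)\; u_1\mid u_0\mid o_0 o_1\ \longrightarrow\ (+,+,-)\; u_1 u_2\mid o_1 u_0 o_2\mid o_0$; weights $0$. - A2: $(+,-)\; u_1\mid u_0\mid o_0 o_1\ \longrightarrow\ (+,-,+)\; u_2 u_1\mid o_1 u_0 o_2\mid o_0$; weights $0,0,0\mid 0,0,-1,1\mid 0,0$. - A3: $(-,-)\; u_1\mid o_1 o_0\mid u_0\ \longrightarrow\ (-,-,+)\; u_2 u_1\mid o_0\mid o_2 u_0 o_1$; weights $0$. - A4: $(-,+)\; u_1\mid u_0\mid o_1 o_0\ \longrightarrow\ (-,+,-)\; u_1 u_2\mid o_2 u_0 o_1\mid o_0$; weights $0,-1,1\mid 0,0,0,0\mid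 0,0$. - B1: $(-,-)\; u_1 u_0\mid o_1\mid o_0\ \longrightarrow\ (+,-,-)\; u_2\mid u_1 o_2 u_0\mid o_1 o_0$; weights $0$. - B2: $(+,-)\; u_1 u_0\mid o_1\mid o_0\ \longrightarrow\ (-,+,-)\; u_2\mid u_1 o_2 u_0\mid o_0 o_1$; weights $0,0\mid 0,0,-1,1\mid 0,0,0$. - B3: $(+,+)\; u_0 u_1\mid o_1\mid o_0\ \longrightarrow\ (-,+,+)\; u_2\mid u_0 o_2 u_1\mid o_0 o_1$; weights $0$. - B4: $(-,+)\; u_0 u_1\mid o_0\mid o_1\ \longrightarrow\ (+,-,+)\; u_2\mid o_1 o_0\mid u_0 o_2 u_1$; weights $0,0\mid 0,-1,1\mid 0,0,0,0$. - C1: $(-,+)\; u_1\mid u_0 o_1\mid o_0\ \longrightarrow\ (-,+,+)\; u_1 u_2\mid o_2 u_0\mid o_1 o_0$; weights $0$. - C2: $(-,-)\; u_1\mid u_0 o_1\mid o_0\ \longrightarrow\ (-,-,-)\; u_2 u_1\mid o_2 u_0\mid o_1 o_0$; weights $0$. - C3: $(+,+)\; u_1\mid u_0 o_1\mid o_0\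 \longrightarrow\ (+,-,+)\; u_1 u_2\mid o_2 u_0\mid o_0 o_1$; weights $-1,1,0\mid 0,0,0\mid 0,0,0$. - C4: $(+,-)\; u_1\mid u_0 o_1\mid o_0\ \longrightarrow\ (+,+,-)\; u_2 u_1\mid o_2 u_0\mid o_0 o_1$; weights $0$. - D1: $(+,-)\; u_1\mid o_1 u_0\mid o_0\ \longrightarrow\ (+,-,-)\; u_2 u_1\mid u_0 o_2\mid o_0 o_1$; weights $0$. - D2: $(+,+)\; u_1\mid o_1 u_0\mid o_0\ \longrightarrow\ (+,+,+)\; u_1 u_2\mid u_0 o_2\mid o_0 o_1$; weights $0$. - D3: $(-,-)\; u_1\mid o_1 u_0\mid o_0\ \longrightarrow\ (-,+,-)\; u_2 u_1\mid u_0 o_2\mid o_1 o_0$; weights $0,0,0\mid 0,0,0\mid -1,1,0$. - D4: $(-,+)\; u_1\mid o_0\mid o_1 u_0\ \longrightarrow\ (-,-,+)\; u_1 u_2\mid o_1 o_0\mid u_0 o_2$; weights $0$. **The generating moves.** - *Primary integral MP move* (all weights $0$): $(+,+)\; o_0\mid o_1u_0\mid u_1\ \longrightarrow\ (+,+,+)\;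 o_0o_1\mid u_0o_2\mid u_1u_2$. - *Integral H-move*: at a crossing of any sign, increase by $1$ the weights of both incoming half-edges and decrease by $1$ those of both outgoing half-edges. - *Integral pure sliding moves* I, II, III, IV: the first picture consists of two strands $e_1,e_2$ without crossings, which are disjoint segments (possibly of the same edge) of weights $k,l$. The move is allowed if the line $i$ of $e_1$ and the line $j$ of $e_2$ belong to the same circuit, where $(i,j)=(3,2),(3,1),(1,2),(3,3)$, respectively. Follow the oriented boundary of this 2-cell after it leaves $e_1$ on line $i$ until it first arrives at $e_2$ on line $j$; let $p\in\frac12\mathbb Z$ be the sum of the signed weights of the segments strictly in between, minus half the number of dots on the way. Put $a=-p-\frac12$ for I, II and $a=-p-1$ for III, IV (an integer). The picture is replaced by - I: $(+,-)\; o_0o_1\mid u_0u_1$, weights $0,0,k\mid a,0,l-a$; - II: $(-,+)\; u_0u_1\mid o_0o_1$, weights $0,0,k\mid a,0,l-a$; - III: $(-,+)\; o_1o_0\mid u_0u_1$, weights $k,0,0\mid a,1,l-1-a$; - IV: $(+,-)\; u_0u_1\mid o_1o_0$, weights $0,0,k\mid l+1+a,-1,-a$. **Statement.** For each of the 16 types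 of MP moves there is a finite word, depending only on the type, in the primary framed MP move, the framed pure sliding moves I--IV, the framed H-move and their inverses, such that whenever a framed normal o-graph $\Gamma'$ is obtained from a framed normal o-graph $\Gamma$ by a framed MP move of this type, $\Gamma'$ is obtained from $\Gamma$ by performing successively moves of the kinds listed in the word, all intermediate objects being framed normal o-graphs. -/

import Mathlib

namespace OGraph

/-! ### Oriented virtual link diagrams and normal o-graphs

An oriented virtual link diagram is only considered modulo planar isotopy and the Reidemeister
type moves involving virtual crossings, i.e. only the following combinatorial data matter:
the set of real crossings with their signs, and the way in which the outgoing half-edges of the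
real crossings are joined to incoming half-edges.  Edges may moreover carry finitely many marked
points, which cut them into segments; inserting or erasing such points does not change the normal
o-graph, and the weight of an edge is the sum of the weights of its segments. -/

/-- The sign of a real crossing. -/
inductive Sign
  | pos
  | neg
  deriving DecidableEq

/-- The two strands passing through a real crossing. -/
inductive Strand
  | upper
  | lower
  deriving DecidableEq

/-- The ports of a diagram with crossings `X` and marked points `M`.  A port is both a place where
a segment may end (`inl (x, s)`: the incoming half of the strand `s` at the crossing `x`) and a
place where a segment starts (`inl (x, s)`: the outgoing half of the same strand).  Segments are
named after the port at which they start. -/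
abbrev Port (X M : Type) : Type := X × Strand ⊕ M

/-- An oriented virtual link diagram with `A`-weighted segments. The segment starting at `p` ends
at `next p`. -/
structure Diagram (A : Type) where
  X : Type
  M : Type
  finX : Finite X
  finM : Finite M
  sign : X → Sign
  next : Equiv.Perm (Port X M)
  weight : Port X M → A

namespace Diagram

variable {A B : Type}

/-- `D` and `D'` differ by a renaming of crossings and marked points. -/
def Iso (D D' : Diagram A) : Prop :=
  ∃ (f : D.X ≃ D'.X) (g : D.M ≃ D'.M),
    let ι : Port D.X D.M → Port D'.X D'.M := Sum.map (Prod.map f id) g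
    (∀ x, D'.sign (f x) = D.sign x) ∧ (∀ p, D'.next (ι p) = ι (D.next p)) ∧
      ∀ p, D'.weight (ι p) = D.weight p

/-- `D'` is obtained from `D` by inserting one new marked point `μ` in a segment `e`, whose weight
is distributed on the two resulting segments. -/
def Subdivides [Add A] (D D' : Diagram A) : Prop :=
  ∃ (f : D.X ≃ D'.X) (g : Option D.M ≃ D'.M) (e : Port D.X D.M),
    let ι : Port D.X D.M → Port D'.X D'.M := Sum.map (Prod.map f id) (fun m => g (some m))
    let μ : Port D'.X D'.M := Sum.inr (g none)
    (∀ x, D'.sign (f x) = D.sign x) ∧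
      D'.next (ι e) = μ ∧ D'.next μ = ι (D.next e) ∧ (∀ p, p ≠ e → D'.next (ι p) = ι (D.next p)) ∧
      D'.weight (ι e) + D'.weight μ = D.weight e ∧ ∀ p, p ≠ e → D'.weight (ι p) = D.weight p

/-- Two diagrams present the same normal o-graph if they are related by the equivalence relation
generated by `SameStep`. -/
def SameStep [Add A] (D D' : Diagram A) : Prop := Iso D D' ∨ Subdivides D D'

/-- Change of coefficients of the weights. -/
def map (φ : A → B) (D : Diagram A) : Diagram B :=
  { D with weight := fun p => φ (D.weight p) }

end Diagram

/-- Normal o-graphs with weights in `A` on the edges. -/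
def NormalOGraph (A : Type) [Add A] : Type 1 := Quot (Diagram.SameStep (A := A))

/-- The normal o-graph presented by a diagram. -/
def NormalOGraph.mk {A : Type} [Add A] (D : Diagram A) : NormalOGraph A := Quot.mk _ D

theorem Diagram.SameStep.map {A B : Type} [Add A] [Add B] (φ : A → B)
    (hφ : ∀ a b, φ (a + b) = φ a + φ b) {D D' : Diagram A} (h : Diagram.SameStep D D') :
    Diagram.SameStep (D.map φ) (D'.map φ) := by
  rcases h with ⟨f, g, h1, h2, h3⟩ | ⟨f, g, e, h1, h2, h3, h4, h5, h6⟩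
  · exact Or.inl ⟨f, g, h1, h2, fun p => congrArg φ (h3 p)⟩
  · exact Or.inr ⟨f, g, e, h1, h2, h3, h4, (hφ _ _).symm.trans (congrArg φ h5),
      fun p hp => congrArg φ (h6 p hp)⟩

/-- Reduction modulo 2 of the weights of an integral normal o-graph. -/
def NormalOGraph.reduce : NormalOGraph ℤ → NormalOGraph (ZMod 2) :=
  Quot.map (Diagram.map (fun k : ℤ => (k : ZMod 2)))
    (fun _ _ h => h.map _ (fun a b => Int.cast_add a b))

/-! ### The branched polyhedron of a diagram

A segment stands for a part of a triple line of the branched polyhedron, with its canonical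
orientation.  Three sheets meet along it: the *first* and the *second* line (`0`, `1 : Line`) stand
for the two sheets inducing its orientation, the *third* line (`2 : Line`) for the sheet inducing
the opposite orientation, numbered by the right-hand screw order.  The vector field crosses the
first sheet and then the second one, and it crosses the third one directly.

In the dual picture a crossing is a tetrahedron with ordered vertices `0 < 1 < 2 < 3`, its four
half-edges are the faces, and a sheet is a dual edge; along the face with vertices `a < b < c` the
first, second and third line are dual to `ab`, `bc` and `ac`.  With `F_i` the face opposite to the
vertex `i`, at a positive crossing the over-strand goes from `F_0` to `F_1` and the under-strand
from `F_2` to `F_3`; at a negative crossing both are reversed. -/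

/-- The three lines along a segment. -/
abbrev Line := Fin 3

open Sign Strand in
/-- The six sheets at a true vertex.  The boundary of a sheet, oriented by the sheet, arrives at
the vertex along the incoming half of a strand if it is on the first or second line, and along the
outgoing half, backwards, if it is on the third line; it leaves along the outgoing half on the
first or second line, or along the incoming half, backwards, on the third line.
`corner ε (s, i) = (s', j)` says that the boundary arriving on the line `i` of the strand `s` at a
vertex of sign `ε` leaves on the line `j` of the strand `s'`. -/
def corner : Sign → Strand × Line → Strand × Line
  | pos, (upper, 0) => (lower, 1)
  | pos, (upper, 1) => (upper, 1)
  | pos, (upper, 2) => (lower, 2)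
  | pos, (lower, 0) => (lower, 0)
  | pos, (lower, 1) => (upper, 2)
  | pos, (lower, 2) => (upper, 0)
  | neg, (upper, 0) => (lower, 2)
  | neg, (upper, 1) => (upper, 1)
  | neg, (upper, 2) => (lower, 1)
  | neg, (lower, 0) => (lower, 0)
  | neg, (lower, 1) => (upper, 0)
  | neg, (lower, 2) => (upper, 2)

namespace Diagram

variable {A : Type} (D : Diagram A)

/-- The positions on the circuit diagram: a line along a segment. The boundary of the sheet
traverses it in the direction of the segment for the first two lines, and backwards for the
third one. -/
abbrev Position : Type := Port D.X D.M × Line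

/-- The position following a given one along the oriented boundary of its 2-cell. -/
def step (a : D.Position) : D.Position :=
  let leave : Port D.X D.M → Line → D.Position :=
    fun q j => if j = 2 then (D.next.symm q, 2) else (q, j)
  match (if a.2 = 2 then a.1 else D.next a.1) with
  | Sum.inl (x, s) =>
      leave (Sum.inl (x, (corner (D.sign x) (s, a.2)).1)) (corner (D.sign x) (s, a.2)).2
  | Sum.inr m => leave (Sum.inr m) a.2

/-- The 2-cells of the branched polyhedron: the circuits of the circuit diagram. -/
def TwoCell : Type := Quot (fun a b : D.Position => D.step a = b)

/-- The number of solid dots (points where the reference vector field is tangent to the boundary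
of the 2-cell) between a position and the following one: one dot if the boundary passes from one of
the first two lines to the third line or conversely, none otherwise. -/
def dot (a : D.Position) : ℕ := if (a.2 = 2 ↔ (D.step a).2 = 2) then 0 else 1

/-- The two sides of a 2-cell: `top` is the side to which the vector field points. -/
inductive Side
  | top
  | bottom

/-- The boundary surface of the thickened polyhedron has one face for each side of each 2-cell.
Sides of 2-cells are adjacent if they are consecutive along one of the three edges of the boundary
surface parallel to a segment. -/
inductive BoundaryAdj : D.Position × Side → D.Position × Side → Prop
  | along (a : D.Position) (σ : Side) : BoundaryAdj (a, σ) (D.step a, σ)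
  | above (e : Port D.X D.M) : BoundaryAdj ((e, 2), Side.top) ((e, 1), Side.top)
  | below (e : Port D.X D.M) : BoundaryAdj ((e, 2), Side.bottom) ((e, 0), Side.bottom)
  | between (e : Port D.X D.M) : BoundaryAdj ((e, 0), Side.top) ((e, 1), Side.bottom)

/-- The diagram presents a closed branched polyhedron: the boundary of the thickened polyhedron is
a sphere (it is connected, and its Euler characteristic, twice that of the polyhedron, is `2`;
the polyhedron has as many 0-cells as crossings and twice as many 1-cells), on which the tangency
locus, which runs straight through all crossings, is a single circle. -/
def IsClosed : Prop :=
  (∀ a b, Relation.EqvGen D.BoundaryAdj a b) ∧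
    Nat.card D.TwoCell = Nat.card D.X + 1 ∧
    ∀ p q, D.next.SameCycle p q

end Diagram

namespace Diagram

variable (D : Diagram ℤ)

/-- The value of the cochain of weights on a position, with the sign of the direction in which the
boundary of the 2-cell traverses it. -/
def signedWeight (a : D.Position) : ℤ := if a.2 = 2 then -D.weight a.1 else D.weight a.1

/-- The value of the coboundary of the weights on the 2-cell through the position `a`. -/
noncomputable def coboundary (a : D.Position) : ℤ :=
  ∑ m ∈ Finset.range (Function.minimalPeriod D.step a), D.signedWeight (D.step^[m] a)

/-- The number of solid dots on the boundary of the 2-cell through the position `a`. -/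
noncomputable def dots (a : D.Position) : ℕ :=
  ∑ m ∈ Finset.range (Function.minimalPeriod D.step a), D.dot (D.step^[m] a)

/-- The value of the Euler cochain on the 2-cell through the position `a`. -/
noncomputable def eulerCochain (a : D.Position) : ℚ := -(1 - (D.dots a : ℚ) / 2)

/-- The diagram presents a framed integral normal o-graph: it is closed and the coboundary of the
weights is the Euler cochain. -/
def IsFramed : Prop := D.IsClosed ∧ ∀ a, (D.coboundary a : ℚ) = D.eulerCochain a

/-- The boundary of a 2-cell, leaving the position `a`, arrives for the first time at the position
`b` after `n` steps, and the rotation number on the way is `p`: the signed weights of the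
positions strictly in between, and `-1/2` for each solid dot. -/
def RotationBetween (a b : D.Position) (p : ℚ) : Prop :=
  ∃ n : ℕ, D.step^[n] a = b ∧ (∀ m < n, D.step^[m] a ≠ b) ∧
    p = (∑ m ∈ Finset.Ioo 0 n, (D.signedWeight (D.step^[m] a) : ℚ))
      - (∑ m ∈ Finset.range n, (D.dot (D.step^[m] a) : ℚ)) / 2

end Diagram

/-- Framed integral normal o-graphs. -/
def FramedIntegralNormalOGraph : Type 1 :=
  {Γ : NormalOGraph ℤ // ∃ D : Diagram ℤ, D.IsFramed ∧ NormalOGraph.mk D = Γ}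

/-- Framed normal o-graphs: the images of the framed integral ones under reduction modulo 2. -/
def FramedNormalOGraph : Type 1 :=
  {Γ : NormalOGraph (ZMod 2) // ∃ G : FramedIntegralNormalOGraph, NormalOGraph.reduce G.1 = Γ}

/-- The projection from framed integral normal o-graphs to framed normal o-graphs. -/
def FramedIntegralNormalOGraph.proj (G : FramedIntegralNormalOGraph) : FramedNormalOGraph :=
  ⟨NormalOGraph.reduce G.1, G, rfl⟩

/-! ### Local replacement -/

/-- A diagram with `n` distinguished marked points `0, …, n - 1`.  It is used in two ways: as the
outside of a local picture with `n` strands (the `k`-th distinguished point stands for the place of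
the `k`-th strand), and as the local picture itself (the `k`-th strand is cut out of the curve
through the `k`-th distinguished point by cutting at this point). -/
structure Tangle (A : Type) (n : ℕ) where
  X : Type
  M : Type
  finX : Finite X
  finM : Finite M
  sign : X → Sign
  next : Equiv.Perm (Port X (M ⊕ Fin n))
  weight : Port X (M ⊕ Fin n) → A

/-- Exchange of the distinguished points of the two sides of a glued diagram. -/
def swapHoles (M N : Type) (n : ℕ) : Equiv.Perm ((M ⊕ Fin n) ⊕ (N ⊕ Fin n)) where
  toFun
    | Sum.inl (Sum.inl m) => Sum.inl (Sum.inl m)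
    | Sum.inl (Sum.inr k) => Sum.inr (Sum.inr k)
    | Sum.inr (Sum.inl m) => Sum.inr (Sum.inl m)
    | Sum.inr (Sum.inr k) => Sum.inl (Sum.inr k)
  invFun
    | Sum.inl (Sum.inl m) => Sum.inl (Sum.inl m)
    | Sum.inl (Sum.inr k) => Sum.inr (Sum.inr k)
    | Sum.inr (Sum.inl m) => Sum.inr (Sum.inl m)
    | Sum.inr (Sum.inr k) => Sum.inl (Sum.inr k)
  left_inv := by rintro ((m | k) | (m | k)) <;> rfl
  right_inv := by rintro ((m | k) | (m | k)) <;> rfl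

/-- The ports of the disjoint union of two pictures. -/
def portSum (X Y M N : Type) : Port (X ⊕ Y) (M ⊕ N) ≃ Port X M ⊕ Port Y N :=
  (Equiv.sumCongr (Equiv.sumProdDistrib X Y Strand) (Equiv.refl (M ⊕ N))).trans
    (Equiv.sumSumSumComm (X × Strand) (Y × Strand) M N)

/-- Insertion of the local picture `T` in the outside `C`: a segment of `C` ending at its `k`-th
distinguished point is continued by the `k`-th strand of `T`, and the end of this strand by the
segment of `C` starting at the `k`-th distinguished point. In the result, the `k`-th strand of `T`
starts at the marked point `inr (inr k)` and ends at the marked point `inl (inr k)`. -/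
def Tangle.glue {A : Type} {n : ℕ} (C T : Tangle A n) : Diagram A where
  X := C.X ⊕ T.X
  M := (C.M ⊕ Fin n) ⊕ (T.M ⊕ Fin n)
  finX := by have := C.finX; have := T.finX; infer_instance
  finM := by have := C.finM; have := T.finM; infer_instance
  sign := Sum.elim C.sign T.sign
  next := Equiv.sumCongr (Equiv.refl _) (swapHoles C.M T.M n) *
    (portSum C.X T.X (C.M ⊕ Fin n) (T.M ⊕ Fin n)).symm.permCongr (Equiv.sumCongr C.next T.next)
  weight p := Sum.elim C.weight T.weight (portSum C.X T.X (C.M ⊕ Fin n) (T.M ⊕ Fin n) p)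

/-- The first segment of the `k`-th strand of `T` in `C.glue T`. -/
def Tangle.firstSegment {A : Type} {n : ℕ} (C T : Tangle A n) (k : Fin n) :
    Port (C.glue T).X (C.glue T).M :=
  Sum.inr (Sum.inr (Sum.inr k))

/-- The local picture with `c` crossings of the given signs and `n` strands, the `k`-th of which
runs successively through the crossings listed in `word k`; the successive segments of the `k`-th
strand carry the weights listed in `wt k` (missing entries are `0`). Every strand of every crossing
has to occur exactly once in the words. -/
def Tangle.ofWords {n c : ℕ} (sign : Fin c → Sign) (word : Fin n → List (Fin c × Strand))
    (wt : Fin n → List ℤ) : Tangle ℤ n where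
  X := Fin c
  M := Empty
  finX := inferInstance
  finM := inferInstance
  sign := sign
  next := (List.ofFn fun k : Fin n =>
    List.formPerm (Sum.inr (Sum.inr k) :: (word k).map Sum.inl :
      List (Port (Fin c) (Empty ⊕ Fin n)))).prod
  weight
    | Sum.inl x => ∑ k, if x ∈ word k then (wt k).getD ((word k).idxOf x + 1) 0 else 0
    | Sum.inr (Sum.inl m) => m.elim
    | Sum.inr (Sum.inr k) => (wt k).getD 0 0

/-- The integral move replacing the local picture `L` by the local picture `R`. -/
def IntegralMove {n : ℕ} (L R : Tangle ℤ n) (G G' : FramedIntegralNormalOGraph) : Prop :=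
  ∃ C : Tangle ℤ n, G.1 = NormalOGraph.mk (C.glue L) ∧ G'.1 = NormalOGraph.mk (C.glue R)

/-- The framed move obtained by projection of an integral move. -/
def Framed (R : FramedIntegralNormalOGraph → FramedIntegralNormalOGraph → Prop) :
    FramedNormalOGraph → FramedNormalOGraph → Prop :=
  Relation.Map R FramedIntegralNormalOGraph.proj FramedIntegralNormalOGraph.proj

/-! ### The 16 MP moves

The moves are dual to the 2-3 moves on triangulations with ordered vertices: two tetrahedra sharing
a face are replaced by three tetrahedra sharing an edge, and all five vertices are ordered by the
branching.  These are 20 moves, of which exactly 16 join the ends of the three strands in the same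
way before and after. The weights are zero for the moves in which the new triangular region is not
cyclically oriented (all but `A2`, `A4`, `B2`, `B4`, `C3`, `D3`). -/

/-- The names of the 16 MP moves. -/
inductive MPType
  | A1 | A2 | A3 | A4 | B1 | B2 | B3 | B4 | C1 | C2 | C3 | C4 | D1 | D2 | D3 | D4

/-- The two local pictures of an MP move, with three strands; the weights before the move are
zero. -/
structure MPData where
  leftSign : Fin 2 → Sign
  leftWord : Fin 3 → List (Fin 2 × Strand)
  rightSign : Fin 3 → Sign
  rightWord : Fin 3 → List (Fin 3 × Strand)
  rightWeight : Fin 3 → List ℤ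

open Strand in
/-- The 16 MP moves. -/
def MPType.data : MPType → MPData
  | .A1 => {
      leftSign := ![.pos, .pos]
      leftWord := ![[(1, lower)], [(0, lower)], [(0, upper), (1, upper)]]
      rightSign := ![.pos, .pos, .neg]
      rightWord := ![[(1, lower), (2, lower)], [(1, upper), (0, lower), (2, upper)], [(0, upper)]]
      rightWeight := fun _ => [] }
  | .A2 => {
      leftSign := ![.pos, .neg]
      leftWord := ![[(1, lower)], [(0, lower)], [(0, upper), (1, upper)]]
      rightSign := ![.pos, .neg, .pos]
      rightWord := ![[(2, lower), (1, lower)], [(1, upper), (0, lower), (2, upper)], [(0, upper)]]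
      rightWeight := ![[0, 0, 0], [0, 0, -1, 1], [0, 0]] }
  | .A3 => {
      leftSign := ![.neg, .neg]
      leftWord := ![[(1, lower)], [(1, upper), (0, upper)], [(0, lower)]]
      rightSign := ![.neg, .neg, .pos]
      rightWord := ![[(2, lower), (1, lower)], [(0, upper)], [(2, upper), (0, lower), (1, upper)]]
      rightWeight := fun _ => [] }
  | .A4 => {
      leftSign := ![.neg, .pos]
      leftWord := ![[(1, lower)], [(0, lower)], [(1, upper), (0, upper)]]
      rightSign := ![.neg, .pos, .neg]
      rightWord := ![[(1, lower), (2, lower)], [(2, upper), (0, lower), (1, upper)], [(0, upper)]]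
      rightWeight := ![[0, -1, 1], [0, 0, 0, 0], [0, 0]] }
  | .B1 => {
      leftSign := ![.neg, .neg]
      leftWord := ![[(1, lower), (0, lower)], [(1, upper)], [(0, upper)]]
      rightSign := ![.pos, .neg, .neg]
      rightWord := ![[(2, lower)], [(1, lower), (2, upper), (0, lower)], [(1, upper), (0, upper)]]
      rightWeight := fun _ => [] }
  | .B2 => {
      leftSign := ![.pos, .neg]
      leftWord := ![[(1, lower), (0, lower)], [(1, upper)], [(0, upper)]]
      rightSign := ![.neg, .pos, .neg]
      rightWord := ![[(2, lower)], [(1, lower), (2, upper), (0, lower)], [(0, upper), (1, upper)]]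
      rightWeight := ![[0, 0], [0, 0, -1, 1], [0, 0, 0]] }
  | .B3 => {
      leftSign := ![.pos, .pos]
      leftWord := ![[(0, lower), (1, lower)], [(1, upper)], [(0, upper)]]
      rightSign := ![.neg, .pos, .pos]
      rightWord := ![[(2, lower)], [(0, lower), (2, upper), (1, lower)], [(0, upper), (1, upper)]]
      rightWeight := fun _ => [] }
  | .B4 => {
      leftSign := ![.neg, .pos]
      leftWord := ![[(0, lower), (1, lower)], [(0, upper)], [(1, upper)]]
      rightSign := ![.pos, .neg, .pos]
      rightWord := ![[(2, lower)], [(1, upper), (0, upper)], [(0, lower), (2, upper), (1, lower)]]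
      rightWeight := ![[0, 0], [0, -1, 1], [0, 0, 0, 0]] }
  | .C1 => {
      leftSign := ![.neg, .pos]
      leftWord := ![[(1, lower)], [(0, lower), (1, upper)], [(0, upper)]]
      rightSign := ![.neg, .pos, .pos]
      rightWord := ![[(1, lower), (2, lower)], [(2, upper), (0, lower)], [(1, upper), (0, upper)]]
      rightWeight := fun _ => [] }
  | .C2 => {
      leftSign := ![.neg, .neg]
      leftWord := ![[(1, lower)], [(0, lower), (1, upper)], [(0, upper)]]
      rightSign := ![.neg, .neg, .neg]
      rightWord := ![[(2, lower), (1, lower)], [(2, upper), (0, lower)], [(1, upper), (0, upper)]]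
      rightWeight := fun _ => [] }
  | .C3 => {
      leftSign := ![.pos, .pos]
      leftWord := ![[(1, lower)], [(0, lower), (1, upper)], [(0, upper)]]
      rightSign := ![.pos, .neg, .pos]
      rightWord := ![[(1, lower), (2, lower)], [(2, upper), (0, lower)], [(0, upper), (1, upper)]]
      rightWeight := ![[-1, 1, 0], [0, 0, 0], [0, 0, 0]] }
  | .C4 => {
      leftSign := ![.pos, .neg]
      leftWord := ![[(1, lower)], [(0, lower), (1, upper)], [(0, upper)]]
      rightSign := ![.pos, .pos, .neg]
      rightWord := ![[(2, lower), (1, lower)], [(2, upper), (0, lower)], [(0, upper), (1, upper)]]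
      rightWeight := fun _ => [] }
  | .D1 => {
      leftSign := ![.pos, .neg]
      leftWord := ![[(1, lower)], [(1, upper), (0, lower)], [(0, upper)]]
      rightSign := ![.pos, .neg, .neg]
      rightWord := ![[(2, lower), (1, lower)], [(0, lower), (2, upper)], [(0, upper), (1, upper)]]
      rightWeight := fun _ => [] }
  | .D2 => {
      leftSign := ![.pos, .pos]
      leftWord := ![[(1, lower)], [(1, upper), (0, lower)], [(0, upper)]]
      rightSign := ![.pos, .pos, .pos]
      rightWord := ![[(1, lower), (2, lower)], [(0, lower), (2, upper)], [(0, upper), (1, upper)]]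
      rightWeight := fun _ => [] }
  | .D3 => {
      leftSign := ![.neg, .neg]
      leftWord := ![[(1, lower)], [(1, upper), (0, lower)], [(0, upper)]]
      rightSign := ![.neg, .pos, .neg]
      rightWord := ![[(2, lower), (1, lower)], [(0, lower), (2, upper)], [(1, upper), (0, upper)]]
      rightWeight := ![[0, 0, 0], [0, 0, 0], [-1, 1, 0]] }
  | .D4 => {
      leftSign := ![.neg, .pos]
      leftWord := ![[(1, lower)], [(0, upper)], [(1, upper), (0, lower)]]
      rightSign := ![.neg, .neg, .pos]
      rightWord := ![[(1, lower), (2, lower)], [(1, upper), (0, upper)], [(0, lower), (2, upper)]]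
      rightWeight := fun _ => [] }

/-- The integral MP moves. -/
def IntegralMP (t : MPType) : FramedIntegralNormalOGraph → FramedIntegralNormalOGraph → Prop :=
  IntegralMove (Tangle.ofWords t.data.leftSign t.data.leftWord fun _ => [])
    (Tangle.ofWords t.data.rightSign t.data.rightWord t.data.rightWeight)

/-- The framed MP moves. -/
def FramedMP (t : MPType) : FramedNormalOGraph → FramedNormalOGraph → Prop :=
  Framed (IntegralMP t)

/-! ### The generating moves -/

open Strand in
/-- The primary integral MP move: all crossings are positive and all weights zero.  On the left the
second strand passes over the third one and then under the first one; on the right the first strand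
passes over the second one (crossing `0`), then over the third one (crossing `1`), and the second
strand then passes over the third one (crossing `2`). -/
def IntegralPrimaryMP : FramedIntegralNormalOGraph → FramedIntegralNormalOGraph → Prop :=
  IntegralMove
    (Tangle.ofWords (n := 3) (c := 2) (fun _ => Sign.pos)
      ![[(0, upper)], [(1, upper), (0, lower)], [(1, lower)]] fun _ => [])
    (Tangle.ofWords (n := 3) (c := 3) (fun _ => Sign.pos)
      ![[(0, upper), (1, upper)], [(0, lower), (2, upper)], [(1, lower), (2, lower)]] fun _ => [])

open Strand in
/-- The integral H-move: the weights of the two incoming half-edges of a crossing are increased by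
one, and those of the two outgoing half-edges are decreased by one. -/
def IntegralH (G G' : FramedIntegralNormalOGraph) : Prop :=
  ∃ ε : Sign, IntegralMove
    (Tangle.ofWords (n := 2) (c := 1) (fun _ => ε) ![[(0, upper)], [(0, lower)]] fun _ => [])
    (Tangle.ofWords (n := 2) (c := 1) (fun _ => ε) ![[(0, upper)], [(0, lower)]] fun _ => [1, -1])
    G G'

/-- The names of the four pure sliding moves. -/
inductive SlideType
  | I | II | III | IV

/-- The line on the left strand which is connected to `SlideType.rightLine` on the right strand,
for the pure sliding move to be possible. -/
def SlideType.leftLine : SlideType → Line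
  | I => 2
  | II => 2
  | III => 0
  | IV => 2

/-- See `SlideType.leftLine`. -/
def SlideType.rightLine : SlideType → Line
  | I => 1
  | II => 0
  | III => 1
  | IV => 2

/-- Two strands, the left one (number `0`) and the right one (number `1`), without crossings, and
with weights `k` and `l`. -/
def slideLeft (k l : ℤ) : Tangle ℤ 2 :=
  Tangle.ofWords (n := 2) (c := 0) Fin.elim0 (fun _ => []) ![[k], [l]]

open Sign Strand SlideType in
/-- The picture after a pure sliding move; the crossing `0` is the bottom one and the crossing `1`
the top one. Both strands go up in `I` and `II`; the left one goes down and the right one up in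
`III`, and conversely in `IV`. The integer `a` is determined by the rotation number of the framing
along the part of the boundary of the 2-cell outside the picture. -/
def slideRight (t : SlideType) (k l a : ℤ) : Tangle ℤ 2 :=
  match t with
  | I => Tangle.ofWords (n := 2) (c := 2) ![pos, neg]
      ![[(0, upper), (1, upper)], [(0, lower), (1, lower)]] ![[0, 0, k], [a, 0, l - a]]
  | II => Tangle.ofWords (n := 2) (c := 2) ![neg, pos]
      ![[(0, lower), (1, lower)], [(0, upper), (1, upper)]] ![[0, 0, k], [a, 0, l - a]]
  | III => Tangle.ofWords (n := 2) (c := 2) ![neg, pos]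
      ![[(1, upper), (0, upper)], [(0, lower), (1, lower)]] ![[k, 0, 0], [a, 1, l - 1 - a]]
  | IV => Tangle.ofWords (n := 2) (c := 2) ![pos, neg]
      ![[(0, lower), (1, lower)], [(1, upper), (0, upper)]] ![[0, 0, k], [l + 1 + a, -1, -a]]

/-- The integer `a` in terms of the rotation number `p` from the bottom of the left strand to the
bottom of the right strand. -/
def SlideType.IsShift (t : SlideType) (p : ℚ) (a : ℤ) : Prop :=
  match t with
  | I => (a : ℚ) = -p - 1 / 2
  | II => (a : ℚ) = -p - 1 / 2
  | III => (a : ℚ) = -p - 1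
  | IV => (a : ℚ) = -p - 1

/-- The integral pure sliding moves. The condition that the line `leftLine` of the left strand and
the line `rightLine` of the right strand belong to the same circuit is part of
`RotationBetween`. -/
def IntegralSlide (t : SlideType) (G G' : FramedIntegralNormalOGraph) : Prop :=
  ∃ (C : Tangle ℤ 2) (k l a : ℤ) (p : ℚ),
    (C.glue (slideLeft k l)).RotationBetween
        (C.firstSegment (slideLeft k l) 0, t.leftLine)
        (C.firstSegment (slideLeft k l) 1, t.rightLine) p ∧
      t.IsShift p a ∧
      G.1 = NormalOGraph.mk (C.glue (slideLeft k l)) ∧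
      G'.1 = NormalOGraph.mk (C.glue (slideRight t k l a))

/-- The names of the generating moves. -/
inductive Generator
  | primaryMP
  | slide (t : SlideType)
  | H

/-- The generating framed moves. -/
def Generator.move : Generator → FramedNormalOGraph → FramedNormalOGraph → Prop
  | primaryMP => Framed IntegralPrimaryMP
  | slide t => Framed (IntegralSlide t)
  | H => Framed IntegralH

/-- `Derives w Γ Γ'`: the framed normal o-graph `Γ'` is obtained from `Γ` by performing
successively the generating moves (`true`) or inverses of generating moves (`false`) listed in
`w`. -/
def Derives : List (Generator × Bool) → FramedNormalOGraph → FramedNormalOGraph → Prop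
  | [], Γ, Γ' => Γ = Γ'
  | (g, true) :: w, Γ, Γ' => ∃ Γ₁, g.move Γ Γ₁ ∧ Derives w Γ₁ Γ'
  | (g, false) :: w, Γ, Γ' => ∃ Γ₁, g.move Γ₁ Γ ∧ Derives w Γ₁ Γ'

end OGraph

/-!
Every MP move other than `D2`, which is the primary move with two strands exchanged, is reduced to
an MP move that has been dealt with before. A pure sliding move creates two crossings in such a way
that the picture now contains the right side of the other MP move. The inverse of that move leads to
the right side of the given one, in three cases only up to an H-move.

The shift of the slide depends on the rotation number of an arc of the boundary of a 2-cell. If this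
arc runs inside the picture, its rotation number can be read off. Otherwise the complementary arc
runs inside the picture, and `δ x = c_P`, which says that the whole boundary has rotation number
`-1`, gives the answer.

The intermediate objects are framed because MP moves, in the forward direction, and H-moves preserve
framedness: inside both pictures, the circuits go from end to end in the same way and with the same
rotation number, apart from at most one closed circuit of rotation number `-1` within the right
picture. Framedness is therefore passed from the last object back to the previous ones, and the
result of a slide needs no separate argument.
-/

namespace OGraph

/-! ### Orbits and first return maps -/

section Orbits

variable {α β : Type*}

/-- The orbits of a self-map `s`: the classes of the equivalence relation generated by
`a ∼ s a`. -/
abbrev Orbits (s : α → α) : Type _ := Quot fun a b => s a = b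

/-- The orbit through a point. -/
abbrev orbit (s : α → α) (a : α) : Orbits s := Quot.mk _ a

theorem orbit_apply (s : α → α) (a : α) : orbit s (s a) = orbit s a :=
  (Quot.sound (r := fun a b => s a = b) rfl).symm

theorem orbit_iterate (s : α → α) (a : α) (n : ℕ) : orbit s (s^[n] a) = orbit s a := by
  induction n with
  | zero => rfl
  | succ n ih => rw [Function.iterate_succ_apply', orbit_apply, ih]

theorem orbit_zpow (f : Equiv.Perm α) (a : α) (n : ℤ) : orbit f ((f ^ n) a) = orbit f a := by
  induction n with
  | zero => rfl
  | succ n ih => rw [add_comm, zpow_add, zpow_one, Equiv.Perm.mul_apply, orbit_apply, ih]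
  | pred n ih =>
    rw [← ih, ← orbit_apply, ← Equiv.Perm.mul_apply, ← zpow_one_add, add_sub_cancel]

theorem orbit_eq_orbit_iff_sameCycle {f : Equiv.Perm α} {a b : α} :
    orbit f a = orbit f b ↔ f.SameCycle a b := by
  constructor
  · intro h
    induction Quot.eqvGen_exact h with
    | rel a b hab => exact ⟨1, hab⟩
    | refl a => exact .refl _ _
    | symm a b _ ih => exact (ih (Quot.eqvGen_sound ‹_›)).symm
    | trans a b c _ _ ih ih' =>
      exact (ih (Quot.eqvGen_sound ‹_›)).trans (ih' (Quot.eqvGen_sound ‹_›))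
  · rintro ⟨n, rfl⟩
    exact (orbit_zpow f a n).symm

theorem orbit_eq_orbit_iff [Finite α] {s : α → α} (hs : s.Injective) {a b : α} :
    orbit s a = orbit s b ↔ ∃ n, s^[n] a = b := by
  let f : Equiv.Perm α := .ofBijective s (Finite.injective_iff_bijective.1 hs)
  refine (orbit_eq_orbit_iff_sameCycle (f := f)).trans ?_
  constructor
  · intro h
    obtain ⟨n, -, h⟩ := h.exists_pow_eq'
    exact ⟨n, (congrFun (Equiv.Perm.iterate_eq_pow f n) a).trans h⟩
  · rintro ⟨n, rfl⟩
    exact ⟨n, by rw [zpow_natCast, ← Equiv.Perm.iterate_eq_pow]; rfl⟩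

open Classical in
/-- The sum of a function over an orbit. -/
noncomputable def orbitSum [Fintype α] (s : α → α) (φ : α → ℤ) (q : Orbits s) : ℤ :=
  ∑ a with orbit s a = q, φ a

open Classical in
theorem sum_range_minimalPeriod [Fintype α] {s : α → α} (hs : s.Injective) (φ : α → ℤ) (a : α) :
    ∑ m ∈ Finset.range (Function.minimalPeriod s a), φ (s^[m] a) =
      orbitSum s φ (orbit s a) := by
  refine Finset.sum_bij (fun m _ => s^[m] a) ?_ ?_ ?_ fun _ _ => rfl
  · intro m _
    simp [orbit_iterate]
  · intro m hm n hn h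
    exact Function.iterate_injOn_Iio_minimalPeriod (by simpa using hm) (by simpa using hn) h
  · intro b hb
    obtain ⟨n, rfl⟩ := (orbit_eq_orbit_iff hs).1 (Finset.mem_filter.1 hb).2.symm
    refine ⟨n % Function.minimalPeriod s a, ?_, Function.iterate_mod_minimalPeriod_eq⟩
    rw [Finset.mem_range]
    exact Nat.mod_lt _ (Function.minimalPeriod_pos_of_mem_periodicPts (hs.mem_periodicPts a))

end Orbits

/-- `r` is the first return map of `s` to the subset parametrized by `ι`, and `exit a` is the first
point of this subset on the orbit of `a` (`none` if the orbit avoids the subset). -/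
structure IsFirstReturn {α β : Type*} (s : α → α) (r : β → β) (ι : β → α) (exit : α → Option β) :
    Prop where
  exit_incl : ∀ b, exit (ι b) = some b
  exit_step_incl : ∀ b, exit (s (ι b)) = some (r b)
  exit_step : ∀ a, a ∉ Set.range ι → exit (s a) = exit a
  exists_iterate_eq : ∀ a b, exit a = some b → ∃ n, s^[n] a = ι b

namespace IsFirstReturn

variable {α β : Type*} {s : α → α} {r : β → β} {ι : β → α} {exit : α → Option β}

theorem orbit_eq (h : IsFirstReturn s r ι exit) {a : α} {b : β} (hab : exit a = some b) :
    orbit s a = orbit s (ι b) := by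
  obtain ⟨n, hn⟩ := h.exists_iterate_eq a b hab
  rw [← hn, orbit_iterate]

/-- The orbit of the first return map contained in an orbit, if there is one. -/
def restrict (h : IsFirstReturn s r ι exit) : Orbits s → Option (Orbits r) :=
  Quot.lift (fun a => (exit a).map (orbit r)) (by
    rintro a _ rfl
    by_cases ha : a ∈ Set.range ι
    · obtain ⟨b, rfl⟩ := ha
      simp only [h.exit_incl, h.exit_step_incl, Option.map_some, orbit_apply]
    · rw [h.exit_step a ha])

theorem restrict_orbit (h : IsFirstReturn s r ι exit) (a : α) :
    h.restrict (orbit s a) = (exit a).map (orbit r) := rfl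

/-- The orbit containing an orbit of the first return map. -/
def extend (h : IsFirstReturn s r ι exit) : Orbits r → Orbits s :=
  Quot.lift (fun b => orbit s (ι b)) (by
    rintro b _ rfl
    rw [← orbit_apply s, h.orbit_eq (h.exit_step_incl b)])

theorem extend_orbit (h : IsFirstReturn s r ι exit) (b : β) :
    h.extend (orbit r b) = orbit s (ι b) := rfl

theorem restrict_extend (h : IsFirstReturn s r ι exit) (q : Orbits r) :
    h.restrict (h.extend q) = some q := by
  induction q using Quot.ind with
  | mk b => rw [extend_orbit, restrict_orbit, h.exit_incl, Option.map_some]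

theorem restrict_eq_some_iff (h : IsFirstReturn s r ι exit) {q : Orbits s} {q' : Orbits r} :
    h.restrict q = some q' ↔ q = h.extend q' := by
  refine ⟨fun hq => ?_, fun hq => hq ▸ h.restrict_extend q'⟩
  induction q using Quot.ind with
  | mk a =>
    obtain ⟨b, hb, rfl⟩ := Option.map_eq_some_iff.1 hq
    exact h.orbit_eq hb

theorem extend_injective (h : IsFirstReturn s r ι exit) : Function.Injective h.extend :=
  fun q q' hq => Option.some.inj (by rw [← h.restrict_extend q, hq, h.restrict_extend])

theorem extend_surjective (h : IsFirstReturn s r ι exit) (hexit : ∀ a, exit a ≠ none) :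
    Function.Surjective h.extend := by
  intro q
  induction q using Quot.ind with
  | mk a =>
    obtain ⟨b, hb⟩ := Option.ne_none_iff_exists'.1 (hexit a)
    exact ⟨orbit r b, (h.orbit_eq hb).symm⟩

theorem orbitSum_extend [Fintype α] [Fintype β] [DecidableEq β] (h : IsFirstReturn s r ι exit)
    {φ : α → ℤ} {ψ : β → ℤ} (hψ : ∀ b, ψ b = ∑ a with exit a = some b, φ a) (q : Orbits r) :
    orbitSum s φ (h.extend q) = orbitSum r ψ q := by
  classical
  simp only [orbitSum, hψ]
  rw [Finset.sum_sigma']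
  refine (Finset.sum_bij (fun x _ => x.2) ?_ ?_ ?_ fun _ _ => rfl).symm
  · rintro ⟨b, a⟩ hba
    simp only [Finset.mem_sigma, Finset.mem_filter_univ] at hba ⊢
    rw [← hba.1, extend_orbit, h.orbit_eq hba.2]
  · rintro ⟨b, a⟩ hba ⟨b', a'⟩ hba' rfl
    simp only [Finset.mem_sigma, Finset.mem_filter_univ] at hba hba'
    rw [Option.some.inj (hba.2.symm.trans hba'.2)]
  · intro a ha
    rw [Finset.mem_filter_univ, ← h.restrict_eq_some_iff] at ha
    obtain ⟨b, hb, hq⟩ := Option.map_eq_some_iff.1 ha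
    exact ⟨⟨b, a⟩, by simp [hb, hq], rfl⟩

theorem card_orbits (h : IsFirstReturn s r ι exit) (hexit : ∀ a, exit a ≠ none) :
    Nat.card (Orbits s) = Nat.card (Orbits r) :=
  (Nat.card_congr (.ofBijective _ ⟨h.extend_injective, h.extend_surjective hexit⟩)).symm

theorem orbit_eq_of_exit_eq_none (h : IsFirstReturn s r ι exit) {a₀ : α}
    (hexit : ∀ a, exit a = none → ∃ n, s^[n] a₀ = a) {a : α} (ha : exit a = none) :
    exit a₀ = none ∧ orbit s a = orbit s a₀ := by
  obtain ⟨n, rfl⟩ := hexit a ha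
  have hrestrict := congrArg h.restrict (orbit_iterate s a₀ n)
  rw [restrict_orbit, restrict_orbit, ha, Option.map_none, eq_comm, Option.map_eq_none_iff]
    at hrestrict
  exact ⟨hrestrict, orbit_iterate s a₀ n⟩

theorem card_orbits_eq_add_ite [Finite β] (h : IsFirstReturn s r ι exit) {a₀ : α}
    (hexit : ∀ a, exit a = none → ∃ n, s^[n] a₀ = a) :
    Nat.card (Orbits s) = Nat.card (Orbits r) + if exit a₀ = none then 1 else 0 := by
  split_ifs with h₀
  · have eq_orbit : ∀ q, h.restrict q = none → q = orbit s a₀ := Quot.ind fun a ha =>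
      (h.orbit_eq_of_exit_eq_none hexit (Option.map_eq_none_iff.1 ha)).2
    rw [← Finite.card_option]
    refine Nat.card_congr (.ofBijective h.restrict ⟨fun q q' hq => ?_, ?_⟩)
    · cases hr : h.restrict q with
      | some r =>
        rw [h.restrict_eq_some_iff.1 hr, h.restrict_eq_some_iff.1 (hq.symm.trans hr)]
      | none => rw [eq_orbit q hr, eq_orbit q' (hq.symm.trans hr)]
    · rintro (_ | q)
      · exact ⟨orbit s a₀, by rw [restrict_orbit, h₀, Option.map_none]⟩
      · exact ⟨_, h.restrict_extend q⟩
  · exact h.card_orbits fun a ha => h₀ (h.orbit_eq_of_exit_eq_none hexit ha).1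

theorem orbitSum_eq_of_exit_eq_none [Fintype α] (h : IsFirstReturn s r ι exit) {a₀ : α}
    (h₀ : exit a₀ = none) (hexit : ∀ a, exit a = none → ∃ n, s^[n] a₀ = a) (φ : α → ℤ) :
    orbitSum s φ (orbit s a₀) = ∑ a with exit a = none, φ a := by
  classical
  unfold orbitSum
  congr 1
  ext a
  simp only [Finset.mem_filter_univ]
  refine ⟨fun ha => ?_, fun ha => (h.orbit_eq_of_exit_eq_none hexit ha).2⟩
  rw [← Option.map_eq_none_iff (f := orbit r), ← h.restrict_orbit, ha, h.restrict_orbit, h₀,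
    Option.map_none]

end IsFirstReturn

section Gluing

variable {α β γ E : Type*}

/-- A point of a part of a dynamical system eventually leaves this part at the gate `e`; here
`f a = inl a'` if `a` is sent to the point `a'` of the part, and `f a = inr e` if it leaves the part
at `e`. -/
inductive ExitsAt (f : α → α ⊕ E) : α → E → Prop
  | leave {a : α} {e : E} (h : f a = .inr e) : ExitsAt f a e
  | step {a a' : α} {e : E} (h : f a = .inl a') (h' : ExitsAt f a' e) : ExitsAt f a e

/-- `exit` computes the gate at which a point leaves, `none` meaning that it stays forever. -/
def IsExit (f : α → α ⊕ E) (exit : α → Option E) : Prop :=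
  ∀ a e, exit a = some e ↔ ExitsAt f a e

/-- The gate at which a point leaves, if this happens within `N` steps. -/
def exitWithin (f : α → α ⊕ E) : ℕ → α → Option E
  | 0, _ => none
  | N + 1, a => Sum.elim (exitWithin f N) some (f a)

/-- Two parts with the same gates, glued: a point leaving one part at the gate `e` enters the other
one at its point `j e` or `i e`. -/
def glueMap (f : α → α ⊕ E) (i : E → α) (g : β → β ⊕ E) (j : E → β) : α ⊕ β → α ⊕ β :=
  Sum.elim (fun a => Sum.elim .inl (fun e => .inr (j e)) (f a))
    (fun b => Sum.elim .inr (fun e => .inl (i e)) (g b))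

/-- A part closed up: a point leaving at the gate `e` enters again at the gate `through e`. -/
def closeMap (f : α → α ⊕ E) (i : E → α) (through : E → E) (a : α) : α :=
  Sum.elim id (fun e => i (through e)) (f a)

theorem ExitsAt.elim {f : α → α ⊕ E} {a : α} {e : E} :
    ExitsAt f a e ↔ Sum.elim (ExitsAt f · e) (· = e) (f a) := by
  constructor
  · rintro (h | ⟨h, h'⟩) <;> simp_all
  · intro h
    cases hf : f a <;> simp only [hf, Sum.elim_inl, Sum.elim_inr] at h
    exacts [.step hf h, .leave (hf.trans (congrArg _ h))]

theorem isExit_exitWithin {f : α → α ⊕ E} {N : ℕ}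
    (h : ∀ a, exitWithin f (N + 1) a = exitWithin f N a) : IsExit f (exitWithin f N) := by
  intro a e
  constructor
  · clear h
    induction N generalizing a with
    | zero => exact fun h => (Option.some_ne_none e h.symm).elim
    | succ N ih =>
      intro ha
      rw [exitWithin] at ha
      cases hf : f a with
      | inl a' => exact .step hf (ih a' (by simpa [hf] using ha))
      | inr e' => exact .leave (by simpa [hf] using ha)
  · intro ha
    induction ha with
    | leave hf => rw [← h, exitWithin, hf, Sum.elim_inr]
    | step hf _ ih => rw [← h, exitWithin, hf, Sum.elim_inl, ih]

namespace IsExit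

variable {f : α → α ⊕ E} {i : E → α} {g : β → β ⊕ E} {j : E → β} {exit : β → Option E}
  {Φ : α ⊕ β ≃ γ} {s : γ → γ}

theorem apply (hg : IsExit g exit) (b : β) : exit b = Sum.elim exit some (g b) := by
  ext e
  rw [hg, ExitsAt.elim]
  cases g b with
  | inl b' => exact (hg b' e).symm
  | inr e' => exact Option.some_inj.symm

theorem exists_iterate_eq (hg : IsExit g exit) (hΦ : Function.Semiconj Φ (glueMap f i g j) s)
    {b : β} {e : E} (hb : exit b = some e) : ∃ m, s^[m] (Φ (.inr b)) = Φ (.inl (i e)) := by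
  induction (hg b e).1 hb with
  | leave h => exact ⟨1, by rw [Function.iterate_one, ← hΦ, glueMap, Sum.elim_inr, h]; rfl⟩
  | step h h' ih =>
    obtain ⟨m, hm⟩ := ih ((hg _ _).2 h')
    refine ⟨m + 1, ?_⟩
    rw [← hm, Function.iterate_succ_apply, ← hΦ, glueMap, Sum.elim_inr, h]
    rfl

/-- The first point outside the glued part on the orbit of a point. -/
def outside (Φ : α ⊕ β ≃ γ) (i : E → α) (exit : β → Option E) (c : γ) : Option α :=
  Sum.elim some (fun b => (exit b).map i) (Φ.symm c)

theorem outside_inl (Φ : α ⊕ β ≃ γ) (i : E → α) (exit : β → Option E) (a : α) :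
    outside Φ i exit (Φ (.inl a)) = some a := by
  rw [outside, Equiv.symm_apply_apply, Sum.elim_inl]

theorem outside_inr (Φ : α ⊕ β ≃ γ) (i : E → α) (exit : β → Option E) (b : β) :
    outside Φ i exit (Φ (.inr b)) = (exit b).map i := by
  rw [outside, Equiv.symm_apply_apply, Sum.elim_inr]

theorem outside_eq_none_iff {c : γ} :
    outside Φ i exit c = none ↔ ∃ b, exit b = none ∧ Φ (.inr b) = c := by
  constructor
  · obtain ⟨a | b, rfl⟩ := Φ.surjective c
    · rw [outside_inl]
      exact fun h => (Option.some_ne_none a h).elim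
    · rw [outside_inr, Option.map_eq_none_iff]
      exact fun h => ⟨b, h, rfl⟩
  · rintro ⟨b, hb, rfl⟩
    rw [outside_inr, hb, Option.map_none]

theorem isFirstReturn (hg : IsExit g exit) (hΦ : Function.Semiconj Φ (glueMap f i g j) s)
    {through : E → E} (hj : ∀ e, exit (j e) = some (through e)) :
    IsFirstReturn s (closeMap f i through) (fun a => Φ (.inl a)) (outside Φ i exit) where
  exit_incl := outside_inl Φ i exit
  exit_step_incl a := by
    rw [← hΦ, glueMap, closeMap, Sum.elim_inl]
    cases f a with
    | inl a' => exact outside_inl Φ i exit a'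
    | inr e => simp only [Sum.elim_inr, outside_inr, hj, Option.map_some]
  exit_step c hc := by
    obtain ⟨a | b, rfl⟩ := Φ.surjective c
    · exact (hc ⟨a, rfl⟩).elim
    · rw [← hΦ, glueMap, Sum.elim_inr, outside_inr, hg.apply b]
      cases g b with
      | inl b' => exact outside_inr Φ i exit b'
      | inr e => exact outside_inl Φ i exit (i e)
  exists_iterate_eq c a hca := by
    obtain ⟨a' | b, rfl⟩ := Φ.surjective c
    · rw [outside_inl] at hca
      exact ⟨0, by rw [Option.some.inj hca]; rfl⟩
    · rw [outside_inr] at hca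
      obtain ⟨e, he, rfl⟩ := Option.map_eq_some_iff.1 hca
      exact hg.exists_iterate_eq hΦ he

theorem iterate_of_eq_none (hg : IsExit g exit) (hΦ : Function.Semiconj Φ (glueMap f i g j) s)
    {b : β} (hb : exit b = none) (m : ℕ) : s^[m] (Φ (.inr b)) =
      Φ (.inr ((closeMap g j id)^[m] b)) ∧ exit ((closeMap g j id)^[m] b) = none := by
  induction m with
  | zero => exact ⟨rfl, hb⟩
  | succ m ih =>
    rw [Function.iterate_succ_apply', Function.iterate_succ_apply', ih.1, ← hΦ, glueMap,
      Sum.elim_inr, closeMap]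
    have h := ih.2
    rw [hg.apply] at h
    cases hf : g ((closeMap g j id)^[m] b) with
    | inl b' => exact ⟨rfl, by simpa [hf] using h⟩
    | inr e => simp [hf] at h

end IsExit

end Gluing

/-! ### Boundaries of 2-cells -/

/-- Passing through a port along the boundary of a 2-cell. -/
def turn {X M : Type} (sign : X → Sign) : Port X M × Line → Port X M × Line
  | (Sum.inl (x, s), i) =>
      (Sum.inl (x, (corner (sign x) (s, i)).1), (corner (sign x) (s, i)).2)
  | (Sum.inr m, i) => (Sum.inr m, i)

/-- The port at which the boundary of a 2-cell arrives along a segment, with the line. -/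
def arrive {P : Type} (next : Equiv.Perm P) (a : P × Line) : P × Line :=
  (if a.2 = 2 then a.1 else next a.1, a.2)

/-- The segment along which the boundary of a 2-cell leaves a port, with the line. -/
def leave {P : Type} (next : Equiv.Perm P) (a : P × Line) : P × Line :=
  if a.2 = 2 then (next.symm a.1, 2) else a

theorem corner_injective (ε : Sign) : Function.Injective (corner ε) := by
  rintro ⟨s, i⟩ ⟨s', i'⟩
  revert i i'
  cases ε <;> cases s <;> cases s' <;> decide

theorem turn_injective {X M : Type} (sign : X → Sign) :
    Function.Injective (turn (M := M) sign) := by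
  rintro ⟨⟨x, s⟩ | m, i⟩ ⟨⟨x', s'⟩ | m', i'⟩ h
  · simp only [turn, Prod.mk.injEq, Sum.inl.injEq] at h
    obtain ⟨⟨rfl, hs⟩, hi⟩ := h
    obtain ⟨rfl, rfl⟩ := Prod.mk.inj (corner_injective _ (Prod.ext hs hi))
    rfl
  · simp [turn] at h
  · simp [turn] at h
  · exact h

theorem arrive_injective {P : Type} (next : Equiv.Perm P) : Function.Injective (arrive next) := by
  rintro ⟨p, i⟩ ⟨p', i'⟩ h
  simp only [arrive, Prod.mk.injEq] at h
  obtain ⟨h, rfl⟩ := h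
  by_cases hi : i = 2 <;> simp_all

theorem leave_injective {P : Type} (next : Equiv.Perm P) : Function.Injective (leave next) := by
  rintro ⟨p, i⟩ ⟨p', i'⟩ h
  by_cases hi : i = 2 <;> by_cases hi' : i' = 2 <;> simp_all [leave]

theorem leave_snd {P : Type} (next : Equiv.Perm P) (a : P × Line) : (leave next a).2 = a.2 := by
  by_cases h : a.2 = 2 <;> simp [leave, h]

theorem turn_map {X Y M N : Type} {sX : X → Sign} {sY : Y → Sign} (f : X → Y) (g : M → N)
    (h : ∀ x, sY (f x) = sX x) (a : Port X M × Line) :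
    turn sY (Prod.map (Sum.map (Prod.map f id) g) id a) =
      Prod.map (Sum.map (Prod.map f id) g) id (turn sX a) := by
  obtain ⟨⟨x, s⟩ | m, i⟩ := a <;> simp [turn, h]

theorem arrive_map {P Q : Type} {nP : Equiv.Perm P} {nQ : Equiv.Perm Q} {ι : P → Q}
    (h : ∀ p, nQ (ι p) = ι (nP p)) (a : P × Line) :
    arrive nQ (Prod.map ι id a) = Prod.map ι id (arrive nP a) := by
  by_cases ha : a.2 = 2 <;> simp [arrive, ha, h]

theorem leave_map {P Q : Type} {nP : Equiv.Perm P} {nQ : Equiv.Perm Q} {ι : P → Q}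
    (h : ∀ p, nQ (ι p) = ι (nP p)) (a : P × Line) :
    leave nQ (Prod.map ι id a) = Prod.map ι id (leave nP a) := by
  have hsymm : ∀ p, nQ.symm (ι p) = ι (nP.symm p) := fun p => by
    rw [Equiv.symm_apply_eq, h, Equiv.apply_symm_apply]
  by_cases ha : a.2 = 2 <;> simp [leave, ha, hsymm, Prod.map]

instance : Fintype Strand := ⟨{.upper, .lower}, by rintro (_ | _) <;> decide⟩

namespace Diagram

instance {A : Type} (D : Diagram A) : Finite D.X := D.finX
instance {A : Type} (D : Diagram A) : Finite D.M := D.finM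
noncomputable instance {A : Type} (D : Diagram A) : Fintype (Port D.X D.M) := Fintype.ofFinite _

section Boundary

variable {A : Type} (D : Diagram A)

theorem step_eq (a : D.Position) :
    D.step a = leave D.next (turn D.sign (arrive D.next a)) := by
  obtain ⟨p, i⟩ := a
  unfold step arrive
  generalize (if (p, i).2 = 2 then (p, i).1 else D.next (p, i).1) = q
  rcases q with ⟨x, s⟩ | m <;> simp only [turn, leave] <;> split_ifs with h <;> simp_all

theorem step_injective : Function.Injective D.step := by
  rw [show D.step = leave D.next ∘ turn D.sign ∘ arrive D.next from funext D.step_eq]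
  exact (leave_injective _).comp ((turn_injective _).comp (arrive_injective _))

theorem step_map {B : Type} {D : Diagram A} {D' : Diagram B} (f : D.X → D'.X) (g : D.M → D'.M)
    (hsign : ∀ x, D'.sign (f x) = D.sign x)
    (hnext : ∀ p, D'.next (Sum.map (Prod.map f id) g p) = Sum.map (Prod.map f id) g (D.next p))
    (a : D.Position) :
    D'.step (Prod.map (Sum.map (Prod.map f id) g) id a) =
      Prod.map (Sum.map (Prod.map f id) g) id (D.step a) := by
  rw [step_eq, step_eq, arrive_map hnext, turn_map f g hsign, leave_map hnext]

/-- The components of the boundary surface of the thickened polyhedron. -/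
abbrev BoundaryComponent : Type := Quot D.BoundaryAdj

/-- The component containing a given side of the 2-cell through a position. -/
abbrev component (a : D.Position) (σ : Side) : D.BoundaryComponent := Quot.mk _ (a, σ)

theorem component_step (a : D.Position) (σ : Side) :
    D.component (D.step a) σ = D.component a σ :=
  (Quot.sound (.along a σ)).symm

theorem component_iterate (a : D.Position) (σ : Side) (n : ℕ) :
    D.component (D.step^[n] a) σ = D.component a σ := by
  induction n with
  | zero => rfl
  | succ n ih => rw [Function.iterate_succ_apply', component_step, ih]

/-- The pairs of sides of the three sheets along a segment which are adjacent in the boundary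
surface. -/
def rim : List ((Line × Side) × (Line × Side)) :=
  [((2, .top), (1, .top)), ((2, .bottom), (0, .bottom)), ((0, .top), (1, .bottom))]

theorem component_eq_of_mem_rim (p : Port D.X D.M) {e : (Line × Side) × (Line × Side)}
    (he : e ∈ rim) : D.component (p, e.1.1) e.1.2 = D.component (p, e.2.1) e.2.2 := by
  simp only [rim, List.mem_cons, List.not_mem_nil, or_false] at he
  obtain rfl | rfl | rfl := he
  exacts [Quot.sound (.above p), Quot.sound (.below p), Quot.sound (.between p)]

/-- A function on the components of the boundary surface. -/
def BoundaryComponent.lift {D : Diagram A} {γ : Type*} (f : D.Position → Side → γ)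
    (hstep : ∀ a σ, f (D.step a) σ = f a σ)
    (hrim : ∀ p, ∀ e ∈ rim, f (p, e.1.1) e.1.2 = f (p, e.2.1) e.2.2) : D.BoundaryComponent → γ :=
  Quot.lift (fun x => f x.1 x.2) (by
    rintro _ _ (⟨a, σ⟩ | p | p | p)
    exacts [(hstep a σ).symm, hrim p _ (.head _), hrim p _ (.tail _ (.head _)),
      hrim p _ (.tail _ (.tail _ (.head _)))])

end Boundary

/-- Twice the rotation number of a step along the boundary of a 2-cell. -/
def rot (D : Diagram ℤ) (a : D.Position) : ℤ := 2 * D.signedWeight a - D.dot a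

/-- Every circuit has rotation number `-1`. -/
def Balanced (D : Diagram ℤ) : Prop := ∀ q : Orbits D.step, orbitSum D.step D.rot q = -2

theorem coboundary_eq_eulerCochain_iff (D : Diagram ℤ) (a : D.Position) :
    ((D.coboundary a : ℚ) = D.eulerCochain a) ↔ orbitSum D.step D.rot (orbit D.step a) = -2 := by
  have sum_eq : orbitSum D.step D.rot (orbit D.step a) = 2 * D.coboundary a - D.dots a := by
    simp only [← sum_range_minimalPeriod D.step_injective, rot, coboundary, dots,
      Finset.sum_sub_distrib, Finset.mul_sum, Nat.cast_sum]
  rw [sum_eq, eulerCochain, ← Int.cast_inj (α := ℚ)]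
  push_cast
  constructor <;> intro h <;> linarith

theorem isFramed_iff (D : Diagram ℤ) : D.IsFramed ↔ Subsingleton D.BoundaryComponent ∧
    Nat.card (Orbits D.step) = Nat.card D.X + 1 ∧ Subsingleton (Orbits D.next) ∧ D.Balanced := by
  have forall_quot_eq {α : Type} (r : α → α → Prop) :
      Subsingleton (Quot r) ↔ ∀ a b, Quot.mk r a = Quot.mk r b := by
    rw [subsingleton_iff, Quot.mk_surjective.forall]
    exact forall_congr' fun a => Quot.mk_surjective.forall
  simp only [IsFramed, IsClosed, and_assoc, forall_quot_eq, Quot.eq (r := D.BoundaryAdj),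
    orbit_eq_orbit_iff_sameCycle, coboundary_eq_eulerCochain_iff]
  exact and_congr_right fun _ => and_congr_right fun _ => and_congr_right fun _ =>
    (Quot.mk_surjective.forall (p := fun q => orbitSum D.step D.rot q = -2)).symm

open Classical in
/-- The diagram `D'` is obtained from `D` by cutting its segments into smaller ones: `collapse`
sends a small segment to the segment of `D` containing it, `incl` chooses a small segment in each
segment, and `ret` the small segment which the boundary of a 2-cell traverses last. -/
structure Refinement (D D' : Diagram ℤ) where
  incl : Port D.X D.M → Port D'.X D'.M
  collapse : Port D'.X D'.M → Port D.X D.M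
  ret : D.Position → D'.Position
  card_X : Nat.card D'.X = Nat.card D.X
  collapse_incl : ∀ p, collapse (incl p) = p
  orbit_incl_next : ∀ p, orbit D'.next (incl (D.next p)) = orbit D'.next (incl p)
  orbit_collapse_next : ∀ q, orbit D.next (collapse (D'.next q)) = orbit D.next (collapse q)
  orbit_incl_collapse : ∀ q, orbit D'.next (incl (collapse q)) = orbit D'.next q
  isFirstReturn : IsFirstReturn D'.step D.step ret fun a => some (collapse a.1, a.2)
  rot_eq_sum : ∀ b, D.rot b = ∑ q with collapse q = b.1, D'.rot (q, b.2)

namespace Refinement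

variable {D D' : Diagram ℤ} (h : Refinement D D')

include h

theorem component_ret_collapse (a : D'.Position) (σ : Side) :
    D'.component (h.ret (h.collapse a.1, a.2)) σ = D'.component a σ := by
  obtain ⟨n, hn⟩ := h.isFirstReturn.exists_iterate_eq a _ rfl
  rw [← hn, component_iterate]

theorem component_ret (p : Port D.X D.M) (j : Line) (σ : Side) :
    D'.component (h.ret (p, j)) σ = D'.component (h.incl p, j) σ := by
  rw [← h.component_ret_collapse (h.incl p, j), h.collapse_incl]

theorem component_ret_step (b : D.Position) (σ : Side) :
    D'.component (h.ret (D.step b)) σ = D'.component (h.ret b) σ := by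
  have h_step := Option.some.inj (h.isFirstReturn.exit_step_incl b)
  rw [← h_step, component_ret_collapse, component_step]

theorem component_collapse_step (a : D'.Position) (σ : Side) :
    D.component (h.collapse (D'.step a).1, (D'.step a).2) σ =
      D.component (h.collapse a.1, a.2) σ := by
  by_cases ha : a ∈ Set.range h.ret
  · obtain ⟨b, rfl⟩ := ha
    have h_incl := Option.some.inj (h.isFirstReturn.exit_incl b)
    have h_step := Option.some.inj (h.isFirstReturn.exit_step_incl b)
    rw [h_incl, h_step, component_step]
  · rw [Option.some.inj (h.isFirstReturn.exit_step a ha)]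

theorem subsingleton_boundaryComponent_iff :
    Subsingleton D.BoundaryComponent ↔ Subsingleton D'.BoundaryComponent := by
  constructor <;> intro _
  · refine Function.Surjective.subsingleton
      (f := BoundaryComponent.lift (fun b => D'.component (h.ret b)) h.component_ret_step
        fun p e he => ?_) ?_
    · simpa only [component_ret] using D'.component_eq_of_mem_rim (h.incl p) he
    · rintro ⟨a, σ⟩
      exact ⟨D.component _ σ, h.component_ret_collapse a σ⟩
  · refine Function.Surjective.subsingleton
      (f := BoundaryComponent.lift (fun a => D.component (h.collapse a.1, a.2))
        h.component_collapse_step fun q e he => D.component_eq_of_mem_rim (h.collapse q) he) ?_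
    rintro ⟨⟨p, j⟩, σ⟩
    exact ⟨D'.component (h.incl p, j) σ,
      congrArg (fun p => D.component (p, j) σ) (h.collapse_incl p)⟩

theorem subsingleton_orbits_next_iff :
    Subsingleton (Orbits D.next) ↔ Subsingleton (Orbits D'.next) := by
  constructor <;> intro _
  · let f : Orbits D.next → Orbits D'.next :=
      Quot.lift (fun p => orbit D'.next (h.incl p)) fun p _ hp => hp ▸ (h.orbit_incl_next p).symm
    refine Function.Surjective.subsingleton (f := f) ?_
    rintro ⟨q⟩
    exact ⟨orbit D.next (h.collapse q), h.orbit_incl_collapse q⟩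
  · let f : Orbits D'.next → Orbits D.next :=
      Quot.lift (fun q => orbit D.next (h.collapse q)) fun q _ hq =>
        hq ▸ (h.orbit_collapse_next q).symm
    refine Function.Surjective.subsingleton (f := f) ?_
    rintro ⟨p⟩
    exact ⟨orbit D'.next (h.incl p), congrArg (orbit D.next) (h.collapse_incl p)⟩

theorem balanced_iff : D.Balanced ↔ D'.Balanced := by
  classical
  have sum_rot (b : D.Position) :
      D.rot b = ∑ a with some (h.collapse a.1, a.2) = some b, D'.rot a := by
    rw [h.rot_eq_sum]
    refine Finset.sum_bij (fun q _ => (q, b.2)) ?_ ?_ ?_ fun _ _ => rfl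
    · intro q hq
      simpa [Prod.ext_iff] using hq
    · intro q _ q' _ hqq'
      exact congrArg Prod.fst hqq'
    · rintro ⟨q, j⟩ hq
      simp only [Finset.mem_filter_univ, Option.some_inj, Prod.ext_iff] at hq
      exact ⟨q, by simpa using hq.1, by rw [hq.2]⟩
  unfold Balanced
  rw [(h.isFirstReturn.extend_surjective fun _ => Option.some_ne_none _).forall]
  simp only [h.isFirstReturn.orbitSum_extend sum_rot]

theorem isFramed_iff : D.IsFramed ↔ D'.IsFramed := by
  rw [Diagram.isFramed_iff, Diagram.isFramed_iff, h.subsingleton_boundaryComponent_iff,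
    h.isFirstReturn.card_orbits fun _ => Option.some_ne_none _, h.card_X,
    h.subsingleton_orbits_next_iff, h.balanced_iff]

end Refinement

theorem Iso.isFramed_iff {D D' : Diagram ℤ} (h : Iso D D') : D.IsFramed ↔ D'.IsFramed := by
  obtain ⟨f, g, hsign, hnext, hweight⟩ := h
  let ι : Port D.X D.M ≃ Port D'.X D'.M := Equiv.sumCongr (Equiv.prodCongr f (.refl _)) g
  have hstep : ∀ b : D.Position, D'.step (ι b.1, b.2) = (ι (D.step b).1, (D.step b).2) :=
    step_map f g hsign hnext
  replace hnext : ∀ p, D'.next (ι p) = ι (D.next p) := hnext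
  replace hweight : ∀ p, D'.weight (ι p) = D.weight p := hweight
  refine Refinement.isFramed_iff
    { incl := ι
      collapse := ι.symm
      ret := fun b => (ι b.1, b.2)
      card_X := (Nat.card_congr f).symm
      collapse_incl := ι.symm_apply_apply
      orbit_incl_next := fun p => by rw [← hnext, orbit_apply]
      orbit_collapse_next := ι.surjective.forall.2 fun p => by
        simp only [hnext, Equiv.symm_apply_apply, orbit_apply]
      orbit_incl_collapse := fun q => by rw [Equiv.apply_symm_apply]
      isFirstReturn :=
        { exit_incl := by simp
          exit_step_incl := by simp [hstep]
          exit_step := fun a ha => (ha ⟨(ι.symm a.1, a.2), by simp⟩).elim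
          exists_iterate_eq := fun a b hb => ⟨0, by simp [← Option.some.inj hb]⟩ }
      rot_eq_sum := fun b => ?_ }
  rw [Finset.sum_eq_single_of_mem (ι b.1) (by simp)]
  · simp only [rot, signedWeight, dot, hstep, hweight]
  · intro q hq hqb
    simp only [Finset.mem_filter_univ, Equiv.symm_apply_eq] at hq
    exact (hqb hq).elim

end Diagram

namespace Diagram

/-- `D'` is obtained from `D` by inserting a marked point in the segment `e`: the bijection `Φ`
sends `some p` to the first segment obtained from the segment `p`, and `none` to the second segment
obtained from `e`, which starts at the new marked point. -/
structure InsertsPoint (D D' : Diagram ℤ) (e : Port D.X D.M)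
    (Φ : Option (Port D.X D.M) ≃ Port D'.X D'.M) : Prop where
  card_X : Nat.card D'.X = Nat.card D.X
  turn_some : ∀ a : D.Position, turn D'.sign (Φ (some a.1), a.2) =
    (Φ (some (turn D.sign a).1), (turn D.sign a).2)
  turn_none : ∀ j, turn D'.sign (Φ none, j) = (Φ none, j)
  next_some_self : D'.next (Φ (some e)) = Φ none
  next_none : D'.next (Φ none) = Φ (some (D.next e))
  next_some : ∀ p, p ≠ e → D'.next (Φ (some p)) = Φ (some (D.next p))
  weight_add : D'.weight (Φ (some e)) + D'.weight (Φ none) = D.weight e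
  weight_some : ∀ p, p ≠ e → D'.weight (Φ (some p)) = D.weight p

theorem Subdivides.exists_insertsPoint {D D' : Diagram ℤ} (h : Subdivides D D') :
    ∃ e Φ, InsertsPoint D D' e Φ := by
  obtain ⟨f, g, e, hsign, hnext_self, hnext_none, hnext, hweight_add, hweight⟩ := h
  let φ : Option (Port D.X D.M) → Port D'.X D'.M :=
    fun o => o.elim (.inr (g none)) (Sum.map (Prod.map f id) fun m => g (some m))
  have injective : Function.Injective φ := by
    rintro (_ | ⟨x, s⟩ | m) (_ | ⟨x', s'⟩ | m') h <;> simp_all [φ]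
  have surjective : Function.Surjective φ := by
    rintro (⟨x, s⟩ | m)
    · exact ⟨some (.inl (f.symm x, s)), by simp [φ]⟩
    · obtain ⟨_ | m, rfl⟩ := g.surjective m
      exacts [⟨none, rfl⟩, ⟨some (.inr m), rfl⟩]
  exact ⟨e, .ofBijective φ ⟨injective, surjective⟩,
    { card_X := (Nat.card_congr f).symm
      turn_some := turn_map f _ hsign
      turn_none := fun _ => rfl
      next_some_self := hnext_self
      next_none := hnext_none
      next_some := hnext
      weight_add := hweight_add
      weight_some := hweight }⟩

namespace InsertsPoint

variable {D D' : Diagram ℤ} {e : Port D.X D.M} {Φ : Option (Port D.X D.M) ≃ Port D'.X D'.M}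

open Classical in
/-- The last position traversed by the boundary of a 2-cell along a segment of `D`. -/
noncomputable def ret (e : Port D.X D.M) (Φ : Option (Port D.X D.M) ≃ Port D'.X D'.M)
    (b : D.Position) : D'.Position :=
  if b.1 = e ∧ b.2 ≠ 2 then (Φ none, b.2) else (Φ (some b.1), b.2)

theorem collapse_ret (b : D.Position) :
    ((Φ.symm (ret e Φ b).1).getD e, (ret e Φ b).2) = b := by
  unfold ret
  split_ifs with h
  · simp [← h.1]
  · simp

theorem mem_range_ret_or (a : D'.Position) :
    a ∈ Set.range (ret e Φ) ∨ (∃ j ≠ 2, a = (Φ (some e), j)) ∨ a = (Φ none, 2) := by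
  obtain ⟨q, j⟩ := a
  obtain ⟨_ | p, rfl⟩ := Φ.surjective q <;> by_cases hj : j = 2
  · exact .inr (.inr (by rw [hj]))
  · exact .inl ⟨(e, j), if_pos ⟨rfl, hj⟩⟩
  · exact .inl ⟨(p, j), if_neg fun h => h.2 hj⟩
  · by_cases hp : p = e
    · exact .inr (.inl ⟨j, hj, by rw [hp]⟩)
    · exact .inl ⟨(p, j), if_neg fun h => hp h.1⟩

variable (h : InsertsPoint D D' e Φ)

include h

theorem orbit_next_none : orbit D'.next (Φ none) = orbit D'.next (Φ (some e)) := by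
  rw [← h.next_some_self, orbit_apply]

theorem collapse_next_symm (p : Port D.X D.M) :
    (Φ.symm (D'.next.symm (Φ (some p)))).getD e = D.next.symm p := by
  obtain ⟨p, rfl⟩ := D.next.surjective p
  by_cases hp : p = e
  · rw [hp, ← h.next_none]
    simp
  · rw [← h.next_some p hp]
    simp

theorem arrive_ret (b : D.Position) :
    arrive D'.next (ret e Φ b) = (Φ (some (arrive D.next b).1), (arrive D.next b).2) := by
  obtain ⟨p, j⟩ := b
  by_cases hj : j = 2
  · simp [ret, arrive, hj]
  · by_cases hp : p = e
    · simp [ret, arrive, hj, hp, h.next_none]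
    · simp [ret, arrive, hj, hp, h.next_some p hp]

theorem collapse_step_ret (b : D.Position) :
    ((Φ.symm (D'.step (ret e Φ b)).1).getD e, (D'.step (ret e Φ b)).2) = D.step b := by
  rw [step_eq, step_eq, h.arrive_ret, h.turn_some]
  generalize turn D.sign (arrive D.next b) = c
  refine Prod.ext ?_ (by rw [leave_snd, leave_snd])
  by_cases hc : c.2 = 2
  · simp [leave, hc, h.collapse_next_symm]
  · simp [leave, hc]

theorem step_some_self {j : Line} (hj : j ≠ 2) : D'.step (Φ (some e), j) = (Φ none, j) := by
  rw [step_eq]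
  simp [arrive, hj, h.next_some_self, h.turn_none, leave]

theorem step_none : D'.step (Φ none, 2) = (Φ (some e), 2) := by
  rw [step_eq]
  simp [arrive, h.turn_none, leave, Equiv.symm_apply_eq, h.next_some_self]

theorem isFirstReturn :
    IsFirstReturn D'.step D.step (ret e Φ) fun a => some ((Φ.symm a.1).getD e, a.2) where
  exit_incl b := congrArg some (collapse_ret b)
  exit_step_incl b := congrArg some (h.collapse_step_ret b)
  exit_step a ha := by
    rcases mem_range_ret_or (e := e) (Φ := Φ) a with ha' | ⟨j, hj, rfl⟩ | rfl
    · exact absurd ha' ha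
    · simp [h.step_some_self hj]
    · simp [h.step_none]
  exists_iterate_eq a b hb := by
    obtain rfl := Option.some.inj hb
    rcases mem_range_ret_or (e := e) (Φ := Φ) a with ⟨b, rfl⟩ | ⟨j, hj, rfl⟩ | rfl
    · exact ⟨0, by rw [collapse_ret]; rfl⟩
    · exact ⟨1, by simp [h.step_some_self hj, ret, hj]⟩
    · exact ⟨1, by simp [h.step_none, ret]⟩

theorem dot_ret (b : D.Position) : D'.dot (ret e Φ b) = D.dot b := by
  have line_ret : (ret e Φ b).2 = b.2 := congrArg Prod.snd (collapse_ret b)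
  have line_step : (D'.step (ret e Φ b)).2 = (D.step b).2 :=
    congrArg Prod.snd (h.collapse_step_ret b)
  simp only [dot, line_ret, line_step]

theorem rot_some {p : Port D.X D.M} (hp : p ≠ e) (j : Line) :
    D'.rot (Φ (some p), j) = D.rot (p, j) := by
  have hdot := h.dot_ret (p, j)
  simp only [ret, hp, false_and, if_false] at hdot
  simp only [rot, signedWeight, hdot, h.weight_some p hp]

theorem rot_some_self_add_rot_none (j : Line) :
    D'.rot (Φ (some e), j) + D'.rot (Φ none, j) = D.rot (e, j) := by
  have hdot := h.dot_ret (e, j)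
  by_cases hj : j = 2
  · have dot_none : D'.dot (Φ none, 2) = 0 := by simp [dot, h.step_none]
    subst hj
    simp only [ret, ne_eq, not_true_eq_false, and_false, if_false] at hdot
    simp only [rot, signedWeight, if_true, hdot, dot_none, ← h.weight_add]
    push_cast
    ring
  · have dot_some : D'.dot (Φ (some e), j) = 0 := by simp [dot, h.step_some_self hj]
    simp only [ret, ne_eq, hj, not_false_eq_true, and_self, if_true] at hdot
    simp only [rot, signedWeight, if_neg hj, hdot, dot_some, ← h.weight_add]
    push_cast
    ring

open Classical in
theorem rot_eq_sum (b : D.Position) :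
    D.rot b = ∑ q with (Φ.symm q).getD e = b.1, D'.rot (q, b.2) := by
  obtain ⟨p, j⟩ := b
  rw [Finset.sum_filter, ← Φ.sum_comp, Fintype.sum_option]
  simp only [Equiv.symm_apply_apply, Option.getD_none, Option.getD_some, Finset.sum_ite_eq',
    Finset.mem_univ, if_true]
  by_cases hp : p = e
  · rw [hp, if_pos rfl, add_comm, h.rot_some_self_add_rot_none]
  · rw [if_neg (Ne.symm hp), zero_add, h.rot_some hp]

/-- Inserting a marked point is a refinement. -/
noncomputable def refinement : Refinement D D' where
  incl p := Φ (some p)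
  collapse q := (Φ.symm q).getD e
  ret := ret e Φ
  card_X := h.card_X
  collapse_incl p := by simp
  orbit_incl_next p := by
    by_cases hp : p = e
    · rw [hp, ← h.next_none, orbit_apply, h.orbit_next_none]
    · rw [← h.next_some p hp, orbit_apply]
  orbit_collapse_next q := by
    obtain ⟨_ | p, rfl⟩ := Φ.surjective q
    · simp [h.next_none, orbit_apply]
    · by_cases hp : p = e
      · simp [hp, h.next_some_self]
      · simp [h.next_some p hp, orbit_apply]
  orbit_incl_collapse q := by
    obtain ⟨_ | p, rfl⟩ := Φ.surjective q
    · simp [h.orbit_next_none]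
    · simp
  isFirstReturn := h.isFirstReturn
  rot_eq_sum := h.rot_eq_sum

end InsertsPoint

end Diagram

theorem NormalOGraph.isFramed_iff_of_mk_eq {D D' : Diagram ℤ}
    (h : NormalOGraph.mk D = NormalOGraph.mk D') : D.IsFramed ↔ D'.IsFramed := by
  have hgen := Quot.eqvGen_exact h
  clear h
  induction hgen with
  | rel D D' h =>
    rcases h with h | h
    · exact h.isFramed_iff
    · obtain ⟨e, Φ, h⟩ := h.exists_insertsPoint
      exact h.refinement.isFramed_iff
  | refl => exact Iff.rfl
  | symm _ _ _ ih => exact ih.symm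
  | trans _ _ _ _ _ ih ih' => exact ih.trans ih'

/-! ### Local pictures and their exteriors -/

/-- Tells whether a port is one of the distinguished points. -/
def splitHole {X M : Type} {n : ℕ} : Port X (M ⊕ Fin n) → Port X (M ⊕ Fin n) ⊕ Fin n
  | .inr (.inr k) => .inr k
  | p => .inl p

theorem splitHole_eq_inl {X M : Type} {n : ℕ} {p q : Port X (M ⊕ Fin n)}
    (h : splitHole p = .inl q) : p = q := by
  rcases p with _ | _ | _ <;> simp_all [splitHole]

theorem splitHole_eq_inr {X M : Type} {n : ℕ} {p : Port X (M ⊕ Fin n)} {k : Fin n}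
    (h : splitHole p = .inr k) : p = .inr (.inr k) := by
  rcases p with _ | _ | _ <;> simp_all [splitHole]

theorem splitHole_turn {X M : Type} {n : ℕ} {sign : X → Sign} {p : Port X (M ⊕ Fin n)} {j : Line}
    (h : splitHole p = .inl p) :
    splitHole (turn sign (p, j)).1 = .inl (turn sign (p, j)).1 := by
  rcases p with _ | _ | _ <;> simp_all [splitHole, turn]

namespace Tangle

variable {A : Type} {n : ℕ}

instance (T : Tangle A n) : Finite T.X := T.finX
instance (T : Tangle A n) : Finite T.M := T.finM

/-- The places where the boundary of a 2-cell may enter or leave a tangle: a line along a strand. -/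
abbrev Gate (n : ℕ) : Type := Fin n × Line

/-- The segments of a tangle, named after the port at which they start. -/
abbrev Segment (T : Tangle A n) : Type := Port T.X (T.M ⊕ Fin n)

/-- The positions in a tangle: a line along a segment. -/
abbrev Position (T : Tangle A n) : Type := T.Segment × Line

/-- The distinguished point of a strand. -/
abbrev hole (T : Tangle A n) (k : Fin n) : T.Segment := .inr (.inr k)

/-- The segment following a given one, unless the strand leaves the tangle. -/
def strandStep (T : Tangle A n) (p : T.Segment) : T.Segment ⊕ Fin n := splitHole (T.next p)

/-- The position following a given one along the boundary of a 2-cell, unless it leaves the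
tangle. -/
def lineStep (T : Tangle A n) (a : T.Position) : T.Position ⊕ Gate n :=
  (splitHole (arrive T.next a).1).map (fun q => leave T.next (turn T.sign (q, a.2))) (·, a.2)

/-- The position at which the boundary of a 2-cell enters a tangle. -/
def entry (T : Tangle A n) (e : Gate n) : T.Position := leave T.next (T.hole e.1, e.2)

/-- Twice the rotation number of a step in a tangle along the boundary of a 2-cell. -/
def rot (T : Tangle ℤ n) (a : T.Position) : ℤ :=
  2 * (if a.2 = 2 then -T.weight a.1 else T.weight a.1) -
    if a.2 = 2 ↔ (T.lineStep a).elim Prod.snd Prod.snd = 2 then 0 else 1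

section Part

variable {D : Diagram A} {C T : Tangle A n} {ι : C.Segment → Port D.X D.M}
  {κ : T.Segment → Port D.X D.M}

theorem next_symm_of_glue
    (hι : ∀ p, D.next (ι p) = Sum.elim ι (fun k => κ (T.hole k)) (C.strandStep p)) (q : C.Segment) :
    D.next.symm (Sum.elim ι (fun k => κ (T.hole k)) (splitHole q)) = ι (C.next.symm q) := by
  rw [Equiv.symm_apply_eq, hι, strandStep, Equiv.apply_symm_apply]

theorem leave_of_glue
    (hι : ∀ p, D.next (ι p) = Sum.elim ι (fun k => κ (T.hole k)) (C.strandStep p))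
    {a : C.Position} (ha : splitHole a.1 = .inl a.1) :
    leave D.next (Prod.map ι id a) = Prod.map ι id (leave C.next a) := by
  have hsymm := next_symm_of_glue hι a.1
  rw [ha, Sum.elim_inl] at hsymm
  by_cases h : a.2 = 2 <;> simp [leave, h, hsymm, Prod.map]

theorem step_of_glue
    (hturn : ∀ p j, turn D.sign (ι p, j) = Prod.map ι id (turn C.sign (p, j)))
    (hturn' : ∀ p j, turn D.sign (κ p, j) = Prod.map κ id (turn T.sign (p, j)))
    (hι : ∀ p, D.next (ι p) = Sum.elim ι (fun k => κ (T.hole k)) (C.strandStep p))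
    (hκ : ∀ p, D.next (κ p) = Sum.elim κ (fun k => ι (C.hole k)) (T.strandStep p))
    (a : C.Position) :
    D.step (Prod.map ι id a) =
      Sum.elim (Prod.map ι id) (fun e => Prod.map κ id (T.entry e)) (C.lineStep a) := by
  obtain ⟨p, j⟩ := a
  have turn_hole (k : Fin n) : turn D.sign (ι (C.hole k), j) = (ι (C.hole k), j) := hturn _ _
  have turn_hole' (k : Fin n) : turn D.sign (κ (T.hole k), j) = (κ (T.hole k), j) := hturn' _ _
  have leave_turn (q : C.Segment) : leave D.next (turn D.sign
      (if j = 2 then ι q else Sum.elim ι (fun k => κ (T.hole k)) (splitHole q), j)) =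
      Sum.elim (Prod.map ι id) (fun e => Prod.map κ id (T.entry e))
        ((splitHole q).map (fun q => leave C.next (turn C.sign (q, j))) (·, j)) := by
    cases hq : splitHole q with
    | inl q' =>
      obtain rfl := splitHole_eq_inl hq
      rw [Sum.elim_inl, ite_self, hturn, leave_of_glue hι (splitHole_turn hq)]
      rfl
    | inr k =>
      obtain rfl := splitHole_eq_inr hq
      by_cases hj : j = 2
      · rw [if_pos hj, turn_hole, leave, if_pos hj, Sum.map_inr, Sum.elim_inr, entry, leave,
          if_pos hj]
        exact Prod.ext (next_symm_of_glue hκ (T.hole k)) rfl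
      · rw [if_neg hj, Sum.elim_inr, turn_hole', leave, if_neg hj, Sum.map_inr, Sum.elim_inr,
          entry, leave, if_neg hj]
        rfl
  rw [D.step_eq]
  by_cases hj : j = 2
  · simpa [arrive, hj, lineStep] using leave_turn p
  · simpa [arrive, hj, lineStep, hι, strandStep] using leave_turn (C.next p)

end Part

section Glue

variable (C T : Tangle A n)

/-- The segments of a glued diagram. -/
def segmentEquiv : C.Segment ⊕ T.Segment ≃ Port (C.glue T).X (C.glue T).M :=
  (portSum C.X T.X (C.M ⊕ Fin n) (T.M ⊕ Fin n)).symm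

/-- The positions of a glued diagram. -/
def positionEquiv : C.Position ⊕ T.Position ≃ (C.glue T).Position :=
  (Equiv.sumProdDistrib C.Segment T.Segment Line).symm.trans
    ((C.segmentEquiv T).prodCongr (Equiv.refl Line))

/-- The segments of the outside in a glued diagram. -/
abbrev outer (p : C.Segment) : Port (C.glue T).X (C.glue T).M := C.segmentEquiv T (.inl p)

/-- The segments of the local picture in a glued diagram. -/
abbrev inner (p : T.Segment) : Port (C.glue T).X (C.glue T).M := C.segmentEquiv T (.inr p)

theorem glue_next_outer (p : C.Segment) : (C.glue T).next (C.outer T p) =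
    Sum.elim (C.outer T) (fun k => C.inner T (T.hole k)) (C.strandStep p) := by
  have h : (C.glue T).next (C.outer T p) =
      Equiv.sumCongr (Equiv.refl _) (swapHoles C.M T.M n) (C.outer T (C.next p)) := by
    rcases p with ⟨x, s⟩ | m | k <;> rfl
  rw [h, strandStep]
  rcases C.next p with ⟨x, s⟩ | m | k <;> rfl

theorem glue_next_inner (p : T.Segment) : (C.glue T).next (C.inner T p) =
    Sum.elim (C.inner T) (fun k => C.outer T (C.hole k)) (T.strandStep p) := by
  have h : (C.glue T).next (C.inner T p) =
      Equiv.sumCongr (Equiv.refl _) (swapHoles C.M T.M n) (C.inner T (T.next p)) := by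
    rcases p with ⟨x, s⟩ | m | k <;> rfl
  rw [h, strandStep]
  rcases T.next p with ⟨x, s⟩ | m | k <;> rfl

theorem semiconj_segmentEquiv : Function.Semiconj (C.segmentEquiv T)
    (glueMap C.strandStep C.hole T.strandStep T.hole) (C.glue T).next := by
  rintro (p | p)
  · rw [glue_next_outer, glueMap, Sum.elim_inl]
    cases C.strandStep p <;> rfl
  · rw [glue_next_inner, glueMap, Sum.elim_inr]
    cases T.strandStep p <;> rfl

theorem turn_outer (p : C.Segment) (j : Line) : turn (C.glue T).sign (C.outer T p, j) =
    Prod.map (C.outer T) id (turn C.sign (p, j)) := by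
  rcases p with ⟨x, s⟩ | m | k <;> rfl

theorem turn_inner (p : T.Segment) (j : Line) : turn (C.glue T).sign (C.inner T p, j) =
    Prod.map (C.inner T) id (turn T.sign (p, j)) := by
  rcases p with ⟨x, s⟩ | m | k <;> rfl

theorem semiconj_positionEquiv : Function.Semiconj (C.positionEquiv T)
    (glueMap C.lineStep C.entry T.lineStep T.entry) (C.glue T).step := by
  rintro (a | a)
  · refine .trans ?_ (step_of_glue (C.turn_outer T) (C.turn_inner T) (C.glue_next_outer T)
      (C.glue_next_inner T) a).symm
    rw [glueMap, Sum.elim_inl]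
    cases C.lineStep a <;> rfl
  · refine .trans ?_ (step_of_glue (C.turn_inner T) (C.turn_outer T) (C.glue_next_inner T)
      (C.glue_next_outer T) a).symm
    rw [glueMap, Sum.elim_inr]
    cases T.lineStep a <;> rfl

end Glue

section Rot

variable (C T : Tangle ℤ n)

theorem glue_weight_outer (p : C.Segment) :
    (C.glue T).weight (C.outer T p) = C.weight p := by
  rcases p with _ | _ | _ <;> rfl

theorem glue_weight_inner (p : T.Segment) :
    (C.glue T).weight (C.inner T p) = T.weight p := by
  rcases p with _ | _ | _ <;> rfl

theorem rot_outer (a : C.Position) :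
    (C.glue T).rot (C.positionEquiv T (.inl a)) = C.rot a := by
  have hstep : ((C.glue T).step (C.positionEquiv T (.inl a))).2 =
      (C.lineStep a).elim Prod.snd Prod.snd := by
    rw [← C.semiconj_positionEquiv T, glueMap, Sum.elim_inl]
    cases C.lineStep a
    exacts [rfl, leave_snd T.next (T.hole _, _)]
  have hweight : (C.glue T).weight (C.positionEquiv T (.inl a)).1 = C.weight a.1 :=
    C.glue_weight_outer T a.1
  rw [Diagram.rot, Diagram.signedWeight, Diagram.dot, hstep, hweight, Nat.cast_ite]
  rfl

theorem rot_inner (a : T.Position) :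
    (C.glue T).rot (C.positionEquiv T (.inr a)) = T.rot a := by
  have hstep : ((C.glue T).step (C.positionEquiv T (.inr a))).2 =
      (T.lineStep a).elim Prod.snd Prod.snd := by
    rw [← C.semiconj_positionEquiv T, glueMap, Sum.elim_inr]
    cases T.lineStep a
    exacts [rfl, leave_snd C.next (C.hole _, _)]
  have hweight : (C.glue T).weight (C.positionEquiv T (.inr a)).1 = T.weight a.1 :=
    C.glue_weight_inner T a.1
  rw [Diagram.rot, Diagram.signedWeight, Diagram.dot, hstep, hweight, Nat.cast_ite]
  rfl

end Rot

end Tangle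

namespace Tangle

variable {A : Type} {n : ℕ}

/-- How the strands and the boundaries of the 2-cells pass through a tangle: where they leave it
(`none` for a circuit lying inside the tangle), and in particular where the boundary of a 2-cell
entering at a gate leaves. The strands have to leave the tangle at the point where they enter. -/
structure Passage (T : Tangle A n) where
  strandExit : T.Segment → Option (Fin n)
  exit : T.Position → Option (Gate n)
  through : Gate n → Gate n
  isExit_strandExit : IsExit T.strandStep strandExit
  isExit_exit : IsExit T.lineStep exit
  strandExit_hole : ∀ k, strandExit (T.hole k) = some k
  strandExit_ne_none : ∀ p, strandExit p ≠ none
  exit_entry : ∀ e, exit (T.entry e) = some (through e)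

/-- The return map to the outside of the dynamics along the boundaries of the 2-cells. -/
abbrev returnMap (C : Tangle A n) (through : Gate n → Gate n) :
    C.Position → C.Position := closeMap C.lineStep C.entry through

namespace Passage

section Gluing

variable {T : Tangle A n} (P : Passage T)

theorem isFirstReturn_next (C : Tangle A n) :
    IsFirstReturn (C.glue T).next C.next (C.outer T)
      (IsExit.outside (C.segmentEquiv T) C.hole P.strandExit) := by
  have hclose : closeMap C.strandStep C.hole id = C.next := by
    funext p
    rw [closeMap, strandStep]
    cases hp : splitHole (C.next p)
    exacts [(splitHole_eq_inl hp).symm, (splitHole_eq_inr hp).symm]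
  rw [← hclose]
  exact P.isExit_strandExit.isFirstReturn (C.semiconj_segmentEquiv T) P.strandExit_hole

include P in
theorem subsingleton_orbits_next_iff (C : Tangle A n) :
    Subsingleton (Orbits (C.glue T).next) ↔ Subsingleton (Orbits C.next) := by
  have hexit (p) : IsExit.outside (C.segmentEquiv T) C.hole P.strandExit p ≠ none := fun hp => by
    obtain ⟨q, hq, -⟩ := IsExit.outside_eq_none_iff.1 hp
    exact P.strandExit_ne_none q hq
  have h := P.isFirstReturn_next C
  exact (Equiv.ofBijective h.extend
    ⟨h.extend_injective, h.extend_surjective hexit⟩).symm.subsingleton_congr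

theorem isFirstReturn_step (C : Tangle A n) :
    IsFirstReturn (C.glue T).step (C.returnMap P.through) (fun a => C.positionEquiv T (.inl a))
      (IsExit.outside (C.positionEquiv T) C.entry P.exit) :=
  P.isExit_exit.isFirstReturn (C.semiconj_positionEquiv T) P.exit_entry

end Gluing

section Rotation

variable {T : Tangle ℤ n} (P : Passage T) [Fintype T.Position] (C : Tangle ℤ n)

/-- Twice the rotation number in the tangle of the boundaries of 2-cells leaving it at a gate, or of
those staying inside. -/
def exitRot (e : Option (Gate n)) : ℤ := ∑ a with P.exit a = e, T.rot a

open Classical in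
/-- Twice the rotation number between two successive positions outside the tangle. -/
noncomputable def returnRot (b : C.Position) : ℤ :=
  C.rot b + ∑ e with C.entry e = b, P.exitRot (some e)

open Classical in
theorem returnRot_eq_sum (b : C.Position) :
    P.returnRot C b =
      ∑ a with IsExit.outside (C.positionEquiv T) C.entry P.exit a = some b, (C.glue T).rot a := by
  let _ := Fintype.ofFinite C.Position
  have sum_entry : ∑ e with C.entry e = b, P.exitRot (some e) =
      ∑ a with (P.exit a).map C.entry = some b, T.rot a := by
    unfold exitRot
    rw [Finset.sum_sigma']
    refine Finset.sum_bij (fun x _ => x.2) ?_ ?_ ?_ fun _ _ => rfl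
    · rintro ⟨e, a⟩ h
      simp only [Finset.mem_sigma, Finset.mem_filter_univ] at h ⊢
      rw [h.2, Option.map_some, h.1]
    · rintro ⟨e, a⟩ h ⟨e', a'⟩ h' rfl
      simp only [Finset.mem_sigma, Finset.mem_filter_univ] at h h'
      rw [Option.some.inj (h.2.symm.trans h'.2)]
    · intro a ha
      rw [Finset.mem_filter_univ] at ha
      obtain ⟨e, he, heb⟩ := Option.map_eq_some_iff.1 ha
      exact ⟨⟨e, a⟩, by simp [he, heb], rfl⟩
  rw [returnRot, sum_entry, Finset.sum_filter, Finset.sum_filter,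
    ← (C.positionEquiv T).sum_comp, Fintype.sum_sum_type]
  simp only [IsExit.outside_inl, IsExit.outside_inr, rot_outer, rot_inner, Option.some_inj,
    Finset.sum_ite_eq', Finset.mem_univ, if_true]

theorem orbitSum_extend [Fintype C.Position]
    (q : Orbits (C.returnMap P.through)) :
    orbitSum (C.glue T).step (C.glue T).rot ((P.isFirstReturn_step C).extend q) =
      orbitSum (C.returnMap P.through) (P.returnRot C) q := by
  classical
  exact (P.isFirstReturn_step C).orbitSum_extend
    (fun b => (P.returnRot_eq_sum C b).trans (by congr!)) q

end Rotation

/-- The adjacencies along the segments of a tangle, for the sides of the 2-cells passing through it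
(named after the gate at which they leave it) or lying inside it (`none`). -/
def SideAdj {T : Tangle A n} (P : Passage T) (x y : Option (Gate n) × Diagram.Side) : Prop :=
  ∃ p, ∃ e ∈ Diagram.rim, (P.exit (p, e.1.1), e.1.2) = x ∧ (P.exit (p, e.2.1), e.2.2) = y

/-- The components of the part of the boundary surface seen by a tangle. -/
abbrev SideComponent {T : Tangle A n} (P : Passage T) : Type := Quot P.SideAdj

/-- The tangle `T'` can be put in place of `T` without destroying framedness: the circuits pass
through both in the same way and with the same rotation numbers, sides which are adjacent in `T` are
connected in `T'`, and there is at most one circuit inside `T'`, the one through `b₀`, which has to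
be accounted for by an additional crossing, to have rotation number `-1`, and to be connected to
the circuits passing through `T'`. -/
structure Preserves {T T' : Tangle ℤ n} [Fintype T.Position] [Fintype T'.Position] (P : Passage T)
    (P' : Passage T') (b₀ : T'.Position) : Prop where
  through_eq : P'.through = P.through
  exitRot_eq : ∀ e, P'.exitRot (some e) = P.exitRot (some e)
  exit_ne_none : ∀ a, P.exit a ≠ none
  closed : ∀ b, P'.exit b = none →
    P'.exit b₀ = none ∧ ∃ m, (closeMap T'.lineStep T'.entry id)^[m] b₀ = b
  exitRot_none : P'.exit b₀ = none → P'.exitRot none = -2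
  card_eq : Nat.card T'.X = Nat.card T.X + if P'.exit b₀ = none then 1 else 0
  sides : ∀ p, ∀ e ∈ Diagram.rim, (Quot.mk _ (P.exit (p, e.1.1), e.1.2) : P'.SideComponent) =
    Quot.mk _ (P.exit (p, e.2.1), e.2.2)
  sides_none : P'.exit b₀ = none → ∀ σ, ∃ e τ,
    (Quot.mk _ (none, σ) : P'.SideComponent) = Quot.mk _ (some e, τ)

end Passage

section Components

variable {T : Tangle A n} (P : Passage T) (C : Tangle A n)

theorem component_step_outer (c : C.Position) (σ : Diagram.Side) :
    (C.glue T).component (C.positionEquiv T (.inl c)) σ =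
      Sum.elim (fun c' => (C.glue T).component (C.positionEquiv T (.inl c')) σ)
        (fun e => (C.glue T).component (C.positionEquiv T (.inr (T.entry e))) σ)
        (C.lineStep c) := by
  rw [← Diagram.component_step, ← C.semiconj_positionEquiv T, glueMap, Sum.elim_inl]
  cases C.lineStep c <;> rfl

theorem component_eq_of_exit_eq_some {b : T.Position} {e : Gate n} (he : P.exit b = some e)
    (σ : Diagram.Side) : (C.glue T).component (C.positionEquiv T (.inr b)) σ =
      (C.glue T).component (C.positionEquiv T (.inl (C.entry e))) σ := by
  obtain ⟨m, hm⟩ := P.isExit_exit.exists_iterate_eq (C.semiconj_positionEquiv T) he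
  rw [← hm, Diagram.component_iterate]

end Components

namespace Passage.Preserves

variable {T T' : Tangle ℤ n} [Fintype T.Position] [Fintype T'.Position] {P : Passage T}
  {P' : Passage T'} {b₀ : T'.Position} (h : Preserves P P' b₀) (C : Tangle ℤ n)

include h

theorem exists_iterate_eq (a : (C.glue T').Position)
    (ha : IsExit.outside (C.positionEquiv T') C.entry P'.exit a = none) :
    ∃ m, (C.glue T').step^[m] (C.positionEquiv T' (.inr b₀)) = a := by
  obtain ⟨b, hb, rfl⟩ := IsExit.outside_eq_none_iff.1 ha
  obtain ⟨h₀, m, rfl⟩ := h.closed b hb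
  exact ⟨m, (P'.isExit_exit.iterate_of_eq_none (C.semiconj_positionEquiv T') h₀ m).1⟩

theorem outside_ne_none (a : (C.glue T).Position) :
    IsExit.outside (C.positionEquiv T) C.entry P.exit a ≠ none := fun ha => by
  obtain ⟨b, hb, -⟩ := IsExit.outside_eq_none_iff.1 ha
  exact h.exit_ne_none b hb

theorem card_orbits : Nat.card (Orbits (C.glue T').step) =
    Nat.card (Orbits (C.glue T).step) + if P'.exit b₀ = none then 1 else 0 := by
  rw [(P'.isFirstReturn_step C).card_orbits_eq_add_ite (h.exists_iterate_eq C),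
    (P.isFirstReturn_step C).card_orbits (h.outside_ne_none C), h.through_eq]
  simp only [IsExit.outside_inr, Option.map_eq_none_iff]

theorem returnRot_eq : P'.returnRot C = P.returnRot C := by
  funext b
  simp only [returnRot, h.exitRot_eq]

theorem balanced (hf : (C.glue T).Balanced) : (C.glue T').Balanced := by
  classical
  let _ := Fintype.ofFinite C.Position
  refine Quot.ind fun a => ?_
  change orbitSum _ _ (orbit _ a) = -2
  cases ha : IsExit.outside (C.positionEquiv T') C.entry P'.exit a with
  | some b =>
    have hb := (P'.isFirstReturn_step C).orbit_eq ha
    rw [hb, ← (P'.isFirstReturn_step C).extend_orbit, P'.orbitSum_extend, h.returnRot_eq,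
      h.through_eq, ← P.orbitSum_extend]
    exact hf _
  | none =>
    have hexit := h.exists_iterate_eq C
    obtain ⟨h₀, ha₀⟩ := (P'.isFirstReturn_step C).orbit_eq_of_exit_eq_none hexit ha
    rw [ha₀, (P'.isFirstReturn_step C).orbitSum_eq_of_exit_eq_none h₀ hexit, Finset.sum_filter,
      ← (C.positionEquiv T').sum_comp, Fintype.sum_sum_type]
    rw [IsExit.outside_inr, Option.map_eq_none_iff] at h₀
    simpa [IsExit.outside_inl, IsExit.outside_inr, rot_inner, Finset.sum_filter, exitRot]
      using h.exitRot_none h₀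

theorem component_exit (b : T'.Position) (σ : Diagram.Side) :
    (C.glue T').component (C.positionEquiv T' (.inr b)) σ = (C.glue T').component
      (C.positionEquiv T' ((P'.exit b).elim (.inr b₀) fun e => .inl (C.entry e))) σ := by
  cases hb : P'.exit b with
  | some e => exact component_eq_of_exit_eq_some P' C hb σ
  | none =>
    obtain ⟨h₀, m, rfl⟩ := h.closed b hb
    rw [← (P'.isExit_exit.iterate_of_eq_none (C.semiconj_positionEquiv T') h₀ m).1,
      Diagram.component_iterate]
    rfl

/-- The component of the boundary surface containing a component seen by the tangle. -/
def toBoundaryComponent : P'.SideComponent → (C.glue T').BoundaryComponent :=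
  Quot.lift (fun x => (C.glue T').component
    (C.positionEquiv T' (x.1.elim (.inr b₀) fun e => .inl (C.entry e))) x.2) <| by
  rintro x y ⟨p, e, he, rfl, rfl⟩
  dsimp only
  rw [← h.component_exit, ← h.component_exit]
  exact (C.glue T').component_eq_of_mem_rim (C.inner T' p) he

/-- The component of the boundary surface after the replacement which corresponds to a side of a
2-cell before it. -/
def sideComponent (x : C.Position ⊕ T.Position) (σ : Diagram.Side) :
    (C.glue T').BoundaryComponent :=
  x.elim (fun c => (C.glue T').component (C.positionEquiv T' (.inl c)) σ)
    (fun b => h.toBoundaryComponent C (Quot.mk _ (P.exit b, σ)))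

theorem sideComponent_glueMap (x : C.Position ⊕ T.Position) (σ : Diagram.Side) :
    h.sideComponent C (glueMap C.lineStep C.entry T.lineStep T.entry x) σ =
      h.sideComponent C x σ := by
  rcases x with c | b
  · rw [sideComponent, sideComponent, glueMap, Sum.elim_inl, Sum.elim_inl, component_step_outer]
    cases C.lineStep c with
    | inl c' => rfl
    | inr e =>
      rw [Sum.elim_inr, Sum.elim_inr, Sum.elim_inr, h.component_exit, P.exit_entry, P'.exit_entry,
        h.through_eq]
      rfl
  · have hb := P.isExit_exit.apply b
    rw [sideComponent, sideComponent, glueMap, Sum.elim_inr, Sum.elim_inr, hb]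
    cases T.lineStep b <;> rfl

theorem sideComponent_eq_of_mem_rim (p : Port (C.glue T).X (C.glue T).M)
    {e : (Line × Diagram.Side) × (Line × Diagram.Side)} (he : e ∈ Diagram.rim) :
    h.sideComponent C ((C.positionEquiv T).symm (p, e.1.1)) e.1.2 =
      h.sideComponent C ((C.positionEquiv T).symm (p, e.2.1)) e.2.2 := by
  obtain ⟨c | b, rfl⟩ := (C.segmentEquiv T).surjective p
  · have hsymm (j : Line) : (C.positionEquiv T).symm (C.outer T c, j) = .inl (c, j) :=
      (Equiv.symm_apply_eq _).2 rfl
    rw [hsymm, hsymm]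
    exact (C.glue T').component_eq_of_mem_rim (C.outer T' c) he
  · have hsymm (j : Line) : (C.positionEquiv T).symm (C.inner T b, j) = .inr (b, j) :=
      (Equiv.symm_apply_eq _).2 rfl
    rw [hsymm, hsymm]
    exact congrArg (h.toBoundaryComponent C) (h.sides b e he)

theorem exists_sideComponent_eq (x : (C.glue T').Position) (σ : Diagram.Side) :
    ∃ y τ, h.sideComponent C y τ = (C.glue T').component x σ := by
  obtain ⟨c | b, rfl⟩ := (C.positionEquiv T').surjective x
  · exact ⟨.inl c, σ, rfl⟩
  · rw [h.component_exit]
    cases hb : P'.exit b with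
    | some e => exact ⟨.inl (C.entry e), σ, rfl⟩
    | none =>
      obtain ⟨e, τ, he⟩ := h.sides_none (h.closed b hb).1 σ
      exact ⟨.inl (C.entry e), τ, (congrArg (h.toBoundaryComponent C) he).symm⟩

theorem subsingleton_boundaryComponent (_ : Subsingleton (C.glue T).BoundaryComponent) :
    Subsingleton (C.glue T').BoundaryComponent := by
  refine Function.Surjective.subsingleton (f := Diagram.BoundaryComponent.lift
    (fun a => h.sideComponent C ((C.positionEquiv T).symm a)) (fun a σ => ?_)
    fun p e => h.sideComponent_eq_of_mem_rim C p) ?_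
  · obtain ⟨x, rfl⟩ := (C.positionEquiv T).surjective a
    rw [← C.semiconj_positionEquiv T, Equiv.symm_apply_apply, Equiv.symm_apply_apply,
      h.sideComponent_glueMap]
  · rintro ⟨x, σ⟩
    obtain ⟨y, τ, hy⟩ := h.exists_sideComponent_eq C x σ
    refine ⟨(C.glue T).component (C.positionEquiv T y) τ, ?_⟩
    exact (congrArg (h.sideComponent C · τ) ((C.positionEquiv T).symm_apply_apply y)).trans hy

theorem isFramed_glue (hf : (C.glue T).IsFramed) : (C.glue T').IsFramed := by
  rw [Diagram.isFramed_iff] at hf ⊢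
  obtain ⟨hsurface, hcard, hcurve, hbalanced⟩ := hf
  refine ⟨h.subsingleton_boundaryComponent C hsurface, ?_,
    (P'.subsingleton_orbits_next_iff C).2 ((P.subsingleton_orbits_next_iff C).1 hcurve),
    h.balanced C hbalanced⟩
  have card_glue (S : Tangle ℤ n) : Nat.card (C.glue S).X = Nat.card C.X + Nat.card S.X :=
    Nat.card_sum
  rw [h.card_orbits, hcard, card_glue, card_glue, h.card_eq, ← add_assoc, add_right_comm]

end Passage.Preserves
end Tangle

/-! ### MP moves and H-moves preserve framedness -/

section Classes

variable {α : Type*} [DecidableEq α]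

/-- Adds an edge to a graph given by its connected components. -/
def insertEdge (classes : List (List α)) (x : α × α) : List (List α) :=
  (x.1 :: x.2 :: (classes.filter fun c => x.1 ∈ c ∨ x.2 ∈ c).flatten) ::
    classes.filter fun c => ¬ (x.1 ∈ c ∨ x.2 ∈ c)

/-- The connected components of a graph given by its edges. -/
def edgeClasses (edges : List (α × α)) : List (List α) := edges.foldl insertEdge []

theorem exists_eq_of_mem_insertEdge {β : Type*} {f : α → β} {classes : List (List α)} {x : α × α}
    (hx : f x.1 = f x.2) (h : ∀ c ∈ classes, ∃ q, ∀ y ∈ c, f y = q) :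
    ∀ c ∈ insertEdge classes x, ∃ q, ∀ y ∈ c, f y = q := by
  simp only [insertEdge, List.mem_cons, List.mem_filter, decide_eq_true_eq]
  rintro _ (rfl | ⟨hc, -⟩)
  · refine ⟨f x.1, fun y hy => ?_⟩
    simp only [List.mem_cons, List.mem_flatten, List.mem_filter, decide_eq_true_eq] at hy
    obtain rfl | rfl | ⟨c, ⟨hc, hxc⟩, hy⟩ := hy
    · rfl
    · exact hx.symm
    · obtain ⟨q, hq⟩ := h c hc
      obtain hxc | hxc := hxc
      exacts [(hq y hy).trans (hq _ hxc).symm, (hq y hy).trans ((hq _ hxc).symm.trans hx.symm)]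
  · exact h _ hc

theorem eq_of_mem_edgeClasses {β : Type*} {f : α → β} {edges : List (α × α)}
    (h : ∀ x ∈ edges, f x.1 = f x.2) {c : List α} (hc : c ∈ edgeClasses edges) {y z : α}
    (hy : y ∈ c) (hz : z ∈ c) : f y = f z := by
  have exists_eq (classes : List (List α)) (hclasses : ∀ c ∈ classes, ∃ q, ∀ y ∈ c, f y = q) :
      ∀ c ∈ edges.foldl insertEdge classes, ∃ q, ∀ y ∈ c, f y = q := by
    clear hc
    induction edges generalizing classes with
    | nil => exact hclasses
    | cons x edges ih =>
      simp only [List.forall_mem_cons] at h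
      exact ih h.2 (insertEdge classes x) (exists_eq_of_mem_insertEdge h.1 hclasses)
  obtain ⟨q, hq⟩ := exists_eq [] (by simp) c hc
  exact (hq y hy).trans (hq z hz).symm

end Classes

instance : Fintype Strand := ⟨{.upper, .lower}, by rintro (_ | _) <;> simp⟩

instance : DecidableEq Diagram.Side := fun
  | .top, .top => isTrue rfl
  | .bottom, .bottom => isTrue rfl
  | .top, .bottom => isFalse nofun
  | .bottom, .top => isFalse nofun

namespace Tangle

section OfWords

variable {n c : ℕ} (sign : Fin c → Sign) (word : Fin n → List (Fin c × Strand))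
  (wt : Fin n → List ℤ)

instance : Fintype (ofWords sign word wt).X := inferInstanceAs (Fintype (Fin c))
instance : DecidableEq (ofWords sign word wt).X := inferInstanceAs (DecidableEq (Fin c))
instance : Fintype (ofWords sign word wt).M := inferInstanceAs (Fintype Empty)
instance : DecidableEq (ofWords sign word wt).M := inferInstanceAs (DecidableEq Empty)

/-- The segments of a local picture given by words, in a list. -/
def ofWordsSegments : List (ofWords sign word wt).Segment :=
  (List.finRange c).flatMap (fun x => [.inl (x, .upper), .inl (x, .lower)]) ++
    (List.finRange n).map fun k => .inr (.inr k)

end OfWords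

namespace Passage

variable {A : Type} {n : ℕ} {T : Tangle A n}

/-- All strands and all boundaries of 2-cells entering a tangle leave it within `N` steps, the
strands at the point where they enter, and boundaries of 2-cells which do not leave within `N` steps
never leave. -/
def IsComputedWithin (T : Tangle A n) (N : ℕ) : Prop :=
  (∀ p, exitWithin T.strandStep (N + 1) p = exitWithin T.strandStep N p) ∧
    (∀ a, exitWithin T.lineStep (N + 1) a = exitWithin T.lineStep N a) ∧
    (∀ k, exitWithin T.strandStep N (T.hole k) = some k) ∧
    (∀ p, exitWithin T.strandStep N p ≠ none) ∧ ∀ e, exitWithin T.lineStep N (T.entry e) ≠ none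

/-- The way in which strands and boundaries of 2-cells pass through a tangle, computed. -/
def ofIsComputedWithin {N : ℕ} (h : IsComputedWithin T N) : Passage T where
  strandExit := exitWithin T.strandStep N
  exit := exitWithin T.lineStep N
  through e := (exitWithin T.lineStep N (T.entry e)).getD e
  isExit_strandExit := isExit_exitWithin h.1
  isExit_exit := isExit_exitWithin h.2.1
  strandExit_hole := h.2.2.1
  strandExit_ne_none := h.2.2.2.1
  exit_entry e := by
    obtain ⟨e', he⟩ := Option.ne_none_iff_exists'.1 (h.2.2.2.2 e)
    rw [he, Option.getD_some]

/-- The adjacencies of sides along the given segments. -/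
def sideEdges (P : Passage T) (segments : List T.Segment) :
    List ((Option (Gate n) × Diagram.Side) × (Option (Gate n) × Diagram.Side)) :=
  segments.flatMap fun p =>
    Diagram.rim.map fun e => ((P.exit (p, e.1.1), e.1.2), (P.exit (p, e.2.1), e.2.2))

/-- Two sides are connected by adjacencies along the given segments. -/
abbrev Linked (P : Passage T) (segments : List T.Segment)
    (x y : Option (Gate n) × Diagram.Side) : Prop :=
  ∃ c ∈ edgeClasses (P.sideEdges segments), x ∈ c ∧ y ∈ c

theorem Linked.mk_eq_mk {P : Passage T} {segments : List T.Segment}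
    {x y : Option (Gate n) × Diagram.Side} (h : P.Linked segments x y) :
    (Quot.mk _ x : P.SideComponent) = Quot.mk _ y := by
  obtain ⟨c, hc, hx, hy⟩ := h
  refine eq_of_mem_edgeClasses (fun z hz => ?_) hc hx hy
  obtain ⟨p, -, hp⟩ := List.mem_flatMap.1 hz
  obtain ⟨e, he, rfl⟩ := List.mem_map.1 hp
  exact Quot.sound ⟨p, e, he, rfl, rfl⟩

end Passage

end Tangle

namespace MPType

/-- The local picture before an MP move. -/
abbrev left (t : MPType) : Tangle ℤ 3 := .ofWords t.data.leftSign t.data.leftWord fun _ => []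

/-- The local picture after an MP move. -/
abbrev right (t : MPType) : Tangle ℤ 3 :=
  .ofWords t.data.rightSign t.data.rightWord t.data.rightWeight

/-- The way in which strands and boundaries of 2-cells pass through the picture before an MP
move. -/
def leftPassage (t : MPType) : Tangle.Passage t.left :=
  .ofIsComputedWithin (N := 8) (by
    unfold Tangle.Passage.IsComputedWithin; cases t <;> decide +kernel)

/-- The way in which strands and boundaries of 2-cells pass through the picture after an MP
move. -/
def rightPassage (t : MPType) : Tangle.Passage t.right :=
  .ofIsComputedWithin (N := 8) (by
    unfold Tangle.Passage.IsComputedWithin; cases t <;> decide +kernel)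

theorem exists_inner_circuit (t : MPType) : ∃ b₀, t.rightPassage.exit b₀ = none ∧
    ∀ b, t.rightPassage.exit b = none →
      ∃ m : Fin 3, (closeMap t.right.lineStep t.right.entry id)^[m] b₀ = b := by
  cases t <;> decide +kernel

theorem linked_of_mem_rim (t : MPType) : ∀ p, ∀ e ∈ Diagram.rim,
    t.rightPassage.Linked (Tangle.ofWordsSegments _ _ _)
      (t.leftPassage.exit (p, e.1.1), e.1.2) (t.leftPassage.exit (p, e.2.1), e.2.2) := by
  cases t <;> decide +kernel

theorem exists_linked_none (t : MPType) (σ : Diagram.Side) :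
    ∃ e : Tangle.Gate 3, ∃ τ ∈ [Diagram.Side.top, .bottom],
      t.rightPassage.Linked (Tangle.ofWordsSegments _ _ _) (none, σ) (some e, τ) := by
  cases t <;> cases σ <;> decide +kernel

theorem exists_preserves (t : MPType) : ∃ b₀, t.leftPassage.Preserves t.rightPassage b₀ := by
  have through_eq : t.rightPassage.through = t.leftPassage.through := by
    cases t <;> decide +kernel
  have exitRot_eq (e) : t.rightPassage.exitRot (some e) = t.leftPassage.exitRot (some e) := by
    revert e
    cases t <;> decide +kernel
  have exitRot_none : t.rightPassage.exitRot none = -2 := by cases t <;> decide +kernel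
  have exit_ne_none (a) : t.leftPassage.exit a ≠ none := by
    revert a
    cases t <;> decide +kernel
  obtain ⟨b₀, h₀, hcircuit⟩ := t.exists_inner_circuit
  refine ⟨b₀, through_eq, exitRot_eq, exit_ne_none, fun b hb => ?_, fun _ => exitRot_none, ?_,
    fun p e he => (t.linked_of_mem_rim p e he).mk_eq_mk, fun _ σ => ?_⟩
  · obtain ⟨m, hm⟩ := hcircuit b hb
    exact ⟨h₀, m, hm⟩
  · rw [if_pos h₀]
    exact (Nat.card_fin 3).trans (congrArg Nat.succ (Nat.card_fin 2).symm)
  · obtain ⟨e, τ, -, he⟩ := t.exists_linked_none σ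
    exact ⟨e, τ, he.mk_eq_mk⟩

theorem isFramed_glue (t : MPType) (C : Tangle ℤ 3) (hf : (C.glue t.left).IsFramed) :
    (C.glue t.right).IsFramed :=
  have ⟨_, h⟩ := t.exists_preserves
  h.isFramed_glue C hf

end MPType

open Strand in
/-- The local picture with a single crossing, on each of whose strands the segments carry the
weights `w`. -/
abbrev hPicture (ε : Sign) (w : List ℤ) : Tangle ℤ 2 :=
  .ofWords (n := 2) (c := 1) (fun _ => ε) ![[(0, upper)], [(0, lower)]] fun _ => w

/-- The way in which strands and boundaries of 2-cells pass through a crossing. -/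
def hPassage (ε : Sign) (w : List ℤ) : Tangle.Passage (hPicture ε w) :=
  have h : Tangle.Passage.IsComputedWithin (hPicture ε []) 8 := by
    unfold Tangle.Passage.IsComputedWithin
    cases ε <;> decide +kernel
  .ofIsComputedWithin h

theorem hPassage_preserves (ε : Sign) : (hPassage ε []).Preserves (hPassage ε [1, -1])
    ((hPicture ε [1, -1]).entry 0) := by
  have exit_ne_none (a) : (hPassage ε [1, -1]).exit a ≠ none := by
    revert a
    cases ε <;> decide +kernel
  have linked : ∀ p, ∀ e ∈ Diagram.rim,
      (hPassage ε [1, -1]).Linked (Tangle.ofWordsSegments _ _ _)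
        ((hPassage ε []).exit (p, e.1.1), e.1.2) ((hPassage ε []).exit (p, e.2.1), e.2.2) := by
    cases ε <;> decide +kernel
  refine ⟨?_, ?_, ?_, fun b hb => (exit_ne_none b hb).elim, fun h₀ => (exit_ne_none _ h₀).elim, ?_,
    fun p e he => (linked p e he).mk_eq_mk, fun h₀ => (exit_ne_none _ h₀).elim⟩
  · cases ε <;> decide +kernel
  · cases ε <;> decide +kernel
  · cases ε <;> decide +kernel
  · rw [if_neg (exit_ne_none _)]
    rfl

theorem hPicture_isFramed_glue (ε : Sign) (C : Tangle ℤ 2)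
    (hf : (C.glue (hPicture ε [])).IsFramed) : (C.glue (hPicture ε [1, -1])).IsFramed :=
  (hPassage_preserves ε).isFramed_glue C hf

/-! ### Gauss codes -/

section SumKeep

variable (α : Type) {β : Type} (b : β) (γ : Type)

/-- The elements of a sum other than a given element of the middle summand. -/
def sumKeep : α ⊕ {b' // b' ≠ b} ⊕ γ → α ⊕ β ⊕ γ := Sum.map id (Sum.map Subtype.val id)

theorem sumKeep_injective : Function.Injective (sumKeep α b γ) :=
  Function.injective_id.sumMap (Subtype.val_injective.sumMap Function.injective_id)

theorem sumKeep_ne (p : α ⊕ {b' // b' ≠ b} ⊕ γ) : sumKeep α b γ p ≠ .inr (.inl b) := by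
  rcases p with _ | ⟨b', hb'⟩ | _
  · exact Sum.inl_ne_inr
  · exact fun h => hb' (Sum.inl_injective (Sum.inr_injective h))
  · exact fun h => Sum.inr_ne_inl (Sum.inr_injective h)

theorem exists_sumKeep_eq {q : α ⊕ β ⊕ γ} (hq : q ≠ .inr (.inl b)) :
    ∃ p, sumKeep α b γ p = q := by
  rcases q with a | b' | c
  · exact ⟨.inl a, rfl⟩
  · exact ⟨.inr (.inl ⟨b', fun h => hq (h ▸ rfl)⟩), rfl⟩
  · exact ⟨.inr (.inr c), rfl⟩

/-- A sum is obtained by adding a given element of the middle summand to the other elements. -/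
noncomputable def sumRestoreEquiv : Option (α ⊕ {b' // b' ≠ b} ⊕ γ) ≃ α ⊕ β ⊕ γ :=
  .ofBijective (fun o => o.elim (.inr (.inl b)) (sumKeep α b γ)) <| by
    refine ⟨?_, fun q => ?_⟩
    · rintro (_ | p) (_ | q) h
      · rfl
      · exact absurd h.symm (sumKeep_ne α b γ q)
      · exact absurd h (sumKeep_ne α b γ p)
      · exact congrArg some (sumKeep_injective α b γ h)
    · by_cases hq : q = .inr (.inl b)
      · exact ⟨none, hq.symm⟩
      · obtain ⟨p, rfl⟩ := exists_sumKeep_eq α b γ hq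
        exact ⟨some p, rfl⟩

end SumKeep

namespace Tangle

variable {n : ℕ}

section Congruence

variable {T T' : Tangle ℤ n}

theorem glue_iso (C : Tangle ℤ n) (f : T.X ≃ T'.X) (g : T.M ≃ T'.M)
    (hsign : ∀ x, T'.sign (f x) = T.sign x)
    (hnext : ∀ p, T'.next (Sum.map (Prod.map f id) (Sum.map g id) p) =
      Sum.map (Prod.map f id) (Sum.map g id) (T.next p))
    (hweight : ∀ p, T'.weight (Sum.map (Prod.map f id) (Sum.map g id) p) = T.weight p) :
    Diagram.Iso (C.glue T) (C.glue T') := by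
  set φ : T.Segment → T'.Segment := Sum.map (Prod.map f id) (Sum.map g id)
  let F : (C.glue T).X ≃ (C.glue T').X := (Equiv.refl _).sumCongr f
  let G : (C.glue T).M ≃ (C.glue T').M := (Equiv.refl _).sumCongr (g.sumCongr (Equiv.refl _))
  let Φ : Port (C.glue T).X (C.glue T).M → Port (C.glue T').X (C.glue T').M :=
    Sum.map (Prod.map F id) G
  have map_outer (p : C.Segment) : Φ (C.outer T p) = C.outer T' p := by
    rcases p with _ | _ | _ <;> rfl
  have map_inner (p : T.Segment) : Φ (C.inner T p) = C.inner T' (φ p) := by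
    rcases p with _ | _ | _ <;> rfl
  have strandStep_map (p : T.Segment) :
      T'.strandStep (φ p) = (T.strandStep p).map φ id := by
    rw [strandStep, hnext, strandStep]
    rcases T.next p with _ | _ | _ <;> rfl
  refine ⟨F, G, ?_, fun p => ?_, fun p => ?_⟩
  · rintro (x | x)
    exacts [rfl, hsign x]
  · change (C.glue T').next (Φ p) = Φ ((C.glue T).next p)
    obtain ⟨p | p, rfl⟩ := (C.segmentEquiv T).surjective p
    · rw [map_outer, glue_next_outer, glue_next_outer]
      rcases C.strandStep p with q | k
      exacts [(map_outer q).symm, (map_inner (T.hole k)).symm]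
    · rw [map_inner, glue_next_inner, glue_next_inner, strandStep_map]
      rcases T.strandStep p with q | k
      exacts [(map_inner q).symm, (map_outer (C.hole k)).symm]
  · obtain ⟨p | p, rfl⟩ := (C.segmentEquiv T).surjective p
    · rcases p with _ | _ | _ <;> rfl
    · refine .trans ?_ ((hweight p).trans ?_) <;> rcases p with _ | _ | _ <;> rfl

end Congruence

section RemoveMark

variable (T : Tangle ℤ n) (m₀ : T.M)

/-- The segment starting at a marked point. -/
abbrev mark (m : T.M) : T.Segment := .inr (.inl m)

/-- The segments of a tangle are the one starting at `m₀` and the others. -/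
noncomputable abbrev keepEquiv : Option (Port T.X ({m // m ≠ m₀} ⊕ Fin n)) ≃ T.Segment :=
  sumRestoreEquiv _ m₀ _

/-- The segments of a tangle other than the one starting at the marked point `m₀`. -/
abbrev keep : Port T.X ({m // m ≠ m₀} ⊕ Fin n) → T.Segment := sumKeep _ m₀ _

open Classical in
/-- The tangle obtained by joining the two segments which meet at the marked point `m₀`. -/
@[reducible]
noncomputable def removeMark : Tangle ℤ n where
  X := T.X
  M := {m // m ≠ m₀}
  finX := T.finX
  finM := inferInstance
  sign := T.sign
  next := Equiv.removeNone ((T.keepEquiv m₀).trans (T.next.trans (T.keepEquiv m₀).symm))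
  weight p := T.weight (T.keep m₀ p) +
    if T.next (T.keep m₀ p) = T.mark m₀ then T.weight (T.mark m₀) else 0

variable {T m₀}

theorem keep_removeMark_next {p : (T.removeMark m₀).Segment}
    (hp : T.next (T.keep m₀ p) ≠ T.mark m₀) :
    T.keep m₀ ((T.removeMark m₀).next p) = T.next (T.keep m₀ p) := by
  obtain ⟨q, hq⟩ := exists_sumKeep_eq _ m₀ _ hp
  have hsome : ((T.keepEquiv m₀).trans (T.next.trans (T.keepEquiv m₀).symm)) (some p) = some q := by
    rw [Equiv.trans_apply, Equiv.trans_apply, Equiv.symm_apply_eq]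
    exact hq.symm
  exact (congrArg _ (Option.some_injective _
    ((Equiv.removeNone_some _ ⟨q, hsome⟩).trans hsome))).trans hq

theorem keep_removeMark_next_of_eq {p : (T.removeMark m₀).Segment}
    (hp : T.next (T.keep m₀ p) = T.mark m₀) :
    T.keep m₀ ((T.removeMark m₀).next p) = T.next (T.mark m₀) := by
  have hnone : ((T.keepEquiv m₀).trans (T.next.trans (T.keepEquiv m₀).symm)) (some p) = none := by
    rw [Equiv.trans_apply, Equiv.trans_apply, Equiv.symm_apply_eq]
    exact hp
  exact (Equiv.eq_symm_apply (T.keepEquiv m₀)).1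
    ((Equiv.removeNone_none ((T.keepEquiv m₀).trans (T.next.trans (T.keepEquiv m₀).symm)) hnone :))

theorem removeMark_weight {p : (T.removeMark m₀).Segment}
    (hp : T.next (T.keep m₀ p) ≠ T.mark m₀) :
    (T.removeMark m₀).weight p = T.weight (T.keep m₀ p) :=
  (congrArg (T.weight (T.keep m₀ p) + ·) (if_neg hp)).trans (add_zero _)

theorem removeMark_weight_of_eq {p : (T.removeMark m₀).Segment}
    (hp : T.next (T.keep m₀ p) = T.mark m₀) :
    (T.removeMark m₀).weight p = T.weight (T.keep m₀ p) + T.weight (T.mark m₀) :=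
  congrArg (T.weight (T.keep m₀ p) + ·) (if_pos hp)

theorem exists_next_keep_eq_mark (hm₀ : T.next (T.mark m₀) ≠ T.mark m₀) :
    ∃ e, T.next (T.keep m₀ e) = T.mark m₀ ∧
      ∀ p, p ≠ e → T.next (T.keep m₀ p) ≠ T.mark m₀ := by
  obtain ⟨e, he⟩ := exists_sumKeep_eq _ m₀ _ (q := T.next.symm (T.mark m₀))
    fun h => hm₀ ((Equiv.symm_apply_eq _).1 h).symm
  rw [Equiv.eq_symm_apply] at he
  exact ⟨e, he, fun p hp h => hp (sumKeep_injective _ m₀ _ (T.next.injective (h.trans he.symm)))⟩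

theorem subdivides_removeMark (hm₀ : T.next (T.mark m₀) ≠ T.mark m₀) (C : Tangle ℤ n) :
    Diagram.Subdivides (C.glue (T.removeMark m₀)) (C.glue T) := by
  classical
  obtain ⟨e, he, next_keep_ne⟩ := exists_next_keep_eq_mark hm₀
  refine ⟨Equiv.refl _, sumRestoreEquiv _ m₀ _, C.inner (T.removeMark m₀) e, ?_⟩
  intro ι μ
  have map_outer (p : C.Segment) : ι (C.outer _ p) = C.outer T p := by
    rcases p with _ | _ | _ <;> rfl
  have map_inner (p) : ι (C.inner _ p) = C.inner T (T.keep m₀ p) := by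
    rcases p with _ | _ | _ <;> rfl
  have map_elim (p) : ι (Sum.elim (C.inner _) (fun k => C.outer _ (C.hole k)) (splitHole p)) =
      Sum.elim (C.inner T) (fun k => C.outer T (C.hole k)) (splitHole (T.keep m₀ p)) := by
    rcases p with _ | _ | _ <;> rfl
  refine ⟨fun _ => rfl, ?_, ?_, fun p hp => ?_, ?_, fun p hp => ?_⟩
  · rw [map_inner, glue_next_inner, strandStep, he]
    rfl
  · rw [glue_next_inner, strandStep, map_elim, keep_removeMark_next_of_eq he]
    exact C.glue_next_inner T (T.mark m₀)
  · obtain ⟨p | p, rfl⟩ := (C.segmentEquiv (T.removeMark m₀)).surjective p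
    · rw [map_outer, glue_next_outer, glue_next_outer]
      rcases C.strandStep p with q | k
      exacts [(map_outer q).symm, (map_inner ((T.removeMark m₀).hole k)).symm]
    · rw [map_inner, glue_next_inner, glue_next_inner, strandStep, strandStep, map_elim,
        keep_removeMark_next (next_keep_ne p fun h => hp (congrArg (C.inner _) h))]
  · rw [map_inner, glue_weight_inner, glue_weight_inner, removeMark_weight_of_eq he]
    exact congrArg _ (C.glue_weight_inner T (T.mark m₀))
  · obtain ⟨p | p, rfl⟩ := (C.segmentEquiv (T.removeMark m₀)).surjective p
    · rw [map_outer, glue_weight_outer, glue_weight_outer]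
    · rw [map_inner, glue_weight_inner, glue_weight_inner,
        removeMark_weight (next_keep_ne p fun h => hp (congrArg (C.inner _) h))]

end RemoveMark

end Tangle

namespace Tangle

variable {n : ℕ} {T T' : Tangle ℤ n}

/-- `T.Runs k p w l`: the segment `p` lies on a strand which leaves `T` at the distinguished point
`k`; from `p` on it runs along an edge of weight `w`, and then makes the passages `l`, each of
which is listed with the weight of the edge following it. -/
inductive Runs (T : Tangle ℤ n) (k : Fin n) :
    T.Segment → ℤ → List ((T.X × Strand) × ℤ) → Prop
  | exit {p} : T.next p = T.hole k → T.Runs k p (T.weight p) []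
  | mark {p m w l} : T.next p = T.mark m → T.Runs k (T.mark m) w l → T.Runs k p (T.weight p + w) l
  | cross {p x w l} :
      T.next p = .inl x → T.Runs k (.inl x) w l → T.Runs k p (T.weight p) ((x, w) :: l)

/-- The tangle `T` has Gauss code `c`, if its crossings are labelled by `f`. The label of a crossing
contains its sign, and closed curves without crossings are excluded. -/
structure HasCode (T : Tangle ℤ n) (f : T.X → ℕ × Sign)
    (c : Fin n → ℤ × List (((ℕ × Sign) × Strand) × ℤ)) : Prop where
  injective : Function.Injective f
  sign_eq (x : T.X) : (f x).2 = T.sign x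
  runs (k : Fin n) :
    ∃ l, T.Runs k (T.hole k) (c k).1 l ∧ l.map (Prod.map (Prod.map f id) id) = (c k).2
  exists_mem (x : T.X) (s : Strand) : ∃ k w, ((f x, s), w) ∈ (c k).2
  exists_runs (m : T.M) : ∃ k w l, T.Runs k (T.mark m) w l

section RemoveMark

variable {m₀ : T.M} {k : Fin n}

theorem Runs.next_ne {p w l} (h : T.Runs k p w l) (hp : p = T.mark m₀) :
    T.next p ≠ T.mark m₀ := by
  induction h with
  | exit hnext => simp [hnext]
  | cross hnext => simp [hnext]
  | mark hnext _ ih =>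
    intro hm₀
    exact ih (hnext.symm.trans hm₀) (by rw [← hnext.symm.trans hm₀] at hp; exact hp ▸ hm₀)

/-- The segment `p` is a part of the segment `q` of `T.removeMark m₀`, and the part of `q` before
it has weight `u`. -/
def IsPart (q : (T.removeMark m₀).Segment) (p : T.Segment) (u : ℤ) : Prop :=
  T.keep m₀ q = p ∧ u = 0 ∨
    T.next (T.keep m₀ q) = T.mark m₀ ∧ p = T.mark m₀ ∧ u = T.weight (T.keep m₀ q)

theorem IsPart.next_eq {q r : (T.removeMark m₀).Segment} {p : T.Segment} {u : ℤ} (h : IsPart q p u)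
    (hnext : T.next p = T.keep m₀ r) : (T.removeMark m₀).next q = r := by
  apply sumKeep_injective _ m₀ _
  rcases h with ⟨rfl, -⟩ | ⟨hq, rfl, -⟩
  · exact (keep_removeMark_next (hnext ▸ sumKeep_ne _ m₀ _ r)).trans hnext
  · exact (keep_removeMark_next_of_eq hq).trans hnext

theorem IsPart.weight_eq {q r : (T.removeMark m₀).Segment} {p : T.Segment} {u : ℤ}
    (h : IsPart q p u) (hnext : T.next p = T.keep m₀ r) :
    (T.removeMark m₀).weight q = u + T.weight p := by
  rcases h with ⟨rfl, rfl⟩ | ⟨hq, rfl, rfl⟩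
  · rw [removeMark_weight (hnext ▸ sumKeep_ne _ m₀ _ r), zero_add]
  · exact removeMark_weight_of_eq hq

theorem Runs.removeMark (hm₀ : T.next (T.mark m₀) ≠ T.mark m₀) {p w l} (h : T.Runs k p w l)
    {q : (T.removeMark m₀).Segment} {u : ℤ} (hq : IsPart q p u) :
    (T.removeMark m₀).Runs k q (u + w) l := by
  induction h generalizing q u with
  | exit hnext =>
    rw [← hq.weight_eq (r := .inr (.inr k)) hnext]
    exact .exit (hq.next_eq hnext)
  | @cross p x w l hnext _ ih =>
    rw [← hq.weight_eq (r := .inl x) hnext]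
    have := ih (q := .inl x) (.inl ⟨rfl, rfl⟩)
    rw [zero_add] at this
    exact .cross (hq.next_eq hnext) this
  | @mark p m w l hnext _ ih =>
    by_cases hm : m = m₀
    · subst hm
      rcases hq with ⟨rfl, rfl⟩ | ⟨-, rfl, -⟩
      · rw [zero_add]
        exact ih (.inr ⟨hnext, rfl, rfl⟩)
      · exact absurd hnext hm₀
    · rw [← add_assoc, ← hq.weight_eq (r := .inr (.inl ⟨m, hm⟩)) hnext]
      have := ih (q := .inr (.inl ⟨m, hm⟩)) (.inl ⟨rfl, rfl⟩)
      rw [zero_add] at this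
      exact .mark (hq.next_eq (r := .inr (.inl ⟨m, hm⟩)) hnext) this

theorem Runs.removeMark_keep (hm₀ : T.next (T.mark m₀) ≠ T.mark m₀)
    {q : (T.removeMark m₀).Segment} {w l} (h : T.Runs k (T.keep m₀ q) w l) :
    (T.removeMark m₀).Runs k q w l :=
  zero_add w ▸ h.removeMark hm₀ (.inl ⟨rfl, rfl⟩)

variable {f : T.X → ℕ × Sign} {c : Fin n → ℤ × List (((ℕ × Sign) × Strand) × ℤ)}

theorem HasCode.next_mark_ne (h : T.HasCode f c) (m : T.M) : T.next (T.mark m) ≠ T.mark m :=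
  let ⟨_, _, _, hm⟩ := h.exists_runs m
  hm.next_ne rfl

theorem HasCode.removeMark (h : T.HasCode f c) (m₀ : T.M) : (T.removeMark m₀).HasCode f c where
  injective := h.injective
  sign_eq := h.sign_eq
  runs k :=
    let ⟨l, hl, hlc⟩ := h.runs k
    ⟨l, hl.removeMark_keep (q := .inr (.inr k)) (h.next_mark_ne m₀), hlc⟩
  exists_mem := h.exists_mem
  exists_runs m :=
    let ⟨k, w, l, hl⟩ := h.exists_runs m.1
    ⟨k, w, l, hl.removeMark_keep (q := .inr (.inl m)) (h.next_mark_ne m₀)⟩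

theorem HasCode.exists_isEmpty (h : T.HasCode f c) (C : Tangle ℤ n) :
    ∃ (S : Tangle ℤ n) (f' : S.X → ℕ × Sign), S.HasCode f' c ∧ IsEmpty S.M ∧
      NormalOGraph.mk (C.glue S) = NormalOGraph.mk (C.glue T) := by
  induction hN : Nat.card T.M using Nat.strong_induction_on generalizing T with
  | _ N ih =>
    by_cases hT : IsEmpty T.M
    · exact ⟨T, f, h, hT, rfl⟩
    · obtain ⟨m₀⟩ := not_isEmpty_iff.1 hT
      have hlt : Nat.card (T.removeMark m₀).M < N :=
        hN ▸ Finite.card_subtype_lt (x := m₀) (not_not.2 rfl)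
      obtain ⟨S, f', hS, hempty, hmk⟩ := ih _ hlt (h.removeMark m₀) rfl
      exact ⟨S, f', hS, hempty, hmk.trans
        (Quot.sound (.inr (subdivides_removeMark (h.next_mark_ne m₀) C)))⟩

end RemoveMark

section Unique

variable {k : Fin n} {f : T.X → ℕ × Sign} {f' : T'.X → ℕ × Sign}
  {c : Fin n → ℤ × List (((ℕ × Sign) × Strand) × ℤ)}

theorem Runs.of_nil [IsEmpty T.M] {p w} (h : T.Runs k p w []) :
    T.next p = T.hole k ∧ T.weight p = w := by
  cases h with
  | exit hnext => exact ⟨hnext, rfl⟩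
  | @mark _ m => exact isEmptyElim m

theorem Runs.of_cons [IsEmpty T.M] {p w x v l} (h : T.Runs k p w ((x, v) :: l)) :
    (T.next p = .inl x ∧ T.weight p = w) ∧ T.Runs k (.inl x) v l := by
  cases h with
  | cross hnext hl => exact ⟨⟨hnext, rfl⟩, hl⟩
  | @mark _ m => exact isEmptyElim m

theorem Runs.next_map [IsEmpty T.M] [IsEmpty T'.M] {g : T.X → T'.X} {i : T.M → T'.M}
    {l : List ((T.X × Strand) × ℤ)} {p w} (h : T.Runs k p w l)
    (h' : T'.Runs k (Sum.map (Prod.map g id) (Sum.map i id) p) w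
      (l.map (Prod.map (Prod.map g id) id)))
    {r : T.Segment} (hr : r = p ∨ ∃ x ∈ l, r = .inl x.1) :
    T'.next (Sum.map (Prod.map g id) (Sum.map i id) r) =
        Sum.map (Prod.map g id) (Sum.map i id) (T.next r) ∧
      T'.weight (Sum.map (Prod.map g id) (Sum.map i id) r) = T.weight r := by
  induction l generalizing p w with
  | nil =>
    obtain ⟨hnext, hweight⟩ := h.of_nil
    obtain ⟨hnext', hweight'⟩ := h'.of_nil
    obtain rfl : r = p := by simpa using hr
    exact ⟨by rw [hnext', hnext]; rfl, hweight'.trans hweight.symm⟩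
  | cons x l ih =>
    obtain ⟨⟨hnext, hweight⟩, hl⟩ := h.of_cons
    obtain ⟨⟨hnext', hweight'⟩, hl'⟩ := Runs.of_cons h'
    rcases hr with rfl | ⟨y, hy, rfl⟩
    · exact ⟨by rw [hnext', hnext]; rfl, hweight'.trans hweight.symm⟩
    · refine ih hl hl' ?_
      rcases List.mem_cons.1 hy with rfl | hy
      exacts [.inl rfl, .inr ⟨y, hy, rfl⟩]

theorem HasCode.exists_runs_through [IsEmpty T.M] (h : T.HasCode f c) (r : T.Segment) :
    ∃ k l, T.Runs k (T.hole k) (c k).1 l ∧ l.map (Prod.map (Prod.map f id) id) = (c k).2 ∧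
      (r = T.hole k ∨ ∃ x ∈ l, r = .inl x.1) := by
  rcases r with x | m | k
  · obtain ⟨k, w, hw⟩ := h.exists_mem x.1 x.2
    obtain ⟨l, hl, hlc⟩ := h.runs k
    rw [← hlc, List.mem_map] at hw
    obtain ⟨y, hy, hyx⟩ := hw
    obtain rfl : y.1 = x :=
      (h.injective.prodMap Function.injective_id) (congrArg Prod.fst hyx)
    exact ⟨k, l, hl, hlc, .inr ⟨y, hy, rfl⟩⟩
  · exact isEmptyElim m
  · obtain ⟨l, hl, hlc⟩ := h.runs k
    exact ⟨k, l, hl, hlc, .inl rfl⟩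

theorem HasCode.range_subset (h : T.HasCode f c) (h' : T'.HasCode f' c) :
    Set.range f ⊆ Set.range f' := by
  rintro _ ⟨x, rfl⟩
  obtain ⟨k, w, hw⟩ := h.exists_mem x .upper
  obtain ⟨l, -, hlc⟩ := h'.runs k
  rw [← hlc, List.mem_map] at hw
  obtain ⟨y, -, hyx⟩ := hw
  exact ⟨y.1.1, congrArg (·.1.1) hyx⟩

theorem HasCode.glue_iso [IsEmpty T.M] [IsEmpty T'.M] (h : T.HasCode f c) (h' : T'.HasCode f' c)
    (C : Tangle ℤ n) : Diagram.Iso (C.glue T) (C.glue T') := by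
  let g : T.X ≃ T'.X := (Equiv.ofInjective f h.injective).trans <|
    (Equiv.setCongr ((h.range_subset h').antisymm (h'.range_subset h))).trans
      (Equiv.ofInjective f' h'.injective).symm
  have hg (x : T.X) : f' (g x) = f x :=
    Equiv.apply_ofInjective_symm h'.injective _
  have runs_map {k} {l : List ((T.X × Strand) × ℤ)}
      (hlc : l.map (Prod.map (Prod.map f id) id) = (c k).2) :
      T'.Runs k (T'.hole k) (c k).1 (l.map (Prod.map (Prod.map g id) id)) := by
    obtain ⟨l', hl', hlc'⟩ := h'.runs k
    convert hl'
    refine ((h'.injective.prodMap Function.injective_id).prodMap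
      Function.injective_id).list_map ?_
    rw [hlc', ← hlc, List.map_map]
    exact List.map_congr_left fun y _ => by simp [Prod.map, hg]
  let i : T.M ≃ T'.M := Equiv.equivOfIsEmpty _ _
  have next_map (r : T.Segment) :
      T'.next (Sum.map (Prod.map g id) (Sum.map i id) r) =
          Sum.map (Prod.map g id) (Sum.map i id) (T.next r) ∧
        T'.weight (Sum.map (Prod.map g id) (Sum.map i id) r) = T.weight r := by
    obtain ⟨k, l, hl, hlc, hr⟩ := h.exists_runs_through r
    exact hl.next_map (runs_map hlc) hr
  exact Tangle.glue_iso C g i (fun x => by rw [← h'.sign_eq, hg, h.sign_eq])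
    (fun r => (next_map r).1) fun r => (next_map r).2

theorem HasCode.mk_glue_eq (h : T.HasCode f c) (h' : T'.HasCode f' c) (C : Tangle ℤ n) :
    NormalOGraph.mk (C.glue T) = NormalOGraph.mk (C.glue T') := by
  obtain ⟨S, _, hS, _, hmk⟩ := h.exists_isEmpty C
  obtain ⟨S', _, hS', _, hmk'⟩ := h'.exists_isEmpty C
  exact hmk.symm.trans ((Quot.sound (.inl (hS.glue_iso hS' C))).trans hmk')

end Unique

section Read

variable (T) (N : ℕ)

/-- Follows a strand for at most `N` steps. The result consists of the distinguished point at which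
the strand leaves the tangle and of the data in `Tangle.Runs`. -/
def read : ℕ → T.Segment → Option (Fin n × ℤ × List ((T.X × Strand) × ℤ))
  | 0, _ => none
  | N + 1, p =>
    match T.next p with
    | .inl x => (read N (.inl x)).map fun r => (r.1, T.weight p, (x, r.2.1) :: r.2.2)
    | .inr (.inl m) => (read N (T.mark m)).map fun r => (r.1, T.weight p + r.2.1, r.2.2)
    | .inr (.inr k) => some (k, T.weight p, [])

variable {T N} in
theorem runs_of_read {p k w l} (h : T.read N p = some (k, w, l)) : T.Runs k p w l := by
  induction N generalizing p k w l with
  | zero => simp [read] at h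
  | succ N ih =>
    rcases hnext : T.next p with x | m | k'
    · simp only [read, hnext, Option.map_eq_some_iff] at h
      obtain ⟨⟨k, v, l⟩, hr, h⟩ := h
      cases h
      exact .cross hnext (ih hr)
    · simp only [read, hnext, Option.map_eq_some_iff] at h
      obtain ⟨⟨k, v, l⟩, hr, h⟩ := h
      cases h
      exact .mark hnext (ih hr)
    · simp only [read, hnext, Option.some.injEq] at h
      cases h
      exact .exit hnext

/-- The weights and passages of a strand, as far as they can be read in `N` steps. -/
def strandData (k : Fin n) : ℤ × List ((T.X × Strand) × ℤ) :=
  ((T.read N (T.hole k)).map Prod.snd).getD (0, [])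

/-- The passages of all strands, as far as they can be read in `N` steps. -/
def passages : List (T.X × Strand) :=
  (List.finRange n).flatMap fun k => (T.strandData N k).2.map Prod.fst

variable [DecidableEq T.X] [DecidableEq T'.X]

/-- The label of a crossing is given by the place of its overpass among the passages, and by its
sign. -/
def label (x : T.X) : ℕ × Sign := ((T.passages N).idxOf (x, .upper), T.sign x)

/-- The Gauss code of a tangle, as far as it can be read in `N` steps. -/
def gaussCode (k : Fin n) : ℤ × List (((ℕ × Sign) × Strand) × ℤ) :=
  (T.strandData N k).map id (List.map (Prod.map (Prod.map (T.label N) id) id))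

/-- The whole tangle is read in `N` steps, and its `k`-th strand joins the two sides of the `k`-th
distinguished point. -/
def IsReadWithin : Prop :=
  (∀ k, (T.read N (T.hole k)).map Prod.fst = some k) ∧ (∀ x, x ∈ T.passages N) ∧
    ∀ m, (T.read N (T.mark m)).isSome

omit [DecidableEq T'.X] in
variable {T N} in
theorem IsReadWithin.hasCode (h : T.IsReadWithin N) : T.HasCode (T.label N) (T.gaussCode N) where
  injective x y hxy := congrArg Prod.fst
    ((List.idxOf_inj (h.2.1 (x, .upper))).1 (congrArg Prod.fst hxy))
  sign_eq _ := rfl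
  runs k := by
    obtain ⟨⟨k', w, l⟩, hr, hk : k' = k⟩ := Option.map_eq_some_iff.1 (h.1 k)
    subst hk
    simp only [gaussCode, strandData, hr]
    exact ⟨l, runs_of_read hr, rfl⟩
  exists_mem x s := by
    obtain ⟨k, -, hx⟩ := List.mem_flatMap.1 (h.2.1 (x, s))
    obtain ⟨⟨_, w⟩, hw, rfl⟩ := List.mem_map.1 hx
    exact ⟨k, w, List.mem_map.2 ⟨_, hw, rfl⟩⟩
  exists_runs m := by
    obtain ⟨⟨k, w, l⟩, hr⟩ := Option.isSome_iff_exists.1 (h.2.2 m)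
    exact ⟨k, w, l, runs_of_read hr⟩

variable (T') in
/-- Two tangles have the same Gauss code, which is read in `N` steps. -/
def SameCode : Prop :=
  T.IsReadWithin N ∧ T'.IsReadWithin N ∧ ∀ k, T.gaussCode N k = T'.gaussCode N k

instance [Fintype T.X] [Fintype T.M] : Decidable (T.IsReadWithin N) :=
  inferInstanceAs (Decidable (_ ∧ _ ∧ _))

instance [Fintype T.X] [Fintype T.M] [Fintype T'.X] [Fintype T'.M] :
    Decidable (T.SameCode T' N) :=
  inferInstanceAs (Decidable (_ ∧ _ ∧ _))

variable {T N} in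
theorem SameCode.mk_glue_eq (h : T.SameCode T' N) (C : Tangle ℤ n) :
    NormalOGraph.mk (C.glue T) = NormalOGraph.mk (C.glue T') :=
  h.1.hasCode.mk_glue_eq (funext h.2.2 ▸ h.2.1.hasCode) C

end Read

end Tangle

/-! ### Contexts -/

theorem Diagram.RotationBetween.of_semiconj {D D' : Diagram ℤ} {f : D.Position → D'.Position}
    {a b : D.Position} {p : ℚ} (h : D'.RotationBetween (f a) (f b) p) (hf : Function.Injective f)
    (hstep : Function.Semiconj f D.step D'.step)
    (hweight : ∀ a, D'.signedWeight (f a) = D.signedWeight a) (hdot : ∀ a, D'.dot (f a) = D.dot a) :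
    D.RotationBetween a b p := by
  obtain ⟨n, hn, hne, hp⟩ := h
  simp only [← (hstep.iterate_right _).eq, hweight, hdot] at hn hne hp
  exact ⟨n, hf hn, fun m hm hmb => hne m hm (congrArg f hmb), hp⟩

section Cut

variable {A : Type} {n : ℕ} {N : Type}

/-- The tangle obtained from a diagram by taking some of its marked points as distinguished
points. -/
@[reducible]
def Diagram.cut (D : Diagram A) (e : D.M ≃ N ⊕ Fin n) : Tangle A n where
  X := D.X
  M := N
  finX := D.finX
  finM :=
    have := D.finM
    have := Finite.of_equiv _ e
    Finite.sum_left (Fin n)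
  sign := D.sign
  next := (Equiv.sumCongr (Equiv.refl _) e).permCongr D.next
  weight p := D.weight ((Equiv.sumCongr (Equiv.refl _) e).symm p)

theorem Diagram.cut_next (D : Diagram A) (e : D.M ≃ N ⊕ Fin n) (p : Port D.X D.M) :
    (D.cut e).next (Sum.map id e p) = Sum.map id e (D.next p) :=
  congrArg (fun q => Sum.map id e (D.next q))
    ((Equiv.sumCongr (Equiv.refl (D.X × Strand)) e).symm_apply_apply p)

end Cut

/-- A local picture with `n` strands and `m` holes, where a local picture with `m` strands can be
inserted. Each hole is a marked point. -/
structure Context (n m : ℕ) where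
  X : Type
  finX : Finite X
  sign : X → Sign
  next : Equiv.Perm (Port X (Fin m ⊕ Fin n))
  weight : Port X (Fin m ⊕ Fin n) → ℤ

namespace Context

variable {n m : ℕ}

/-- A context as a local picture, whose holes are ordinary marked points. -/
@[reducible]
def inner (K : Context n m) : Tangle ℤ n where
  X := K.X
  M := Fin m
  finX := K.finX
  finM := inferInstance
  sign := K.sign
  next := K.next
  weight := K.weight

/-- A context as an outside: the holes are the distinguished points, and the ends of the strands
are ordinary marked points. -/
@[reducible]
def outer (K : Context n m) : Tangle ℤ m where
  X := K.X
  M := Fin n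
  finX := K.finX
  finM := inferInstance
  sign := K.sign
  next := (Equiv.sumCongr (Equiv.refl _) (Equiv.sumComm (Fin m) (Fin n))).permCongr K.next
  weight p := K.weight (Sum.map id Sum.swap p)

theorem outer_next (K : Context n m) (q : K.inner.Segment) :
    K.outer.next (Sum.map id Sum.swap q) = Sum.map id Sum.swap (K.next q) :=
  congrArg (fun q => Sum.map id Sum.swap (K.next q)) <|
    (Equiv.sumCongr (Equiv.refl (K.X × Strand)) (Equiv.sumComm (Fin m) (Fin n))).symm_apply_apply q

/-- The holes of the context among the marked points of `Context.ext`. -/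
def extMarks (M : Type) (n m : ℕ) :
    (M ⊕ Fin n) ⊕ (Fin m ⊕ Fin n) ≃ ((M ⊕ Fin n) ⊕ Fin n) ⊕ Fin m where
  toFun
    | .inl x => .inl (.inl x)
    | .inr (.inl h) => .inr h
    | .inr (.inr k) => .inl (.inr k)
  invFun
    | .inl (.inl x) => .inl x
    | .inr h => .inr (.inl h)
    | .inl (.inr k) => .inr (.inr k)
  left_inv := by rintro (x | h | k) <;> rfl
  right_inv := by rintro ((x | k) | h) <;> rfl

/-- The ends of the strands of the context among the marked points of `Context.comp`. -/
def compMarks (M : Type) (n m : ℕ) :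
    (Fin n ⊕ Fin m) ⊕ (M ⊕ Fin m) ≃ (Fin m ⊕ (M ⊕ Fin m)) ⊕ Fin n where
  toFun
    | .inr x => .inl (.inr x)
    | .inl (.inr h) => .inl (.inl h)
    | .inl (.inl k) => .inr k
  invFun
    | .inl (.inr x) => .inr x
    | .inl (.inl h) => .inl (.inr h)
    | .inr k => .inl (.inl k)
  left_inv := by rintro ((k | h) | x) <;> rfl
  right_inv := by rintro ((h | x) | k) <;> rfl

/-- The outside obtained by inserting the context `K` in the outside `C`. -/
@[reducible]
def ext (C : Tangle ℤ n) (K : Context n m) : Tangle ℤ m :=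
  (C.glue K.inner).cut (extMarks C.M n m)

/-- The local picture obtained by inserting the local picture `L` in the context `K`. -/
@[reducible]
def comp (K : Context n m) (L : Tangle ℤ m) : Tangle ℤ n :=
  (K.outer.glue L).cut (compMarks L.M n m)

section Assoc

variable (C : Tangle ℤ n) (K : Context n m) (L : Tangle ℤ m)

/-- The correspondence of crossings in `Context.iso_ext_glue`. -/
def assocCrossings : ((ext C K).glue L).X ≃ (C.glue (K.comp L)).X := Equiv.sumAssoc C.X K.X L.X

/-- The correspondence of marked points in `Context.iso_ext_glue`. -/
def assocMarks : ((ext C K).glue L).M ≃ (C.glue (K.comp L)).M where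
  toFun
    | .inl (.inl (.inl x)) => .inl x
    | .inl (.inl (.inr k)) => .inr (.inr k)
    | .inl (.inr h) => .inr (.inl (.inl h))
    | .inr x => .inr (.inl (.inr x))
  invFun
    | .inl x => .inl (.inl (.inl x))
    | .inr (.inr k) => .inl (.inl (.inr k))
    | .inr (.inl (.inl h)) => .inl (.inr h)
    | .inr (.inl (.inr x)) => .inr x
  left_inv := by rintro (((x | k) | h) | x) <;> rfl
  right_inv := by rintro (x | (h | x) | k) <;> rfl

/-- The correspondence of ports in `Context.iso_ext_glue`. -/
def assocPort : Port ((ext C K).glue L).X ((ext C K).glue L).M →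
    Port (C.glue (K.comp L)).X (C.glue (K.comp L)).M :=
  Sum.map (Prod.map (assocCrossings C K L) id) (assocMarks C K L)

theorem assocPort_injective : Function.Injective (assocPort C K L) :=
  ((assocCrossings C K L).injective.prodMap Function.injective_id).sumMap
    (assocMarks C K L).injective

theorem sign_assocCrossings (x) :
    (C.glue (K.comp L)).sign (assocCrossings C K L x) = ((ext C K).glue L).sign x := by
  rcases x with (x | x) | x <;> rfl

/-- A segment of the outside `C` in `(ext C K).glue L`. -/
abbrev outerExt (p : C.Segment) : Port ((ext C K).glue L).X ((ext C K).glue L).M :=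
  (ext C K).outer L (Sum.map id (extMarks C.M n m) (C.outer K.inner p))

/-- A segment of the context `K` in `(ext C K).glue L`. -/
abbrev innerExt (p : K.inner.Segment) : Port ((ext C K).glue L).X ((ext C K).glue L).M :=
  (ext C K).outer L (Sum.map id (extMarks C.M n m) (C.inner K.inner p))

/-- A segment of the context `K` in `K.comp L`. -/
abbrev outerComp (p : K.inner.Segment) : (K.comp L).Segment :=
  Sum.map id (compMarks L.M n m) (K.outer.outer L (Sum.map id Sum.swap p))

/-- A segment of the local picture `L` in `K.comp L`. -/
abbrev innerComp (p : L.Segment) : (K.comp L).Segment :=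
  Sum.map id (compMarks L.M n m) (K.outer.inner L p)

theorem ext_glue_cases (p : Port ((ext C K).glue L).X ((ext C K).glue L).M) :
    (∃ q, outerExt C K L q = p) ∨ (∃ q, innerExt C K L q = p) ∨ ∃ q, (ext C K).inner L q = p := by
  rcases p with ⟨(x | x) | x, s⟩ | ((x | k) | h) | x
  · exact .inl ⟨.inl (x, s), rfl⟩
  · exact .inr (.inl ⟨.inl (x, s), rfl⟩)
  · exact .inr (.inr ⟨.inl (x, s), rfl⟩)
  · exact .inl ⟨.inr x, rfl⟩
  · exact .inr (.inl ⟨.inr (.inr k), rfl⟩)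
  · exact .inr (.inl ⟨.inr (.inl h), rfl⟩)
  · exact .inr (.inr ⟨.inr x, rfl⟩)

theorem assocPort_outerExt (q) :
    assocPort C K L (outerExt C K L q) = C.outer (K.comp L) q := by
  rcases q with ⟨x, s⟩ | x <;> rfl

theorem assocPort_innerExt (q) :
    assocPort C K L (innerExt C K L q) = C.inner (K.comp L) (outerComp K L q) := by
  rcases q with ⟨x, s⟩ | h | k <;> rfl

theorem assocPort_inner (q) :
    assocPort C K L ((ext C K).inner L q) = C.inner (K.comp L) (innerComp K L q) := by
  rcases q with ⟨x, s⟩ | x <;> rfl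

theorem strandStep_outerExt (p : C.Segment) :
    (ext C K).strandStep (Sum.map id (extMarks C.M n m) (C.outer K.inner p)) =
      splitHole (Sum.map id (extMarks C.M n m)
        (Sum.elim (C.outer K.inner) (fun k => C.inner K.inner (K.inner.hole k))
          (C.strandStep p))) :=
  congrArg splitHole <|
    ((C.glue K.inner).cut_next _ _).trans (congrArg _ (C.glue_next_outer K.inner p))

theorem strandStep_innerExt (p : K.inner.Segment) :
    (ext C K).strandStep (Sum.map id (extMarks C.M n m) (C.inner K.inner p)) =
      splitHole (Sum.map id (extMarks C.M n m)
        (Sum.elim (C.inner K.inner) (fun k => C.outer K.inner (C.hole k))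
          (K.inner.strandStep p))) :=
  congrArg splitHole <|
    ((C.glue K.inner).cut_next _ _).trans (congrArg _ (C.glue_next_inner K.inner p))

theorem strandStep_outerComp (p : K.inner.Segment) :
    (K.comp L).strandStep (outerComp K L p) =
      splitHole (Sum.map id (compMarks L.M n m)
        (Sum.elim (K.outer.outer L) (fun h => K.outer.inner L (L.hole h))
          (splitHole (Sum.map id Sum.swap (K.next p))))) :=
  congrArg splitHole <| ((K.outer.glue L).cut_next _ _).trans <| congrArg _ <|
    (K.outer.glue_next_outer L _).trans <| congrArg _ <| congrArg splitHole (outer_next K p)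

theorem strandStep_innerComp (p : L.Segment) :
    (K.comp L).strandStep (innerComp K L p) =
      splitHole (Sum.map id (compMarks L.M n m)
        (Sum.elim (K.outer.inner L) (fun h => K.outer.outer L (K.outer.hole h))
          (L.strandStep p))) :=
  congrArg splitHole <|
    ((K.outer.glue L).cut_next _ _).trans (congrArg _ (K.outer.glue_next_inner L p))

theorem next_assocPort (p) : (C.glue (K.comp L)).next (assocPort C K L p) =
    assocPort C K L (((ext C K).glue L).next p) := by
  obtain ⟨q, rfl⟩ | ⟨q, rfl⟩ | ⟨q, rfl⟩ := ext_glue_cases C K L p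
  · rw [assocPort_outerExt, Tangle.glue_next_outer, Tangle.glue_next_outer, strandStep_outerExt,
      Tangle.strandStep]
    rcases C.next q with ⟨x, s⟩ | x | k <;> rfl
  · rw [assocPort_innerExt, Tangle.glue_next_inner, Tangle.glue_next_outer, strandStep_innerExt,
      strandStep_outerComp, Tangle.strandStep]
    rcases K.next q with ⟨x, s⟩ | h | k <;> rfl
  · rw [assocPort_inner, Tangle.glue_next_inner, Tangle.glue_next_inner, strandStep_innerComp,
      Tangle.strandStep]
    rcases L.next q with ⟨x, s⟩ | x | h <;> rfl

theorem weight_assocPort (p) :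
    (C.glue (K.comp L)).weight (assocPort C K L p) = ((ext C K).glue L).weight p := by
  obtain ⟨q, rfl⟩ | ⟨q, rfl⟩ | ⟨q, rfl⟩ := ext_glue_cases C K L p
  · rcases q with ⟨x, s⟩ | x <;> rfl
  · rcases q with ⟨x, s⟩ | x | x <;> rfl
  · rcases q with ⟨x, s⟩ | x <;> rfl

theorem iso_ext_glue : Diagram.Iso ((ext C K).glue L) (C.glue (K.comp L)) :=
  ⟨assocCrossings C K L, assocMarks C K L, sign_assocCrossings C K L, next_assocPort C K L,
    weight_assocPort C K L⟩

theorem mk_ext_glue :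
    NormalOGraph.mk ((ext C K).glue L) = NormalOGraph.mk (C.glue (K.comp L)) :=
  Quot.sound (.inl (iso_ext_glue C K L))

/-- The marked point of `K.comp L` at the beginning of the `h`-th strand of `L`. -/
abbrev start (h : Fin m) : (K.comp L).Segment := innerComp K L (L.hole h)

theorem rotationBetween_ext {h h' : Fin m} {i j : Line} {p : ℚ}
    (hp : (C.glue (K.comp L)).RotationBetween
      (C.positionEquiv (K.comp L) (.inr (K.start L h, i)))
      (C.positionEquiv (K.comp L) (.inr (K.start L h', j))) p) :
    ((ext C K).glue L).RotationBetween ((ext C K).firstSegment L h, i)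
      ((ext C K).firstSegment L h', j) p := by
  have hstep (a) : (C.glue (K.comp L)).step (Prod.map (assocPort C K L) id a) =
      Prod.map (assocPort C K L) id (((ext C K).glue L).step a) :=
    Diagram.step_map (assocCrossings C K L) (assocMarks C K L) (sign_assocCrossings C K L)
      (next_assocPort C K L) a
  refine hp.of_semiconj ((assocPort_injective C K L).prodMap Function.injective_id)
    (fun a => (hstep a).symm) ?_ ?_
  · rintro ⟨q, i⟩
    simp only [Diagram.signedWeight, Prod.map, weight_assocPort, id]
  · intro a
    rw [Diagram.dot, Diagram.dot, hstep a]
    rfl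

end Assoc

end Context

/-! ### Rotation numbers of arcs -/

namespace Diagram

variable {D : Diagram ℤ} {a b : D.Position} {r : ℤ}

/-- Following the boundary of a 2-cell from `a` one arrives at `b`, and `r` is twice the rotation
number of the path to the first arrival, the weight at `a` included. -/
def IsArc (D : Diagram ℤ) (a b : D.Position) (r : ℤ) : Prop :=
  ∃ n, D.step^[n] a = b ∧ (∀ m < n, D.step^[m] a ≠ b) ∧
    ∑ m ∈ Finset.range n, D.rot (D.step^[m] a) = r

theorem IsArc.refl (a : D.Position) : D.IsArc a a 0 := ⟨0, rfl, by simp, rfl⟩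

theorem IsArc.cons (h : D.IsArc (D.step a) b r) (hab : a ≠ b) : D.IsArc a b (D.rot a + r) := by
  obtain ⟨n, hn, hne, rfl⟩ := h
  refine ⟨n + 1, hn, ?_, ?_⟩
  · rintro (_ | m) hm
    · exact hab
    · exact hne m (Nat.lt_of_succ_lt_succ hm)
  · rw [Finset.sum_range_succ', add_comm]
    rfl

/-- The two arcs between `a` and `b` make up a circuit, whose rotation number is `-1`. -/
theorem IsArc.complement (hD : D.Balanced) (hab : a ≠ b) (h : D.IsArc b a r) :
    D.IsArc a b (-2 - r) := by
  obtain ⟨n, rfl, hne, rfl⟩ := h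
  have hperiod := Function.isPeriodicPt_minimalPeriod D.step b
  have hpos := Function.minimalPeriod_pos_of_mem_periodicPts (D.step_injective.mem_periodicPts b)
  have hcircuit := hD (orbit D.step b)
  rw [← sum_range_minimalPeriod D.step_injective] at hcircuit
  set P := Function.minimalPeriod D.step b with hP
  have hlt : n < P := by
    by_contra! hle
    refine hne (n - P) (by omega) ?_
    conv_rhs => rw [← Nat.sub_add_cancel hle, Function.iterate_add_apply, hperiod.eq]
  have iterate_add (m : ℕ) : D.step^[m] (D.step^[n] b) = D.step^[n + m] b := by
    rw [add_comm, Function.iterate_add_apply]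
  refine ⟨P - n, ?_, fun m hm hmb => ?_, ?_⟩
  · rw [iterate_add, Nat.add_sub_of_le hlt.le, hperiod.eq]
  · rw [iterate_add] at hmb
    rcases Nat.eq_zero_or_pos (n + m) with h0 | h0
    · obtain rfl : n = 0 := by omega
      exact hab rfl
    · have := Function.IsPeriodicPt.minimalPeriod_le h0 hmb
      omega
  · rw [← Nat.add_sub_of_le hlt.le, Finset.sum_range_add] at hcircuit
    simp only [iterate_add]
    linarith

theorem IsArc.rotationBetween (h : D.IsArc a b r) (hweight : D.weight a.1 = 0) :
    D.RotationBetween a b ((r : ℚ) / 2) := by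
  obtain ⟨n, hn, hne, rfl⟩ := h
  have signedWeight_eq_zero : D.signedWeight a = 0 := by simp [signedWeight, hweight]
  have sum_Ioo : ∑ m ∈ Finset.Ioo 0 n, (D.signedWeight (D.step^[m] a) : ℚ) =
      ∑ m ∈ Finset.range n, (D.signedWeight (D.step^[m] a) : ℚ) := by
    refine Finset.sum_subset (fun m hm => Finset.mem_range.2 (Finset.mem_Ioo.1 hm).2)
      fun m hm hm' => ?_
    obtain rfl : m = 0 := by
      simp only [Finset.mem_range, Finset.mem_Ioo] at hm hm'
      omega
    simp [signedWeight_eq_zero]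
  refine ⟨n, hn, hne, ?_⟩
  rw [sum_Ioo]
  simp only [rot]
  push_cast
  rw [Finset.sum_sub_distrib, ← Finset.mul_sum]
  ring

end Diagram

namespace Tangle

variable {n : ℕ} (T : Tangle ℤ n) [DecidableEq T.X] [DecidableEq T.M]

/-- Twice the rotation number of the arc from `a` to `b`, if it consists of at most `N` steps inside
the local picture. -/
def rotTo (b : T.Position) : ℕ → T.Position → Option ℤ
  | 0, a => if a = b then some 0 else none
  | N + 1, a => if a = b then some 0 else
      (T.lineStep a).elim (fun c => (rotTo b N c).map (T.rot a + ·)) fun _ => none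

/-- Twice the rotation number of the arc from `a` to `b` in a framed diagram, if this arc or the
complementary one consists of at most `N` steps inside the local picture. -/
def rotation (N : ℕ) (a b : T.Position) : Option ℤ :=
  (T.rotTo b N a).or ((T.rotTo a N b).map (-2 - ·))

variable {T} {a b : T.Position} {N : ℕ} {r : ℤ}

theorem rotTo_self (N : ℕ) (a : T.Position) : T.rotTo a N a = some 0 := by
  cases N <;> exact if_pos rfl

theorem isArc_of_rotTo_eq_some (C : Tangle ℤ n) (h : T.rotTo b N a = some r) :
    (C.glue T).IsArc (C.positionEquiv T (.inr a)) (C.positionEquiv T (.inr b)) r := by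
  induction N generalizing a r with
  | zero =>
    obtain ⟨rfl, rfl⟩ : a = b ∧ 0 = r := by simpa [rotTo] using h
    exact .refl _
  | succ N ih =>
    rw [rotTo] at h
    split_ifs at h with hab
    · obtain rfl := hab
      exact Option.some_inj.1 h ▸ .refl _
    rcases hstep : T.lineStep a with c | e
    · rw [hstep, Sum.elim_inl, Option.map_eq_some_iff] at h
      obtain ⟨s, hs, rfl⟩ := h
      have step_inner : (C.glue T).step (C.positionEquiv T (.inr a)) =
          C.positionEquiv T (.inr c) := by
        rw [← C.semiconj_positionEquiv T, glueMap, Sum.elim_inr, hstep]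
        rfl
      rw [← C.rot_inner T a]
      exact .cons (step_inner ▸ ih hs) fun h => hab (Sum.inr.inj ((C.positionEquiv T).injective h))
    · simp [hstep] at h

theorem isArc_of_rotation_eq_some {C : Tangle ℤ n} (hT : (C.glue T).IsFramed)
    (h : T.rotation N a b = some r) :
    (C.glue T).IsArc (C.positionEquiv T (.inr a)) (C.positionEquiv T (.inr b)) r := by
  rw [rotation, Option.or_eq_some_iff] at h
  rcases h with h | ⟨hnone, h⟩
  · exact isArc_of_rotTo_eq_some C h
  · obtain ⟨s, hs, rfl⟩ := Option.map_eq_some_iff.1 h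
    have hab : a ≠ b := by
      rintro rfl
      simp [rotTo_self] at hnone
    exact (isArc_of_rotTo_eq_some C hs).complement ((Diagram.isFramed_iff _).1 hT).2.2.2
      fun h => hab (Sum.inr.inj ((C.positionEquiv T).injective h))

end Tangle

/-! ### Sequences of moves -/

theorem FramedIntegralNormalOGraph.isFramed {G : FramedIntegralNormalOGraph} {D : Diagram ℤ}
    (h : G.1 = NormalOGraph.mk D) : D.IsFramed := by
  obtain ⟨D', hD', hG⟩ := G.2
  exact (NormalOGraph.isFramed_iff_of_mk_eq (hG.trans h)).1 hD'

/-- The generating moves on framed integral normal o-graphs. -/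
def Generator.integralMove :
    Generator → FramedIntegralNormalOGraph → FramedIntegralNormalOGraph → Prop
  | primaryMP => IntegralPrimaryMP
  | slide t => IntegralSlide t
  | H => IntegralH

theorem Generator.framed_integralMove (g : Generator) : Framed g.integralMove = g.move := by
  cases g <;> rfl

/-- The analogue of `Derives` for framed integral normal o-graphs. -/
def IntegralDerives :
    List (Generator × Bool) → FramedIntegralNormalOGraph → FramedIntegralNormalOGraph → Prop
  | [], G, G' => G = G'
  | (g, true) :: w, G, G' => ∃ G₁, g.integralMove G G₁ ∧ IntegralDerives w G₁ G'
  | (g, false) :: w, G, G' => ∃ G₁, g.integralMove G₁ G ∧ IntegralDerives w G₁ G'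

namespace IntegralDerives

variable {w w' : List (Generator × Bool)} {G G' G'' : FramedIntegralNormalOGraph}

theorem proj (h : IntegralDerives w G G') : Derives w G.proj G'.proj := by
  induction w generalizing G with
  | nil => exact congrArg _ h
  | cons x w ih =>
    obtain ⟨g, _ | _⟩ := x <;> obtain ⟨G₁, hmove, hrest⟩ := h
    · exact ⟨G₁.proj, g.framed_integralMove ▸ ⟨G₁, G, hmove, rfl, rfl⟩, ih hrest⟩
    · exact ⟨G₁.proj, g.framed_integralMove ▸ ⟨G, G₁, hmove, rfl, rfl⟩, ih hrest⟩

theorem append (h : IntegralDerives w G G') (h' : IntegralDerives w' G' G'') :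
    IntegralDerives (w ++ w') G G'' := by
  induction w generalizing G with
  | nil => exact (show G = G' from h) ▸ h'
  | cons x w ih =>
    obtain ⟨g, _ | _⟩ := x <;> exact h.imp fun _ => And.imp_right ih

theorem symm (h : IntegralDerives w G G') :
    IntegralDerives (w.map (Prod.map id not)).reverse G' G := by
  induction w generalizing G with
  | nil => exact Eq.symm h
  | cons x w ih =>
    rw [List.map_cons, List.reverse_cons]
    obtain ⟨g, _ | _⟩ := x <;> obtain ⟨G₁, hmove, hrest⟩ := h <;>
      exact (ih hrest).append ⟨G, hmove, rfl⟩

end IntegralDerives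

namespace Tangle

variable {n m : ℕ} {T T' T'' : Tangle ℤ n}

/-- Replacing `T` by `T'` is a composition of generating moves, the same one for all framed integral
normal o-graphs. -/
def Reaches (T T' : Tangle ℤ n) : Prop :=
  ∃ w, ∀ G G', IntegralMove T T' G G' → IntegralDerives w G G'

/-- Besides `T.Reaches T'`, the inverse replacement preserves framed diagrams. Intermediate diagrams
of a sequence of replacements are therefore framed if the last one is. -/
structure Links (T T' : Tangle ℤ n) : Prop where
  isFramed_glue : ∀ C : Tangle ℤ n, (C.glue T').IsFramed → (C.glue T).IsFramed
  reaches : T.Reaches T'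

theorem Reaches.symm (h : T.Reaches T') : T'.Reaches T :=
  h.imp' _ fun _ hw G G' ⟨C, hG, hG'⟩ => (hw G' G ⟨C, hG', hG⟩).symm

theorem Reaches.trans (h : T.Reaches T') (h' : T'.Links T'') : T.Reaches T'' := by
  obtain ⟨w, hw⟩ := h
  obtain ⟨w', hw'⟩ := h'.reaches
  refine ⟨w ++ w', fun G G'' ⟨C, hG, hG''⟩ => ?_⟩
  have framed := h'.isFramed_glue C (FramedIntegralNormalOGraph.isFramed hG'')
  let G' : FramedIntegralNormalOGraph := ⟨.mk (C.glue T'), _, framed, rfl⟩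
  exact (hw G G' ⟨C, hG, rfl⟩).append (hw' G' G'' ⟨C, rfl, hG''⟩)

theorem Reaches.congr_left
    (h : ∀ C : Tangle ℤ n, NormalOGraph.mk (C.glue T) = NormalOGraph.mk (C.glue T'))
    (h' : T'.Reaches T'') : T.Reaches T'' :=
  h'.imp fun _ hw G G' ⟨C, hG, hG'⟩ => hw G G' ⟨C, hG.trans (h C), hG'⟩

theorem Links.trans (h : T.Links T') (h' : T'.Links T'') : T.Links T'' :=
  ⟨fun C hC => h.isFramed_glue C (h'.isFramed_glue C hC), h.reaches.trans h'⟩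

theorem Links.of_mk_eq
    (h : ∀ C : Tangle ℤ n, NormalOGraph.mk (C.glue T) = NormalOGraph.mk (C.glue T')) : T.Links T' :=
  ⟨fun C => (NormalOGraph.isFramed_iff_of_mk_eq (h C)).2, [], fun _ _ ⟨C, hG, hG'⟩ =>
    Subtype.ext (hG.trans ((h C).trans hG'.symm))⟩

theorem Links.comp {L L' : Tangle ℤ m} (h : L.Links L') (K : Context n m) :
    (K.comp L).Links (K.comp L') where
  isFramed_glue C hC := (NormalOGraph.isFramed_iff_of_mk_eq (Context.mk_ext_glue C K L)).1 <|
    h.isFramed_glue _ ((NormalOGraph.isFramed_iff_of_mk_eq (Context.mk_ext_glue C K L')).2 hC)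
  reaches := h.reaches.imp fun _ hw G G' ⟨C, hG, hG'⟩ => hw G G'
    ⟨Context.ext C K, hG.trans (Context.mk_ext_glue C K L).symm,
      hG'.trans (Context.mk_ext_glue C K L').symm⟩

theorem links_hPicture (ε : Sign) : (hPicture ε [1, -1]).Links (hPicture ε []) where
  isFramed_glue := hPicture_isFramed_glue ε
  reaches := ⟨[(.H, false)], fun _ G' ⟨C, hG, hG'⟩ => ⟨G', ⟨ε, C, hG', hG⟩, rfl⟩⟩

theorem Reaches.comp_slide {K : Context n 2} {t : SlideType} {N : ℕ} {r a : ℤ}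
    [DecidableEq (K.comp (slideLeft 0 0)).X] [DecidableEq (K.comp (slideLeft 0 0)).M]
    (hr : (K.comp (slideLeft 0 0)).rotation N (K.start (slideLeft 0 0) 0, t.leftLine)
      (K.start (slideLeft 0 0) 1, t.rightLine) = some r)
    (hweight : (K.comp (slideLeft 0 0)).weight (K.start (slideLeft 0 0) 0) = 0)
    (ha : t.IsShift ((r : ℚ) / 2) a) :
    (K.comp (slideLeft 0 0)).Reaches (K.comp (slideRight t 0 0 a)) := by
  refine ⟨[(.slide t, true)], fun G G' ⟨C, hG, hG'⟩ => ⟨G', ?_, rfl⟩⟩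
  have harc := isArc_of_rotation_eq_some (FramedIntegralNormalOGraph.isFramed hG) hr
  exact ⟨Context.ext C K, 0, 0, a, _, Context.rotationBetween_ext C K _
    (harc.rotationBetween ((C.glue_weight_inner _ _).trans hweight)), ha,
    hG.trans (Context.mk_ext_glue C K _).symm, hG'.trans (Context.mk_ext_glue C K _).symm⟩

end Tangle

theorem MPType.links_right_left {t : MPType} (h : t.left.Reaches t.right) : t.right.Links t.left :=
  ⟨t.isFramed_glue, h.symm⟩

instance (t : SlideType) (p : ℚ) (a : ℤ) : Decidable (t.IsShift p a) := by
  cases t <;> unfold SlideType.IsShift <;> infer_instance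

section Instances

variable (k l a : ℤ) (t : SlideType)

instance : Fintype (slideLeft k l).X := inferInstanceAs (Fintype (Fin 0))
instance : DecidableEq (slideLeft k l).X := inferInstanceAs (DecidableEq (Fin 0))
instance : Fintype (slideLeft k l).M := inferInstanceAs (Fintype Empty)
instance : DecidableEq (slideLeft k l).M := inferInstanceAs (DecidableEq Empty)
instance : Fintype (slideRight t k l a).X := by cases t <;> exact inferInstanceAs (Fintype (Fin 2))
instance : DecidableEq (slideRight t k l a).X := by
  cases t <;> exact inferInstanceAs (DecidableEq (Fin 2))
instance : Fintype (slideRight t k l a).M := by cases t <;> exact inferInstanceAs (Fintype Empty)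

end Instances

namespace Context

variable {n m c : ℕ}

instance (K : Context n m) (L : Tangle ℤ m) [Fintype K.X] [Fintype L.X] : Fintype (K.comp L).X :=
  inferInstanceAs (Fintype (K.X ⊕ L.X))
instance (K : Context n m) (L : Tangle ℤ m) [DecidableEq K.X] [DecidableEq L.X] :
    DecidableEq (K.comp L).X :=
  inferInstanceAs (DecidableEq (K.X ⊕ L.X))
instance (K : Context n m) (L : Tangle ℤ m) [Fintype L.M] : Fintype (K.comp L).M :=
  inferInstanceAs (Fintype (Fin m ⊕ (L.M ⊕ Fin m)))
instance (K : Context n m) (L : Tangle ℤ m) [DecidableEq L.M] : DecidableEq (K.comp L).M :=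
  inferInstanceAs (DecidableEq (Fin m ⊕ (L.M ⊕ Fin m)))

/-- The segments of the `k`-th strand, if it runs successively through the given crossings and
holes. -/
def segments (k : Fin n) (word : List (Fin c × Strand ⊕ Fin m)) :
    List (Port (Fin c) (Fin m ⊕ Fin n)) :=
  .inr (.inr k) :: word.map (Sum.map id .inl)

/-- The context with crossings of the given signs, the `k`-th strand of which runs successively
through the crossings and holes listed in `word k`. Its successive segments carry the weights listed
in `wt k`; missing entries are `0`. -/
def ofWords (sign : Fin c → Sign) (word : Fin n → List (Fin c × Strand ⊕ Fin m))
    (wt : Fin n → List ℤ) : Context n m where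
  X := Fin c
  finX := inferInstance
  sign := sign
  next := (List.ofFn fun k => (segments k (word k)).formPerm).prod
  weight p := ∑ k, (wt k).getD ((segments k (word k)).idxOf p) 0

variable (sign : Fin c → Sign) (word : Fin n → List (Fin c × Strand ⊕ Fin m)) (wt : Fin n → List ℤ)

instance : Fintype (ofWords sign word wt).X := inferInstanceAs (Fintype (Fin c))
instance : DecidableEq (ofWords sign word wt).X := inferInstanceAs (DecidableEq (Fin c))

end Context

/-- The data of a reduction of the MP move `t` to the MP move `u`. The words `slideWord` describe
the left picture of `t` with two holes, where a pure sliding move is made. The result should be the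
right picture of `u` inserted in a picture with a single crossing, which is given by `sign`,
`moveWord` and `moveWeight`. -/
structure SlideReduction (t u : MPType) where
  slide : SlideType
  shift : ℤ
  slideWord : Fin 3 → List (Fin 2 × Strand ⊕ Fin 2)
  sign : Sign
  moveWord : Fin 3 → List (Fin 1 × Strand ⊕ Fin 3)
  moveWeight : Fin 3 → List ℤ

namespace SlideReduction

variable {t u : MPType} (S : SlideReduction t u)

/-- The left picture of `t`, with holes for the slide. -/
abbrev slideContext : Context 3 2 := .ofWords t.data.leftSign S.slideWord fun _ => []

/-- The surroundings of the place where the inverse of `u` is applied. -/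
abbrev moveContext : Context 3 3 := .ofWords (fun _ => S.sign) S.moveWord S.moveWeight

/-- The picture before the slide. -/
abbrev before : Tangle ℤ 3 := S.slideContext.comp (slideLeft 0 0)

/-- The picture after the slide. -/
abbrev after : Tangle ℤ 3 := S.slideContext.comp (slideRight S.slide 0 0 S.shift)

/-- The picture after the slide and the inverse of `u`. -/
abbrev result : Tangle ℤ 3 := S.moveContext.comp u.left

/-- The slide of `S` is permitted, and the inverse of `u` can be applied after it. -/
def IsValid : Prop :=
  t.left.SameCode S.before 8 ∧ S.after.SameCode (S.moveContext.comp u.right) 12 ∧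
    S.before.weight (S.slideContext.start (slideLeft 0 0) 0) = 0 ∧
    ∃ r ∈ S.before.rotation 4 (S.slideContext.start (slideLeft 0 0) 0, S.slide.leftLine)
      (S.slideContext.start (slideLeft 0 0) 1, S.slide.rightLine),
      S.slide.IsShift ((r : ℚ) / 2) S.shift

set_option synthInstance.maxSize 1000 in
instance : Decidable S.IsValid :=
  inferInstanceAs (Decidable (_ ∧ _ ∧ _ ∧ _))

variable {S} in
theorem IsValid.reaches_result (hS : S.IsValid) (hu : u.left.Reaches u.right) :
    t.left.Reaches S.result := by
  obtain ⟨hbefore, hafter, hweight, r, hr, hshift⟩ := hS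
  have hslide : S.before.Reaches S.after := .comp_slide hr hweight hshift
  exact ((hslide.congr_left hbefore.mk_glue_eq).trans (.of_mk_eq hafter.mk_glue_eq)).trans
    ((MPType.links_right_left hu).comp _)

theorem reaches (hS : S.IsValid) (hu : u.left.Reaches u.right) (h : S.result.SameCode t.right 12) :
    t.left.Reaches t.right :=
  (hS.reaches_result hu).trans (.of_mk_eq h.mk_glue_eq)

theorem reaches_of_H (hS : S.IsValid) (hu : u.left.Reaches u.right) {ε : Sign} {K : Context 3 2}
    [DecidableEq K.X] (hbefore : S.result.SameCode (K.comp (hPicture ε [1, -1])) 12)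
    (hafter : (K.comp (hPicture ε [])).SameCode t.right 12) : t.left.Reaches t.right :=
  (hS.reaches_result hu).trans <| (Tangle.Links.of_mk_eq hbefore.mk_glue_eq).trans <|
    ((Tangle.links_hPicture ε).comp K).trans (.of_mk_eq hafter.mk_glue_eq)

end SlideReduction

/-! ### Reductions of the MP moves -/

/-- The local picture before the primary MP move. -/
abbrev primaryLeft : Tangle ℤ 3 :=
  Tangle.ofWords (n := 3) (c := 2) (fun _ => .pos)
    ![[(0, .upper)], [(1, .upper), (0, .lower)], [(1, .lower)]] fun _ => []

/-- The local picture after the primary MP move. -/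
abbrev primaryRight : Tangle ℤ 3 :=
  Tangle.ofWords (n := 3) (c := 3) (fun _ => .pos)
    ![[(0, .upper), (1, .upper)], [(0, .lower), (2, .upper)], [(1, .lower), (2, .lower)]]
    fun _ => []

/-- The exchange of the first and the third of three strands. -/
abbrev reverseContext : Context 3 3 :=
  .ofWords (Fin.elim0 : Fin 0 → Sign) ![[.inr 2], [.inr 1], [.inr 0]] fun _ => []

namespace MPType

theorem reaches_D2 : D2.left.Reaches D2.right := by
  have hleft : D2.left.SameCode (reverseContext.comp primaryLeft) 12 := by decide +kernel
  have hright : D2.right.SameCode (reverseContext.comp primaryRight) 12 := by decide +kernel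
  exact ⟨[(.primaryMP, true)], fun _ G' ⟨C, hG, hG'⟩ => ⟨G',
    ⟨Context.ext C reverseContext,
      hG.trans ((hleft.mk_glue_eq C).trans (Context.mk_ext_glue C _ primaryLeft).symm),
      hG'.trans ((hright.mk_glue_eq C).trans (Context.mk_ext_glue C _ primaryRight).symm)⟩,
    rfl⟩⟩

theorem reaches_A1 : A1.left.Reaches A1.right :=
  SlideReduction.reaches
    { slide := .I
      shift := 0
      slideWord := ![[.inl (1, .lower), .inr 1], [.inl (0, .lower), .inr 0],
        [.inl (0, .upper), .inl (1, .upper)]]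
      sign := .neg
      moveWord := ![[.inr 0, .inl (0, .lower)], [.inr 1, .inl (0, .upper)], [.inr 2]]
      moveWeight := fun _ => [] }
    (by decide +kernel) reaches_D2 (by decide +kernel)

theorem reaches_B3 : B3.left.Reaches B3.right :=
  SlideReduction.reaches
    { slide := .II
      shift := 0
      slideWord := ![[.inl (0, .lower), .inl (1, .lower)], [.inr 0, .inl (1, .upper)],
        [.inr 1, .inl (0, .upper)]]
      sign := .neg
      moveWord := ![[.inr 0], [.inl (0, .lower), .inr 1], [.inl (0, .upper), .inr 2]]
      moveWeight := fun _ => [] }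
    (by decide +kernel) reaches_D2 (by decide +kernel)

theorem reaches_C1 : C1.left.Reaches C1.right :=
  SlideReduction.reaches
    { slide := .I
      shift := 0
      slideWord := ![[.inl (1, .lower)], [.inl (0, .lower), .inl (1, .upper), .inr 1],
        [.inl (0, .upper), .inr 0]]
      sign := .neg
      moveWord := ![[.inr 0], [.inr 1, .inl (0, .lower)], [.inr 2, .inl (0, .upper)]]
      moveWeight := fun _ => [] }
    (by decide +kernel) reaches_B3 (by decide +kernel)

theorem reaches_C3 : C3.left.Reaches C3.right :=
  SlideReduction.reaches
    { slide := .III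
      shift := -1
      slideWord := ![[.inr 1, .inl (1, .lower)], [.inl (0, .lower), .inl (1, .upper)],
        [.inl (0, .upper), .inr 0]]
      sign := .neg
      moveWord := ![[.inl (0, .lower), .inr 0], [.inr 1], [.inr 2, .inl (0, .upper)]]
      moveWeight := ![[-1, 1, 0], [], []] }
    (by decide +kernel) reaches_D2 (by decide +kernel)

theorem reaches_C4 : C4.left.Reaches C4.right :=
  SlideReduction.reaches
    { slide := .II
      shift := 0
      slideWord := ![[.inr 0, .inl (1, .lower)], [.inr 1, .inl (0, .lower), .inl (1, .upper)],
        [.inl (0, .upper)]]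
      sign := .neg
      moveWord := ![[.inl (0, .lower), .inr 0], [.inl (0, .upper), .inr 1], [.inr 2]]
      moveWeight := fun _ => [] }
    (by decide +kernel) reaches_A1 (by decide +kernel)

theorem reaches_D1 : D1.left.Reaches D1.right :=
  SlideReduction.reaches
    { slide := .I
      shift := 0
      slideWord := ![[.inl (1, .lower), .inr 1], [.inl (1, .upper), .inl (0, .lower)],
        [.inl (0, .upper), .inr 0]]
      sign := .neg
      moveWord := ![[.inr 0, .inl (0, .lower)], [.inr 1], [.inr 2, .inl (0, .upper)]]
      moveWeight := fun _ => [] }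
    (by decide +kernel) reaches_C4 (by decide +kernel)

theorem reaches_D4 : D4.left.Reaches D4.right :=
  SlideReduction.reaches
    { slide := .II
      shift := 0
      slideWord := ![[.inr 0, .inl (1, .lower)], [.inr 1, .inl (0, .upper)],
        [.inl (1, .upper), .inl (0, .lower)]]
      sign := .neg
      moveWord := ![[.inl (0, .lower), .inr 0], [.inl (0, .upper), .inr 2], [.inr 1]]
      moveWeight := fun _ => [] }
    (by decide +kernel) reaches_C1 (by decide +kernel)

theorem reaches_A2 : A2.left.Reaches A2.right :=
  SlideReduction.reaches
    { slide := .IV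
      shift := -1
      slideWord := ![[.inr 0, .inl (1, .lower)], [.inl (0, .lower), .inr 1],
        [.inl (0, .upper), .inl (1, .upper)]]
      sign := .pos
      moveWord := ![[.inl (0, .lower), .inr 0], [.inr 1, .inl (0, .upper)], [.inr 2]]
      moveWeight := ![[], [0, -1, 1], []] }
    (by decide +kernel) reaches_D1 (by decide +kernel)

theorem reaches_A3 : A3.left.Reaches A3.right :=
  SlideReduction.reaches
    { slide := .I
      shift := 0
      slideWord := ![[.inl (1, .lower), .inr 1], [.inl (1, .upper), .inl (0, .upper)],
        [.inl (0, .lower), .inr 0]]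
      sign := .neg
      moveWord := ![[.inr 0, .inl (0, .lower)], [.inr 1], [.inr 2, .inl (0, .upper)]]
      moveWeight := fun _ => [] }
    (by decide +kernel) reaches_D4 (by decide +kernel)

theorem reaches_A4 : A4.left.Reaches A4.right :=
  SlideReduction.reaches_of_H
    { slide := .IV
      shift := 0
      slideWord := ![[.inl (1, .lower), .inr 0], [.inr 1, .inl (0, .lower)],
        [.inl (1, .upper), .inl (0, .upper)]]
      sign := .neg
      moveWord := ![[.inr 0, .inl (0, .lower)], [.inl (0, .upper), .inr 1], [.inr 2]]
      moveWeight := ![[], [1, -1, 0], []] }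
    (by decide +kernel) reaches_C1 (ε := .neg)
    (K := .ofWords ![.neg, .pos]
      ![[.inl (1, .lower), .inr 1], [.inr 0, .inl (0, .lower), .inl (1, .upper)],
        [.inl (0, .upper)]]
      ![[0, -1, 1], [], []])
    (by decide +kernel) (by decide +kernel)

theorem reaches_B1 : B1.left.Reaches B1.right :=
  SlideReduction.reaches
    { slide := .II
      shift := 0
      slideWord := ![[.inl (1, .lower), .inl (0, .lower)], [.inr 0, .inl (1, .upper)],
        [.inr 1, .inl (0, .upper)]]
      sign := .neg
      moveWord := ![[.inr 0], [.inl (0, .lower), .inr 1], [.inl (0, .upper), .inr 2]]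
      moveWeight := fun _ => [] }
    (by decide +kernel) reaches_D1 (by decide +kernel)

theorem reaches_B2 : B2.left.Reaches B2.right :=
  SlideReduction.reaches_of_H
    { slide := .IV
      shift := 0
      slideWord := ![[.inl (1, .lower), .inl (0, .lower)], [.inl (1, .upper), .inr 0],
        [.inr 1, .inl (0, .upper)]]
      sign := .neg
      moveWord := ![[.inr 0], [.inr 1, .inl (0, .lower)], [.inl (0, .upper), .inr 2]]
      moveWeight := ![[], [], [1, -1, 0]] }
    (by decide +kernel) reaches_C4 (ε := .neg)
    (K := .ofWords ![.pos, .neg]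
      ![[.inl (1, .lower)], [.inl (0, .lower), .inl (1, .upper), .inr 1],
        [.inr 0, .inl (0, .upper)]]
      ![[], [0, 0, -1, 1], []])
    (by decide +kernel) (by decide +kernel)

theorem reaches_B4 : B4.left.Reaches B4.right :=
  SlideReduction.reaches
    { slide := .IV
      shift := -1
      slideWord := ![[.inl (0, .lower), .inl (1, .lower)], [.inl (0, .upper), .inr 1],
        [.inr 0, .inl (1, .upper)]]
      sign := .pos
      moveWord := ![[.inr 0], [.inr 1, .inl (0, .upper)], [.inl (0, .lower), .inr 2]]
      moveWeight := ![[], [0, -1, 1], []] }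
    (by decide +kernel) reaches_D4 (by decide +kernel)

theorem reaches_C2 : C2.left.Reaches C2.right :=
  SlideReduction.reaches
    { slide := .II
      shift := 0
      slideWord := ![[.inr 0, .inl (1, .lower)], [.inr 1, .inl (0, .lower), .inl (1, .upper)],
        [.inl (0, .upper)]]
      sign := .neg
      moveWord := ![[.inl (0, .lower), .inr 0], [.inl (0, .upper), .inr 2], [.inr 1]]
      moveWeight := fun _ => [] }
    (by decide +kernel) reaches_A3 (by decide +kernel)

theorem reaches_D3 : D3.left.Reaches D3.right :=
  SlideReduction.reaches_of_H
    { slide := .III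
      shift := 0
      slideWord := ![[.inl (1, .lower), .inr 1], [.inl (1, .upper), .inl (0, .lower)],
        [.inr 0, .inl (0, .upper)]]
      sign := .pos
      moveWord := ![[.inr 0, .inl (0, .lower)], [.inr 1], [.inl (0, .upper), .inr 2]]
      moveWeight := ![[0, 1, -1], [], []] }
    (by decide +kernel) reaches_C2 (ε := .pos)
    (K := .ofWords ![.neg, .neg]
      ![[.inl (1, .lower), .inr 1], [.inl (0, .lower), .inl (1, .upper)],
        [.inr 0, .inl (0, .upper)]]
      ![[], [], [-1, 1, 0]])
    (by decide +kernel) (by decide +kernel)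

theorem reaches (t : MPType) : t.left.Reaches t.right := by
  cases t
  case A1 => exact reaches_A1
  case A2 => exact reaches_A2
  case A3 => exact reaches_A3
  case A4 => exact reaches_A4
  case B1 => exact reaches_B1
  case B2 => exact reaches_B2
  case B3 => exact reaches_B3
  case B4 => exact reaches_B4
  case C1 => exact reaches_C1
  case C2 => exact reaches_C2
  case C3 => exact reaches_C3
  case C4 => exact reaches_C4
  case D1 => exact reaches_D1
  case D2 => exact reaches_D2
  case D3 => exact reaches_D3
  case D4 => exact reaches_D4

end MPType

end OGraph

theorem mainTheorem10_general (t : OGraph.MPType) :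
    ∃ w : List (OGraph.Generator × Bool), ∀ G G' : OGraph.FramedIntegralNormalOGraph,
      OGraph.IntegralMP t G G' → OGraph.IntegralDerives w G G' :=
  t.reaches

/-- Each of the 16 framed MP moves is derived as a sequence (depending only on the type of the
move) of the primary framed MP move, the framed pure sliding moves, the framed H-move, and their
inverses. -/
theorem mainTheorem10 (t : OGraph.MPType) :
    ∃ w : List (OGraph.Generator × Bool), ∀ Γ Γ' : OGraph.FramedNormalOGraph,
      OGraph.FramedMP t Γ Γ' → OGraph.Derives w Γ Γ' := by
  obtain ⟨w, hw⟩ := mainTheorem10_general t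
  refine ⟨w, ?_⟩
  rintro _ _ ⟨G, G', hmove, rfl, rfl⟩
  exact (hw G G' hmove).proj
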